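/- All graphs are finite, simple, undirected and connected. Let $s\ge 1$. An $s$-arc of a graph $\Gamma$ is a sequence $(u_0,\dots,u_s)$ of vertices with $u_i$ adjacent to $u_{i+1}$ for $0\le i<s$ and $u_{j-1}\ne u_{j+1}$ for $1\le j\le s-1$; it is an $s$-geodesic if the distance of $u_0$ and $u_s$ is $s$. The graph $\Gamma$ is $s$-geodesic transitive if its full automorphism group is transitive on the vertices and, for each $1\le i\le s$, $\Gamma$ has an $i$-geodesic and $\mathrm{Aut}(\Gamma)$ is transitive on the set of $i$-geodesics. $\Gamma$ is distance transitive if, whenever $d(u,v)=d(x,y)$, some automorphism maps $(u,v)$ to $(x,y)$. An orbital graph of a group $G$ acting on a set $\Omega$ is a graph on $\Omega$ whose edge set is the $G$-orbit of a pair $\{\alpha,\beta\}$ of distinct points. $\mathrm{Cay}(G,S)$ denotes the Cayley graph of $G$ with connection set $S$. **Lemma.** (1) For $q\in\{13,17,25\}$, the Paley graph $P(q)$ (vertex set $\mathbb F_q$; $u,v$ adjacent if and only if $u-v$ is a nonzero square) is $1$-geodesic transitive but not $2$-geodesic transitive. (2) Each of the following graphs is $2$-geodesic transitive but not $3$-geodesic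 transitive: - $\mathcal G_{22,6}=\mathrm{Cay}(G,S)$ with $G=\langle a,b\mid a^{11}=b^2=1,\ a^b=a^{-1}\rangle\cong D_{22}$ and $S=\{b,a^2b,a^6b,a^7b,a^8b,a^{10}b\}$; - $\mathcal G_{64,8}=\mathrm{Cay}(G,S)$ with $G=\langle a,b,c,d\mid a^2=b^4=c^4=d^2=1,\ b^a=b^{-1},\ c^a=c^{-1},\ [a,d]=[b,c]=[b,d]=[c,d]=1\rangle$ (of order $64$) and $S=\{a,\ ab,\ abc,\ abd,\ ab^3c^3d,\ ab^2c^3,\ ac^2d,\ ac^3d\}$; - $\mathcal G_{68,12}$, which is any connected distance transitive graph of valency $12$ among the orbital graphs of $G=\mathrm{P\Gamma L}_2(16)$ acting on the cosets of a subgroup $H$ of index $68$ in $G$. Such $H$ and such a graph exist. (3) Let $A=\mathrm{Aut}(\mathrm{PSL}_3(4))$. The graph $\mathcal G_{280,9}$, which is any connected distance transitive graph of valency $9$ among the orbital graphs of $A$ acting on the cosets of a maximal subgroup $H$ of index $280$ in $A$, is $3$-geodesic transitive but not $4$-geodesic transitive. Such $H$ and such a graph exist. -/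

import Mathlib

open scoped LinearAlgebra.Projectivization

/-! ### Arcs, geodesics, geodesic transitivity, distance transitivity -/

/-- `(p 0, …, p s)` is an `s`-arc of `Γ`: consecutive vertices are adjacent and
`p (j - 1) ≠ p (j + 1)` for `1 ≤ j ≤ s - 1`. -/
structure IsArc {V : Type*} (Γ : SimpleGraph V) (s : ℕ) (p : Fin (s + 1) → V) : Prop where
  adj : ∀ i : Fin s, Γ.Adj (p i.castSucc) (p i.succ)
  ne : ∀ (j : ℕ) (h : j + 2 < s + 1), p ⟨j, by omega⟩ ≠ p ⟨j + 2, h⟩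

/-- An `s`-geodesic is an `s`-arc whose end vertices are at distance `s`. -/
def IsGeodesic {V : Type*} (Γ : SimpleGraph V) (s : ℕ) (p : Fin (s + 1) → V) : Prop :=
  IsArc Γ s p ∧ Γ.dist (p 0) (p (Fin.last s)) = s

/-- The full automorphism group of `Γ` is transitive on the vertices and, for each `1 ≤ i ≤ s`,
there is an `i`-geodesic and the automorphism group is transitive on the `i`-geodesics. -/
def IsGeodesicTransitive {V : Type*} (Γ : SimpleGraph V) (s : ℕ) : Prop :=
  (∀ u v : V, ∃ φ : Γ ≃g Γ, φ u = v) ∧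
  ∀ i : ℕ, 1 ≤ i → i ≤ s →
    (∃ p : Fin (i + 1) → V, IsGeodesic Γ i p) ∧
    ∀ p q : Fin (i + 1) → V, IsGeodesic Γ i p → IsGeodesic Γ i q →
      ∃ φ : Γ ≃g Γ, ∀ j, φ (p j) = q j

/-- Any two pairs of vertices at the same distance are equivalent under the automorphism group
(used for connected graphs). -/
def IsDistanceTransitive {V : Type*} (Γ : SimpleGraph V) : Prop :=
  ∀ u v x y : V, Γ.dist u v = Γ.dist x y → ∃ φ : Γ ≃g Γ, φ u = x ∧ φ v = y

/-! ### Orbital graphs -/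

/-- `Γ` is an (undirected) orbital graph of the action of `G` on `Ω`: its edges are the images
under `G` of one pair `{a, b}` of distinct points. -/
def IsOrbitalGraph (G : Type*) {Ω : Type*} [Group G] [MulAction G Ω] (Γ : SimpleGraph Ω) : Prop :=
  ∃ a b : Ω, a ≠ b ∧ ∀ x y : Ω,
    Γ.Adj x y ↔ ∃ g : G, (g • a = x ∧ g • b = y) ∨ (g • a = y ∧ g • b = x)

/-- `Γ` is a connected distance transitive graph of valency `k` among the orbital graphs of `G`
acting on the cosets of `H`. -/
structure IsDistanceTransitiveOrbitalGraph {G : Type*} [Group G] (H : Subgroup G) (k : ℕ)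
    (Γ : SimpleGraph (G ⧸ H)) : Prop where
  orbital : IsOrbitalGraph G Γ
  connected : Γ.Connected
  distanceTransitive : IsDistanceTransitive Γ
  valency : ∀ v, (Γ.neighborSet v).ncard = k

/-! ### Paley graphs -/

/-- The Paley graph of a finite field `F` of order `q ≡ 1 (mod 4)`: `u` and `v` are adjacent iff
`u - v` is a nonzero square. -/
def paleyGraph (F : Type*) [Field F] [Fintype F] (hF : Fintype.card F % 4 = 1) :
    SimpleGraph F where
  Adj u v := u - v ≠ 0 ∧ IsSquare (u - v)
  symm := ⟨fun u v h => by
    have h1 : IsSquare (-1 : F) := FiniteField.isSquare_neg_one_iff.mpr (by omega)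
    have h2 : v - u = -1 * (u - v) := by ring
    refine ⟨sub_ne_zero.mpr (sub_ne_zero.mp h.1).symm, ?_⟩
    rw [h2]
    exact h1.mul h.2⟩
  loopless := ⟨fun u h => h.1 (sub_self u)⟩

/-! ### The graph `𝒢₂₂,₆` -/

/-- The Cayley graph of the dihedral group `⟨a, b | a¹¹ = b² = 1, a^b = a⁻¹⟩` of order 22 with
connection set `{b, a²b, a⁶b, a⁷b, a⁸b, a¹⁰b}`. -/
def graph22 : SimpleGraph (DihedralGroup 11) :=
  let a : DihedralGroup 11 := DihedralGroup.r 1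
  let b : DihedralGroup 11 := DihedralGroup.sr 0
  SimpleGraph.mulCayley {b, a ^ 2 * b, a ^ 6 * b, a ^ 7 * b, a ^ 8 * b, a ^ 10 * b}

/-! ### The graph `𝒢₆₄,₈` -/

/-- The relators of `a² = b⁴ = c⁴ = d² = 1`, `b^a = b⁻¹`, `c^a = c⁻¹`,
`[a, d] = [b, c] = [b, d] = [c, d] = 1`, where `a, b, c, d` are the free generators
number `0, 1, 2, 3`. -/
def relators64 : Set (FreeGroup (Fin 4)) :=
  let a := FreeGroup.of (0 : Fin 4)
  let b := FreeGroup.of (1 : Fin 4)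
  let c := FreeGroup.of (2 : Fin 4)
  let d := FreeGroup.of (3 : Fin 4)
  {a ^ 2, b ^ 4, c ^ 4, d ^ 2, a⁻¹ * b * a * b, a⁻¹ * c * a * c, a⁻¹ * d⁻¹ * a * d,
    b⁻¹ * c⁻¹ * b * c, b⁻¹ * d⁻¹ * b * d, c⁻¹ * d⁻¹ * c * d}

/-- The nonabelian group of order 64 presented by `relators64`. -/
abbrev Group64 : Type := PresentedGroup relators64

/-- The Cayley graph of `Group64` with connection set
`{a, ab, abc, abd, ab³c³d, ab²c³, ac²d, ac³d}`. -/
def graph64 : SimpleGraph Group64 :=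
  let a : Group64 := PresentedGroup.of 0
  let b : Group64 := PresentedGroup.of 1
  let c : Group64 := PresentedGroup.of 2
  let d : Group64 := PresentedGroup.of 3
  SimpleGraph.mulCayley {a, a * b, a * b * c, a * b * d, a * b ^ 3 * c ^ 3 * d,
    a * b ^ 2 * c ^ 3, a * c ^ 2 * d, a * c ^ 3 * d}

/-! ### The groups `PΓL₂(16)` and `Aut(PSL₃(4))` -/

/-- `PΓL(n, F)`: the group of the permutations of the projective space of `Fⁿ` that are induced by
the bijective semilinear maps `f` of `Fⁿ` (with an arbitrary field automorphism `σ`). -/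
def PGammaL (n : ℕ) (F : Type*) [Field F] : Subgroup (Equiv.Perm (ℙ F (Fin n → F))) where
  carrier := {g | ∃ (σ : F ≃+* F) (f : (Fin n → F) ≃+ (Fin n → F)),
    (∀ (t : F) (v : Fin n → F), f (t • v) = σ t • f v) ∧
    ∀ (v : Fin n → F) (hv : v ≠ 0),
      g (Projectivization.mk F v hv) =
        Projectivization.mk F (f v) ((map_ne_zero_iff f f.injective).mpr hv)}
  one_mem' := ⟨RingEquiv.refl F, AddEquiv.refl _, fun _ _ => rfl, fun _ _ => rfl⟩
  mul_mem' := by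
    rintro g g' ⟨σ, f, hf, hg⟩ ⟨σ', f', hf', hg'⟩
    refine ⟨σ'.trans σ, f'.trans f, fun t v => ?_, fun v hv => ?_⟩
    · simp [hf, hf']
    · rw [Equiv.Perm.mul_apply, hg' v hv, hg]
      rfl
  inv_mem' := by
    rintro g ⟨σ, f, hf, hg⟩
    refine ⟨σ.symm, f.symm, fun t v => ?_, fun v hv => ?_⟩
    · rw [AddEquiv.symm_apply_eq, hf]
      simp
    · rw [Equiv.Perm.inv_eq_iff_eq, hg]
      simp

/-- The group `PΓL₂(16)`. -/
abbrev PGammaL216 : Type := PGammaL 2 (GaloisField 2 4)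

/-- The automorphism group of the simple group `PSL₃(4)`. -/
abbrev AutPSL34 : Type := MulAut (Matrix.ProjectiveSpecialLinearGroup (Fin 3) (GaloisField 2 2))

/-!
Geodesic transitivity is proved by exhibiting automorphisms along one geodesic `b 0, …, b s`: it
suffices that the automorphisms that fix `b 0, …, b i` are transitive on the vertices that continue
this sequence to an `(i + 1)`-geodesic (`isGeodesicTransitive_of_steps`). It is refuted by a property
of tuples of vertices that automorphisms preserve and that some but not all geodesics have
(`not_isGeodesicTransitive_of_invariant`): the number of common neighbours of the vertices of a
`2`-geodesic for the Paley graphs, and the existence of a certain configuration of further vertices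
for the other graphs. The Paley graphs are arc-transitive by affine maps. For the graphs on 22 and 64
vertices, the translations are supplemented by explicit permutations; the presented group of order
`64` is first identified with its normal forms `a ^ e * b ^ x * c ^ y * d ^ l`, by means of a
homomorphism onto a subgroup of `D₄ × D₄ × C₂`.

The two families of orbital graphs are reduced to one concrete graph each. Let `G` act transitively
by automorphisms on a connected graph of valency `k` such that the stabilizer of a vertex is
transitive on each sphere around it, and the spheres of radius at least `2` have more than `k`
elements. Then this graph is the only orbital graph of valency `k` on its vertices
(`IsSphereTransitive.eq_of_isOrbitalGraph`). It remains to show that the subgroups in question are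
exactly the vertex stabilizers.

* For `PΓL₂(16)` the vertices are the `68` circles (Baer sublines) of the projective line over the
  field of order `16`, which are Hermitian forms of determinant `1` over the field of order `4`, and
  two circles are adjacent if they are disjoint. A subgroup `H` of index `68` has order `240`. The
  orbits of the two fixed points of an element of order `5` of `H` together have `12` points, and the
  remaining five points form a circle, which `H` fixes. The exception, where `H` fixes a point and is
  transitive on the other points, has no connected orbital graph of valency `12`
  (`exists_eq_stabilizer_circle`).
* For `Aut(PSL₃(4))` the vertices are the `280` Hermitian matrices of size three and determinant `1`
  over the field of order `4`, adjacent if their difference has rank one. `PSL₃(4)` acts by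
  `M ↦ g M g*`. A Sylow `3`-subgroup, of order `9`, fixes exactly one vertex and acts freely on the
  others. There are `280` Sylow `3`-subgroups (`card_sylow280`), which therefore correspond to the
  vertices, so that the whole automorphism group acts. It preserves adjacency, as the neighbours of
  a vertex are characterized by the action of `PSL₃(4)` (`adj_iff_orbit`). A maximal subgroup of
  index `280` does not contain `PSL₃(4)`, hence meets it in a subgroup of order `72`; this contains
  a Sylow `3`-subgroup and fixes the vertex of the latter (`exists_eq_stabilizer_vert280`).
-/

/-! ### Geodesics and automorphisms -/

section Geodesics

variable {V W : Type*} {Γ : SimpleGraph V} {Γ' : SimpleGraph W}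

lemma dist_map_iso_le (e : Γ ≃g Γ') {u v : V} (h : Γ.Reachable u v) :
    Γ'.dist (e u) (e v) ≤ Γ.dist u v := by
  obtain ⟨w, hw⟩ := h.exists_walk_length_eq_dist
  rw [← hw, ← SimpleGraph.Walk.length_map e.toHom w]
  exact SimpleGraph.dist_le _

lemma dist_map_iso (e : Γ ≃g Γ') (u v : V) : Γ'.dist (e u) (e v) = Γ.dist u v := by
  by_cases h : Γ.Reachable u v
  · refine le_antisymm (dist_map_iso_le e h) ?_
    simpa using dist_map_iso_le e.symm (e.reachable_iff.mpr h)
  · rw [SimpleGraph.dist_eq_zero_of_not_reachable h,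
      SimpleGraph.dist_eq_zero_of_not_reachable (fun h' => h (e.reachable_iff.mp h'))]

lemma exists_walk_of_chain {s : ℕ} {p : Fin (s + 1) → V}
    (h : ∀ i : Fin s, Γ.Adj (p i.castSucc) (p i.succ)) (i k : ℕ) (hk : i + k < s + 1) :
    ∃ w : Γ.Walk (p ⟨i, by omega⟩) (p ⟨i + k, hk⟩), w.length = k := by
  induction k with
  | zero => exact ⟨.nil, rfl⟩
  | succ k ih =>
    obtain ⟨w, hw⟩ := ih (by omega)
    exact ⟨w.concat (h ⟨i + k, by omega⟩), by simp [hw]⟩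

lemma dist_le_of_chain {s : ℕ} {p : Fin (s + 1) → V}
    (h : ∀ i : Fin s, Γ.Adj (p i.castSucc) (p i.succ)) (i j : ℕ) (hij : i ≤ j) (hj : j < s + 1) :
    Γ.dist (p ⟨i, by omega⟩) (p ⟨j, hj⟩) ≤ j - i := by
  obtain ⟨k, rfl⟩ := Nat.exists_eq_add_of_le hij
  obtain ⟨w, hw⟩ := exists_walk_of_chain h i k hj
  simpa [hw] using Γ.dist_le w

/-- Replacing an initial piece of a chain whose ends are at distance `s` cannot shorten it. -/
lemma le_length_of_chain {s : ℕ} {p : Fin (s + 1) → V}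
    (h : ∀ i : Fin s, Γ.Adj (p i.castSucc) (p i.succ)) (hd : Γ.dist (p 0) (p (Fin.last s)) = s)
    {i j : ℕ} (hi : i < s + 1) (hj : j < s + 1) (w : Γ.Walk (p ⟨i, hi⟩) (p ⟨j, hj⟩)) :
    j ≤ i + w.length := by
  obtain ⟨a, ha⟩ := exists_walk_of_chain h 0 i (by omega)
  obtain ⟨b, hb⟩ := exists_walk_of_chain h j (s - j) (by omega)
  have e1 : (⟨0 + i, by omega⟩ : Fin (s + 1)) = ⟨i, hi⟩ := by ext; simp
  have e2 : (⟨j + (s - j), by omega⟩ : Fin (s + 1)) = Fin.last s := by ext; simp; omega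
  have e3 : (⟨0, by omega⟩ : Fin (s + 1)) = 0 := rfl
  have hle := Γ.dist_le (((a.copy (by rw [e3]) (by rw [e1])).append w).append
    (b.copy rfl (by rw [e2])))
  simp only [SimpleGraph.Walk.length_append, SimpleGraph.Walk.length_copy, ha, hb, hd] at hle
  omega

/-- A chain of adjacent vertices whose ends are at the maximal possible distance is a geodesic. -/
lemma isGeodesic_of_chain {s : ℕ} {p : Fin (s + 1) → V}
    (h : ∀ i : Fin s, Γ.Adj (p i.castSucc) (p i.succ)) (hd : Γ.dist (p 0) (p (Fin.last s)) = s) :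
    IsGeodesic Γ s p := by
  refine ⟨⟨h, fun j hj he => ?_⟩, hd⟩
  have := le_length_of_chain h hd (i := j) (j := j + 2) (by omega) hj
    ((SimpleGraph.Walk.nil : Γ.Walk (p ⟨j, by omega⟩) _).copy rfl he)
  simp at this

lemma dist_of_chain {s : ℕ} {p : Fin (s + 1) → V}
    (h : ∀ i : Fin s, Γ.Adj (p i.castSucc) (p i.succ)) (hd : Γ.dist (p 0) (p (Fin.last s)) = s)
    (i : ℕ) (hi : i < s + 1) : Γ.dist (p 0) (p ⟨i, hi⟩) = i := by
  refine le_antisymm (dist_le_of_chain h 0 i (by omega) hi) ?_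
  obtain ⟨a, -⟩ := exists_walk_of_chain h 0 i (by omega)
  have e1 : (⟨0 + i, by omega⟩ : Fin (s + 1)) = ⟨i, hi⟩ := by ext; simp
  obtain ⟨w, hw⟩ := (a.copy rfl (by rw [e1]) :
    Γ.Walk (p ⟨0, by omega⟩) (p ⟨i, hi⟩)).reachable.exists_walk_length_eq_dist
  have := le_length_of_chain h hd (by omega) hi w
  rw [hw] at this
  simpa using this

lemma IsGeodesic.init {s : ℕ} {p : Fin (s + 2) → V} (h : IsGeodesic Γ (s + 1) p) :
    IsGeodesic Γ s (fun i => p i.castSucc) := by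
  refine isGeodesic_of_chain (fun i => h.1.adj i.castSucc) ?_
  exact dist_of_chain h.1.adj h.2 s (by omega)

/-- Geodesic transitivity can be tested along one geodesic `b 0, …, b s`: it suffices that the
automorphisms fixing `b 0, …, b i` are transitive on the continuations to an
`(i + 1)`-geodesic. -/
theorem isGeodesicTransitive_of_steps {s : ℕ} (b : ℕ → V)
    (hadj : ∀ i < s, Γ.Adj (b i) (b (i + 1))) (hdist : Γ.dist (b 0) (b s) = s)
    (htrans : ∀ u : V, ∃ φ : Γ ≃g Γ, φ u = b 0)
    (hstep : ∀ i < s, ∀ w, Γ.Adj (b i) w → Γ.dist (b 0) w = i + 1 →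
      ∃ φ : Γ ≃g Γ, (∀ j ≤ i, φ (b j) = b j) ∧ φ w = b (i + 1)) :
    IsGeodesicTransitive Γ s := by
  have hb : ∀ i ≤ s, IsGeodesic Γ i (fun j => b j) := by
    intro i hi
    have hbs : ∀ i : Fin s, Γ.Adj ((fun j : Fin (s + 1) => b j) i.castSucc)
      ((fun j : Fin (s + 1) => b j) i.succ) := fun i => hadj i i.2
    refine isGeodesic_of_chain (fun j => hadj j (by omega)) ?_
    exact dist_of_chain (p := fun j : Fin (s + 1) => b j) hbs (by simpa using hdist) i (by omega)
  have key : ∀ i ≤ s, ∀ p : Fin (i + 1) → V, IsGeodesic Γ i p →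
      ∃ φ : Γ ≃g Γ, ∀ j, φ (p j) = b j := by
    intro i
    induction i with
    | zero =>
      intro _ p _
      obtain ⟨φ, hφ⟩ := htrans (p 0)
      exact ⟨φ, fun j => by rw [Fin.fin_one_eq_zero j]; exact hφ⟩
    | succ i ih =>
      intro hi p hp
      obtain ⟨φ, hφ⟩ := ih (by omega) _ hp.init
      have hi' : φ (p (Fin.last i).castSucc) = b i := hφ (Fin.last i)
      have h0 : φ (p 0) = b 0 := hφ 0
      have ha : Γ.Adj (b i) (φ (p (Fin.last (i + 1)))) := by
        rw [← hi', φ.map_adj_iff]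
        exact hp.1.adj (Fin.last i)
      have hd : Γ.dist (b 0) (φ (p (Fin.last (i + 1)))) = i + 1 := by
        rw [← h0, dist_map_iso]
        exact_mod_cast hp.2
      obtain ⟨ψ, hψ, hψ'⟩ := hstep i (by omega) _ ha hd
      refine ⟨φ.trans ψ, fun j => ?_⟩
      induction j using Fin.lastCases with
      | last => simpa using hψ'
      | cast j =>
        have : φ (p j.castSucc) = b j := hφ j
        simp [this, hψ j (by omega)]
  refine ⟨fun u v => ?_, fun i _ hi => ⟨⟨_, hb i hi⟩, fun p q hp hq => ?_⟩⟩
  · obtain ⟨φ, hφ⟩ := htrans u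
    obtain ⟨ψ, hψ⟩ := htrans v
    exact ⟨φ.trans ψ.symm, by simp [hφ, ← hψ]⟩
  · obtain ⟨φ, hφ⟩ := key i hi p hp
    obtain ⟨ψ, hψ⟩ := key i hi q hq
    exact ⟨φ.trans ψ.symm, fun j => by simp [hφ j, ← hψ j]⟩

/-- A property of `s`-tuples preserved by automorphisms, which holds for one `s`-geodesic and fails
for another one, excludes `s`-geodesic transitivity. -/
theorem not_isGeodesicTransitive_of_invariant {s : ℕ} (hs : 1 ≤ s) (P : (Fin (s + 1) → V) → Prop)
    (hP : ∀ (φ : Γ ≃g Γ) (p : Fin (s + 1) → V), P p → P (fun i => φ (p i)))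
    {p q : Fin (s + 1) → V} (hp : IsGeodesic Γ s p) (hq : IsGeodesic Γ s q) (h1 : P p)
    (h2 : ¬ P q) : ¬ IsGeodesicTransitive Γ s := by
  rintro ⟨-, h⟩
  obtain ⟨φ, hφ⟩ := (h s hs le_rfl).2 p q hp hq
  apply h2
  rw [← funext hφ]
  exact hP φ p h1

lemma IsGeodesic.map_iso (e : Γ ≃g Γ') {s : ℕ} {p : Fin (s + 1) → V} (h : IsGeodesic Γ s p) :
    IsGeodesic Γ' s (fun i => e (p i)) :=
  ⟨⟨fun i => e.map_adj_iff.mpr (h.1.adj i), fun j hj he => h.1.ne j hj (e.injective he)⟩, by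
    rw [dist_map_iso]; exact h.2⟩

theorem IsGeodesicTransitive.map_iso (e : Γ ≃g Γ') {s : ℕ} (h : IsGeodesicTransitive Γ s) :
    IsGeodesicTransitive Γ' s := by
  refine ⟨fun u v => ?_, fun i h1 hi => ?_⟩
  · obtain ⟨φ, hφ⟩ := h.1 (e.symm u) (e.symm v)
    exact ⟨(e.symm.trans φ).trans e, by simp [hφ]⟩
  · obtain ⟨⟨p, hp⟩, ht⟩ := h.2 i h1 hi
    refine ⟨⟨_, hp.map_iso e⟩, fun p q hp hq => ?_⟩
    obtain ⟨φ, hφ⟩ := ht _ _ (hp.map_iso e.symm) (hq.map_iso e.symm)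
    exact ⟨(e.symm.trans φ).trans e, fun j => by simp [hφ j]⟩

theorem isGeodesicTransitive_congr (e : Γ ≃g Γ') {s : ℕ} :
    IsGeodesicTransitive Γ s ↔ IsGeodesicTransitive Γ' s :=
  ⟨fun h => h.map_iso e, fun h => h.map_iso e.symm⟩

/-- A level function which changes by at most one along edges and can be lowered at every vertex
other than `x₀` is the distance from `x₀`. -/
theorem dist_eq_of_level (x₀ : V) (d : V → ℕ) (h0 : ∀ x, d x = 0 ↔ x = x₀)
    (hadj : ∀ x y, Γ.Adj x y → d y ≤ d x + 1)
    (hdesc : ∀ x, d x ≠ 0 → ∃ y, Γ.Adj x y ∧ d y + 1 = d x) (x : V) :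
    Γ.Reachable x₀ x ∧ Γ.dist x₀ x = d x := by
  have up : ∀ n x, d x = n → ∃ w : Γ.Walk x₀ x, w.length = n := by
    intro n
    induction n with
    | zero =>
      intro x hx
      obtain rfl := (h0 x).mp hx
      exact ⟨.nil, rfl⟩
    | succ n ih =>
      intro x hx
      obtain ⟨y, hy, hd⟩ := hdesc x (by omega)
      obtain ⟨w, hw⟩ := ih y (by omega)
      exact ⟨w.concat hy.symm, by simp [hw]⟩
  have lo : ∀ {u v} (w : Γ.Walk u v), d v ≤ d u + w.length := by
    intro u v w
    induction w with
    | nil => simp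
    | cons h w ih => have := hadj _ _ h; simp only [SimpleGraph.Walk.length_cons]; omega
  obtain ⟨w, hw⟩ := up _ x rfl
  refine ⟨w.reachable, le_antisymm (hw ▸ Γ.dist_le w) ?_⟩
  obtain ⟨w', hw'⟩ := w.reachable.exists_walk_length_eq_dist
  have := lo w'
  rw [(h0 x₀).mpr rfl] at this
  omega

lemma dist_eq_two {u v w : V} (h : u ≠ v) (h' : ¬ Γ.Adj u v) (h1 : Γ.Adj u w) (h2 : Γ.Adj w v) :
    Γ.dist u v = 2 := by
  have hle := Γ.dist_le (SimpleGraph.Walk.cons h1 (SimpleGraph.Walk.cons h2 .nil))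
  have hr : Γ.Reachable u v := h1.reachable.trans h2.reachable
  have h0 : Γ.dist u v ≠ 0 := fun h0 => h (hr.dist_eq_zero_iff.mp h0)
  have h1 : Γ.dist u v ≠ 1 := fun h1 => h' (SimpleGraph.dist_eq_one_iff_adj.mp h1)
  simp at hle
  omega

lemma exists_common_of_dist_eq_two {u v : V} (h : Γ.dist u v = 2) :
    ∃ w, Γ.Adj u w ∧ Γ.Adj w v := by
  have hr : Γ.Reachable u v := by
    by_contra hc
    simp [SimpleGraph.dist_eq_zero_of_not_reachable hc] at h
  obtain ⟨w, hw⟩ := hr.exists_walk_length_eq_dist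
  rw [h] at hw
  match w, hw with
  | .cons (v := a) h1 (.cons h2 .nil), _ => exact ⟨a, h1, h2⟩

lemma dist_eq_three {u v w x : V} (h : u ≠ v) (h' : ¬ Γ.Adj u v)
    (h'' : ∀ z, Γ.Adj u z → ¬ Γ.Adj z v) (h1 : Γ.Adj u w) (h2 : Γ.Adj w x) (h3 : Γ.Adj x v) :
    Γ.dist u v = 3 := by
  have hle := Γ.dist_le (SimpleGraph.Walk.cons h1 (.cons h2 (.cons h3 .nil)))
  have hr : Γ.Reachable u v := (h1.reachable.trans h2.reachable).trans h3.reachable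
  have h0 : Γ.dist u v ≠ 0 := fun h0 => h (hr.dist_eq_zero_iff.mp h0)
  have h1 : Γ.dist u v ≠ 1 := fun h1 => h' (SimpleGraph.dist_eq_one_iff_adj.mp h1)
  have h2 : Γ.dist u v ≠ 2 := fun h2 => by
    obtain ⟨w, hw, hw'⟩ := exists_common_of_dist_eq_two h2
    exact h'' w hw hw'
  simp at hle
  omega

end Geodesics

/-! ### Orbital graphs of a group that is transitive on the spheres of a graph -/

section Orbital

variable {G X : Type*} [Group G] [MulAction G X]

/-- `G` acts transitively on `X` by automorphisms of the connected graph `Γ`, the stabilizer of `x₀`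
is transitive on each sphere around `x₀`, the graph has valency `k`, and the spheres of radius at
least `2` have more than `k` elements. -/
structure IsSphereTransitive (G : Type*) {X : Type*} [Group G] [MulAction G X]
    (Γ : SimpleGraph X) (x₀ : X) (k : ℕ) : Prop where
  transitive : ∀ x, ∃ g : G, g • x₀ = x
  smul_adj : ∀ (g : G) {x y : X}, Γ.Adj x y → Γ.Adj (g • x) (g • y)
  connected : Γ.Connected
  sphere : ∀ x y, Γ.dist x₀ x = Γ.dist x₀ y → ∃ g : G, g • x₀ = x₀ ∧ g • x = y
  valency : (Γ.neighborSet x₀).ncard = k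
  pos : 0 < k
  large : ∀ x, x ≠ x₀ → ¬ Γ.Adj x₀ x → k < {y | Γ.dist x₀ y = Γ.dist x₀ x}.ncard

namespace IsSphereTransitive

variable {Γ : SimpleGraph X} {x₀ : X} {k : ℕ}

/-- The automorphism of `Γ` given by an element of `G`. -/
def toIso (h : IsSphereTransitive G Γ x₀ k) (g : G) : Γ ≃g Γ where
  toEquiv := MulAction.toPerm g
  map_rel_iff' {x y} := ⟨fun ha => by simpa using h.smul_adj g⁻¹ ha, h.smul_adj g⟩

@[simp] lemma toIso_apply (h : IsSphereTransitive G Γ x₀ k) (g : G) (x : X) :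
    h.toIso g x = g • x := rfl

lemma smul_adj_iff (h : IsSphereTransitive G Γ x₀ k) (g : G) {x y : X} :
    Γ.Adj (g • x) (g • y) ↔ Γ.Adj x y := (h.toIso g).map_adj_iff

lemma dist_smul (h : IsSphereTransitive G Γ x₀ k) (g : G) (x y : X) :
    Γ.dist (g • x) (g • y) = Γ.dist x y := dist_map_iso (h.toIso g) x y

lemma exists_smul_eq (h : IsSphereTransitive G Γ x₀ k) {u v x y : X}
    (hd : Γ.dist u v = Γ.dist x y) : ∃ g : G, g • u = x ∧ g • v = y := by
  obtain ⟨a, rfl⟩ := h.transitive u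
  obtain ⟨b, rfl⟩ := h.transitive x
  obtain ⟨g, hg, hg'⟩ := h.sphere (a⁻¹ • v) (b⁻¹ • y) (by
    rw [← h.dist_smul a x₀, ← h.dist_smul b x₀, smul_inv_smul, smul_inv_smul, hd])
  refine ⟨b * g * a⁻¹, ?_, ?_⟩
  · simp [mul_smul, hg]
  · simp [mul_smul, hg']

lemma isDistanceTransitive (h : IsSphereTransitive G Γ x₀ k) : IsDistanceTransitive Γ := by
  intro u v x y hd
  obtain ⟨g, hg⟩ := h.exists_smul_eq hd
  exact ⟨h.toIso g, hg⟩

lemma ncard_neighborSet (h : IsSphereTransitive G Γ x₀ k) (v : X) :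
    (Γ.neighborSet v).ncard = k := by
  obtain ⟨g, rfl⟩ := h.transitive v
  rw [← h.valency, ← Set.ncard_image_of_injective (Γ.neighborSet x₀) (MulAction.injective g)]
  congr 1
  ext y
  simp only [SimpleGraph.mem_neighborSet, Set.mem_image]
  constructor
  · intro hy
    refine ⟨g⁻¹ • y, ?_, by simp⟩
    rwa [← h.smul_adj_iff g, smul_inv_smul]
  · rintro ⟨z, hz, rfl⟩
    exact h.smul_adj g hz

lemma isOrbitalGraph (h : IsSphereTransitive G Γ x₀ k) : IsOrbitalGraph G Γ := by
  obtain ⟨b, hb⟩ : (Γ.neighborSet x₀).Nonempty :=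
    Set.nonempty_of_ncard_ne_zero (by rw [h.valency]; exact h.pos.ne')
  have hb : Γ.Adj x₀ b := hb
  refine ⟨x₀, b, hb.ne, fun x y => ⟨fun hxy => ?_, ?_⟩⟩
  · obtain ⟨g, hg⟩ := h.exists_smul_eq (u := x₀) (v := b) (x := x) (y := y) (by
      rw [SimpleGraph.dist_eq_one_iff_adj.mpr hb, SimpleGraph.dist_eq_one_iff_adj.mpr hxy])
    exact ⟨g, Or.inl hg⟩
  · rintro ⟨g, ⟨rfl, rfl⟩ | ⟨rfl, rfl⟩⟩
    · exact h.smul_adj g hb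
    · exact h.smul_adj g hb.symm

/-- The graph is the only orbital graph of its valency, as an orbital graph with an edge
`{x₀, b}` contains the whole sphere of `b` in the neighbourhood of `x₀`. -/
theorem eq_of_isOrbitalGraph [Finite X] (h : IsSphereTransitive G Γ x₀ k) {Γ' : SimpleGraph X}
    (ho : IsOrbitalGraph G Γ') (hv : (Γ'.neighborSet x₀).ncard = k) : Γ' = Γ := by
  obtain ⟨a, b, hab, ho⟩ := ho
  obtain ⟨g₀, rfl⟩ := h.transitive a
  have hsm : ∀ (g : G), Γ'.Adj (g • x₀) (g • g₀⁻¹ • b) := fun g =>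
    (ho _ _).mpr ⟨g * g₀⁻¹, Or.inl ⟨by simp [mul_smul], by simp [mul_smul]⟩⟩
  set b' := g₀⁻¹ • b with hb'
  have hne : b' ≠ x₀ := fun he => hab (by rw [← he, hb', smul_inv_smul])
  have hadj : Γ.Adj x₀ b' := by
    by_contra hc
    refine (h.large b' hne hc).not_ge ?_
    rw [← hv]
    refine Set.ncard_le_ncard (fun y hy => ?_) (Set.toFinite _)
    obtain ⟨g, hg, rfl⟩ := h.sphere b' y hy.symm
    simpa [hg] using hsm g
  have hbb : b = g₀ • b' := by rw [hb', smul_inv_smul]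
  ext x y
  constructor
  · intro hxy
    obtain ⟨g, ⟨rfl, rfl⟩ | ⟨rfl, rfl⟩⟩ := (ho x y).mp hxy
    · rw [hbb, h.smul_adj_iff, h.smul_adj_iff]; exact hadj
    · rw [hbb, h.smul_adj_iff, h.smul_adj_iff]; exact hadj.symm
  · intro hxy
    obtain ⟨g, rfl, rfl⟩ := h.exists_smul_eq (u := x₀) (v := b') (x := x) (y := y) (by
      rw [SimpleGraph.dist_eq_one_iff_adj.mpr hadj, SimpleGraph.dist_eq_one_iff_adj.mpr hxy])
    exact hsm g

/-- The cosets of the stabilizer of `x` correspond to the points of `X`. -/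
noncomputable def cosetEquiv (h : IsSphereTransitive G Γ x₀ k) (x : X) :
    G ⧸ MulAction.stabilizer G x ≃ X :=
  Equiv.ofBijective (MulAction.ofQuotientStabilizer G x)
    ⟨MulAction.injective_ofQuotientStabilizer G x, fun y => by
      obtain ⟨a, rfl⟩ := h.transitive x
      obtain ⟨b, rfl⟩ := h.transitive y
      exact ⟨((b * a⁻¹ : G) : G ⧸ _), by
        rw [MulAction.ofQuotientStabilizer_mk, mul_smul, inv_smul_smul]⟩⟩

lemma cosetEquiv_smul (h : IsSphereTransitive G Γ x₀ k) (x : X) (g : G)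
    (c : G ⧸ MulAction.stabilizer G x) : h.cosetEquiv x (g • c) = g • h.cosetEquiv x c :=
  MulAction.ofQuotientStabilizer_smul G x g c

lemma isDistanceTransitiveOrbitalGraph_comap (h : IsSphereTransitive G Γ x₀ k) (x : X) :
    IsDistanceTransitiveOrbitalGraph (MulAction.stabilizer G x) k (Γ.comap (h.cosetEquiv x)) := by
  let e := h.cosetEquiv x
  let i : Γ.comap e ≃g Γ := SimpleGraph.Iso.comap e Γ
  have hsym : ∀ (g : G) y, e.symm (g • y) = g • e.symm y := fun g y => by
    rw [Equiv.symm_apply_eq, h.cosetEquiv_smul, Equiv.apply_symm_apply]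
  refine ⟨?_, i.connected_iff.mpr h.connected, fun u v y z hd => ?_, fun v => ?_⟩
  · obtain ⟨a, b, hab, ho⟩ := h.isOrbitalGraph
    refine ⟨e.symm a, e.symm b, fun he => hab (e.symm.injective he), fun y z => ?_⟩
    rw [SimpleGraph.comap_adj, ho]
    simp only [← hsym, Equiv.symm_apply_eq]
    rfl
  · rw [← dist_map_iso i, ← dist_map_iso i] at hd
    obtain ⟨φ, hφ, hφ'⟩ := h.isDistanceTransitive _ _ _ _ hd
    exact ⟨(i.trans φ).trans i.symm, by simp [hφ], by simp [hφ']⟩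
  · refine Eq.trans ?_ (h.ncard_neighborSet (e v))
    rw [← Set.ncard_image_of_injective _ e.injective]
    congr 1
    ext y
    simp only [SimpleGraph.mem_neighborSet, Set.mem_image, SimpleGraph.comap_adj]
    refine ⟨?_, fun hy => ⟨e.symm y, ?_, by simp⟩⟩
    · rintro ⟨z, hz, rfl⟩
      exact hz
    · have : h.cosetEquiv x (e.symm y) = y := e.apply_symm_apply y
      rw [this]; exact hy

lemma nonempty_iso [Finite X] (h : IsSphereTransitive G Γ x₀ k) (x : X)
    (Γ' : SimpleGraph (G ⧸ MulAction.stabilizer G x))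
    (h' : IsDistanceTransitiveOrbitalGraph (MulAction.stabilizer G x) k Γ') :
    Nonempty (Γ ≃g Γ') := by
  let e := h.cosetEquiv x
  have hsym : ∀ (g : G) y, e.symm (g • y) = g • e.symm y := fun g y => by
    rw [Equiv.symm_apply_eq, h.cosetEquiv_smul, Equiv.apply_symm_apply]
  have heq : Γ'.comap e.symm = Γ := by
    refine h.eq_of_isOrbitalGraph ?_ ?_
    · obtain ⟨a, b, hab, ho⟩ := h'.orbital
      refine ⟨e a, e b, fun he => hab (e.injective he), fun y z => ?_⟩
      rw [SimpleGraph.comap_adj, ho]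
      simp only [Equiv.eq_symm_apply]
      simp only [e, h.cosetEquiv_smul]
    · rw [← h'.valency (e.symm x₀), ← Set.ncard_image_of_injective _ e.symm.injective]
      congr 1
      ext y
      simp only [SimpleGraph.mem_neighborSet, Set.mem_image, SimpleGraph.comap_adj]
      refine ⟨?_, fun hy => ⟨e y, by simpa using hy, by simp⟩⟩
      rintro ⟨z, hz, rfl⟩
      exact hz
  rw [← heq]
  exact ⟨SimpleGraph.Iso.comap e.symm Γ'⟩

/-- If every subgroup with the property `P` that carries a suitable orbital graph is a point
stabilizer, then these orbital graphs exist and are all isomorphic to `Γ`. -/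
theorem orbital_conclusion [Finite X] (h : IsSphereTransitive G Γ x₀ k) {s t : ℕ}
    (hs : IsGeodesicTransitive Γ s) (ht : ¬ IsGeodesicTransitive Γ t) (P : Subgroup G → Prop)
    (hP : P (MulAction.stabilizer G x₀))
    (hstab : ∀ (H : Subgroup G) (Γ' : SimpleGraph (G ⧸ H)), P H →
      IsDistanceTransitiveOrbitalGraph H k Γ' → ∃ x : X, H = MulAction.stabilizer G x) :
    (∃ (H : Subgroup G) (Γ' : SimpleGraph (G ⧸ H)),
      P H ∧ IsDistanceTransitiveOrbitalGraph H k Γ') ∧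
    ∀ (H : Subgroup G) (Γ' : SimpleGraph (G ⧸ H)), P H →
      IsDistanceTransitiveOrbitalGraph H k Γ' →
        IsGeodesicTransitive Γ' s ∧ ¬ IsGeodesicTransitive Γ' t := by
  refine ⟨⟨_, _, hP, h.isDistanceTransitiveOrbitalGraph_comap x₀⟩, fun H Γ' hH hΓ' => ?_⟩
  obtain ⟨x, rfl⟩ := hstab H Γ' hH hΓ'
  obtain ⟨e⟩ := h.nonempty_iso x Γ' hΓ'
  exact ⟨hs.map_iso e, fun hc => ht ((isGeodesicTransitive_congr e).mpr hc)⟩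

end IsSphereTransitive

end Orbital

/-! ### Paley graphs -/

section Paley

/-- The number of common neighbours of the three vertices of a `2`-arc. -/
noncomputable def commonNeighbors₃ {V : Type*} (Γ : SimpleGraph V) (p : Fin 3 → V) : ℕ :=
  {x | ∀ i, Γ.Adj (p i) x}.ncard

lemma commonNeighbors₃_map {V W : Type*} {Γ : SimpleGraph V} {Γ' : SimpleGraph W} (φ : Γ ≃g Γ')
    (p : Fin 3 → V) : commonNeighbors₃ Γ' (fun i => φ (p i)) = commonNeighbors₃ Γ p := by
  rw [commonNeighbors₃, commonNeighbors₃, ← Set.ncard_image_of_injective _ φ.injective]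
  congr 1
  ext y
  simp only [Set.mem_ofPred_eq, Set.mem_image]
  refine ⟨fun hy => ⟨φ.symm y, fun i => ?_, by simp⟩, ?_⟩
  · rw [← φ.map_adj_iff]; simpa using hy i
  · rintro ⟨z, hz, rfl⟩ i
    exact φ.map_adj_iff.mpr (hz i)

lemma not_isGeodesicTransitive_two_of_commonNeighbors {V : Type*} [Fintype V] [DecidableEq V]
    {Γ : SimpleGraph V} [DecidableRel Γ.Adj] (a b c d : V)
    (h : Γ.Adj a b ∧ Γ.Adj b c ∧ Γ.Adj b d ∧ ¬ Γ.Adj a c ∧ ¬ Γ.Adj a d ∧ a ≠ c ∧ a ≠ d ∧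
      (Finset.univ.filter fun x => Γ.Adj a x ∧ Γ.Adj b x ∧ Γ.Adj c x).card ≠
      (Finset.univ.filter fun x => Γ.Adj a x ∧ Γ.Adj b x ∧ Γ.Adj d x).card) :
    ¬ IsGeodesicTransitive Γ 2 := by
  obtain ⟨hab, hbc, hbd, hac, had, hac', had', hne⟩ := h
  have geo : ∀ c, Γ.Adj b c → ¬ Γ.Adj a c → a ≠ c → IsGeodesic Γ 2 ![a, b, c] := fun c h1 h2 h3 =>
    isGeodesic_of_chain (fun i => by fin_cases i; exacts [hab, h1]) (dist_eq_two h3 h2 hab h1)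
  have card : ∀ c, commonNeighbors₃ Γ ![a, b, c] =
      (Finset.univ.filter fun x => Γ.Adj a x ∧ Γ.Adj b x ∧ Γ.Adj c x).card := fun c => by
    rw [commonNeighbors₃, ← Set.ncard_coe_finset]
    congr 1
    ext x
    simp [Fin.forall_fin_succ]
  refine not_isGeodesicTransitive_of_invariant (by norm_num)
    (fun p => commonNeighbors₃ Γ p = commonNeighbors₃ Γ ![a, b, c])
    (fun φ p hp => (commonNeighbors₃_map φ p).trans hp) (geo c hbc hac hac') (geo d hbd had had')
    rfl ?_
  rw [card, card]
  exact hne.symm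

theorem isGeodesicTransitive_one_paleyGraph {F : Type*} [Field F] [Fintype F]
    (hF : Fintype.card F % 4 = 1) : IsGeodesicTransitive (paleyGraph F hF) 1 := by
  -- the affine map `z ↦ a z + b` with `a` a nonzero square
  let φ (a b : F) (ha : a ≠ 0) (ha' : IsSquare a) : paleyGraph F hF ≃g paleyGraph F hF :=
    { toFun := fun z => a * z + b
      invFun := fun z => a⁻¹ * (z - b)
      left_inv := fun z => by field_simp; ring
      right_inv := fun z => by field_simp; ring
      map_rel_iff' := by
        intro u v
        have e : a * u + b - (a * v + b) = a * (u - v) := by ring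
        change (a * u + b - (a * v + b) ≠ 0 ∧ IsSquare (a * u + b - (a * v + b))) ↔
          (u - v ≠ 0 ∧ IsSquare (u - v))
        rw [e]
        refine and_congr (by simp [ha]) ⟨fun h => ?_, ha'.mul⟩
        simpa [ha] using ha'.inv.mul h }
  refine isGeodesicTransitive_of_steps (fun i => if i = 0 then 0 else 1) ?_ ?_ ?_ ?_
  · intro i hi
    obtain rfl : i = 0 := by omega
    refine SimpleGraph.Adj.symm (show (paleyGraph F hF).Adj 1 0 from ?_)
    exact ⟨by simp, by simp⟩
  · refine SimpleGraph.dist_eq_one_iff_adj.mpr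
      (SimpleGraph.Adj.symm (show (paleyGraph F hF).Adj 1 0 from ?_))
    exact ⟨by simp, by simp⟩
  · exact fun u => ⟨φ 1 (-u) one_ne_zero (IsSquare.one), by simp [φ]⟩
  · intro i hi w hw _
    obtain rfl : i = 0 := by omega
    have hw : w - 0 ≠ 0 ∧ IsSquare (w - 0) := SimpleGraph.Adj.symm hw
    rw [sub_zero] at hw
    refine ⟨φ w⁻¹ 0 (inv_ne_zero hw.1) hw.2.inv, fun j hj => ?_, ?_⟩
    · obtain rfl : j = 0 := by omega
      simp [φ]
    · simp [φ, hw.1]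

/-- Ring isomorphisms induce isomorphisms of Paley graphs. -/
def paleyGraphIso {F K : Type*} [Field F] [Fintype F] [Field K] [Fintype K]
    (hF : Fintype.card F % 4 = 1) (hK : Fintype.card K % 4 = 1) (e : F ≃+* K) :
    paleyGraph F hF ≃g paleyGraph K hK where
  toEquiv := e.toEquiv
  map_rel_iff' {u v} := by
    change (e u - e v ≠ 0 ∧ IsSquare (e u - e v)) ↔ (u - v ≠ 0 ∧ IsSquare (u - v))
    rw [← map_sub]
    refine and_congr (map_ne_zero_iff e e.injective) ⟨fun h => ?_, fun h => h.map e⟩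
    simpa using h.map e.symm

instance {F : Type*} [Field F] [Fintype F] [DecidableEq F] (hF : Fintype.card F % 4 = 1) :
    DecidableRel (paleyGraph F hF).Adj := fun u v =>
  inferInstanceAs (Decidable (u - v ≠ 0 ∧ ∃ r, u - v = r * r))

/-- The field of order `25`, obtained from `ZMod 5` by adjoining a square root of `2`. -/
abbrev F25 : Type := QuadraticAlgebra (ZMod 5) 2 0

instance : Fact (Nat.Prime 13) := ⟨by norm_num⟩
instance : Fact (Nat.Prime 17) := ⟨by norm_num⟩
instance : Fact (Nat.Prime 5) := ⟨by norm_num⟩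
instance : Fact (∀ r : ZMod 5, r ^ 2 ≠ 2 + 0 * r) := ⟨by decide⟩
instance : Fintype F25 := Fintype.ofEquiv _ (QuadraticAlgebra.equivProd (2 : ZMod 5) 0).symm

lemma card_F25 : Fintype.card F25 = 25 := by decide

lemma not_isGeodesicTransitive_two_paleyGraph_zmod13 (h : Fintype.card (ZMod 13) % 4 = 1) :
    ¬ IsGeodesicTransitive (paleyGraph (ZMod 13) h) 2 :=
  not_isGeodesicTransitive_two_of_commonNeighbors 0 1 2 5 (by revert h; decide +kernel)

lemma not_isGeodesicTransitive_two_paleyGraph_zmod17 (h : Fintype.card (ZMod 17) % 4 = 1) :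
    ¬ IsGeodesicTransitive (paleyGraph (ZMod 17) h) 2 :=
  not_isGeodesicTransitive_two_of_commonNeighbors 0 1 3 5 (by revert h; decide +kernel)

lemma not_isGeodesicTransitive_two_paleyGraph_F25 (h : Fintype.card F25 % 4 = 1) :
    ¬ IsGeodesicTransitive (paleyGraph F25 h) 2 :=
  not_isGeodesicTransitive_two_of_commonNeighbors 0 1 ⟨0, 1⟩ ⟨4, 2⟩ (by revert h; decide +kernel)

theorem paleyGraph_conclusion (F : Type*) [Field F] [Fintype F] (hF : Fintype.card F % 4 = 1)
    (h : Fintype.card F = 13 ∨ Fintype.card F = 17 ∨ Fintype.card F = 25) :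
    IsGeodesicTransitive (paleyGraph F hF) 1 ∧ ¬ IsGeodesicTransitive (paleyGraph F hF) 2 := by
  refine ⟨isGeodesicTransitive_one_paleyGraph hF, ?_⟩
  have key : ∀ {K : Type} [Field K] [Fintype K], Fintype.card F = Fintype.card K →
      (∀ hK : Fintype.card K % 4 = 1, ¬ IsGeodesicTransitive (paleyGraph K hK) 2) →
      ¬ IsGeodesicTransitive (paleyGraph F hF) 2 := by
    intro K _ _ hc hK h2
    have e : F ≃+* K := FiniteField.ringEquivOfCardEq hc
    exact hK (hc ▸ hF) (h2.map_iso (paleyGraphIso hF (hc ▸ hF) e))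
  rcases h with h | h | h
  · exact key (K := ZMod 13) (by simp [h]) not_isGeodesicTransitive_two_paleyGraph_zmod13
  · exact key (K := ZMod 17) (by simp [h]) not_isGeodesicTransitive_two_paleyGraph_zmod17
  · exact key (K := F25) (by rw [h, card_F25]) not_isGeodesicTransitive_two_paleyGraph_F25

end Paley

/-! ### Automorphisms given as permutations -/

section AutPerm

variable {V : Type*} (Γ : SimpleGraph V)

/-- The automorphisms of `Γ`, as a subgroup of the permutations of the vertices. -/
def autPerm : Subgroup (Equiv.Perm V) where
  carrier := {e | ∀ u v, Γ.Adj (e u) (e v) ↔ Γ.Adj u v}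
  one_mem' _ _ := Iff.rfl
  mul_mem' {e f} he hf u v := (he _ _).trans (hf u v)
  inv_mem' {e} he u v := by rw [← he]; simp

variable {Γ}

/-- The graph automorphism given by a permutation that preserves adjacency. -/
def autPerm.toIso {e : Equiv.Perm V} (h : e ∈ autPerm Γ) : Γ ≃g Γ := ⟨e, h _ _⟩

@[simp] lemma autPerm.toIso_apply {e : Equiv.Perm V} (h : e ∈ autPerm Γ) (v : V) :
    autPerm.toIso h v = e v := rfl

lemma mem_autPerm_of_forall_adj [Finite V] {e : Equiv.Perm V}
    (h : ∀ u v, Γ.Adj u v → Γ.Adj (e u) (e v)) : e ∈ autPerm Γ := by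
  have hpow : ∀ (n : ℕ) u v, Γ.Adj u v → Γ.Adj ((e ^ n) u) ((e ^ n) v) := by
    intro n
    induction n with
    | zero => exact fun u v h => h
    | succ n ih =>
      intro u v huv
      rw [pow_succ', Equiv.Perm.mul_apply, Equiv.Perm.mul_apply]
      exact h _ _ (ih u v huv)
  refine fun u v => ⟨fun huv => ?_, h u v⟩
  have hpos := orderOf_pos e
  have := hpow (orderOf e - 1) _ _ huv
  rwa [← Equiv.Perm.mul_apply, ← Equiv.Perm.mul_apply, ← pow_succ, Nat.sub_add_cancel hpos,
    pow_orderOf_eq_one] at this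

end AutPerm

lemma exists_iso_mulCayley {M : Type*} [Group M] (S : Set M) (u v : M) :
    ∃ φ : SimpleGraph.mulCayley S ≃g SimpleGraph.mulCayley S, φ u = v := by
  refine ⟨⟨Equiv.mulLeft (v * u⁻¹), fun {x y} => ?_⟩, by simp⟩
  simp [SimpleGraph.mulCayley_adj', mul_assoc]

/-- Two-step transitivity from permutations that generate enough automorphisms. -/
lemma isGeodesicTransitive_two_of_perms {V : Type*} {Γ : SimpleGraph V} (b₀ b₁ b₂ : V)
    (h01 : Γ.Adj b₀ b₁) (h12 : Γ.Adj b₁ b₂) (h02 : b₀ ≠ b₂) (h02' : ¬ Γ.Adj b₀ b₂)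
    (htrans : ∀ u v : V, ∃ φ : Γ ≃g Γ, φ u = v)
    (h1 : ∀ w, Γ.Adj b₀ w → ∃ e ∈ autPerm Γ, e b₀ = b₀ ∧ e w = b₁)
    (h2 : ∀ w, Γ.Adj b₁ w → w ≠ b₀ → ∃ e ∈ autPerm Γ, e b₀ = b₀ ∧ e b₁ = b₁ ∧ e w = b₂) :
    IsGeodesicTransitive Γ 2 := by
  refine isGeodesicTransitive_of_steps
    (fun i => match i with | 0 => b₀ | 1 => b₁ | _ => b₂) ?_ ?_ (fun u => htrans u _) ?_
  · intro i hi
    interval_cases i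
    exacts [h01, h12]
  · exact dist_eq_two h02 h02' h01 h12
  · intro i hi w hw hd
    interval_cases i
    · obtain ⟨e, he, he0, he1⟩ := h1 w hw
      refine ⟨autPerm.toIso he, fun j hj => ?_, he1⟩
      obtain rfl : j = 0 := by omega
      exact he0
    · obtain ⟨e, he, he0, he1, he2⟩ := h2 w hw (by rintro rfl; simp at hd)
      refine ⟨autPerm.toIso he, fun j hj => ?_, he2⟩
      interval_cases j
      exacts [he0, he1]

/-! ### The graph on 22 vertices -/

section Graph22

open DihedralGroup

instance : DecidableRel graph22.Adj := fun u v => by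
  unfold graph22
  infer_instance

/-- The automorphism of the dihedral group that cubes the rotations. -/
def multiplier22 : DihedralGroup 11 → DihedralGroup 11
  | r i => r (3 * i)
  | sr i => sr (3 * i)

/-- An involutory automorphism of the graph that fixes `1` and moves `b`. It is not induced by an
automorphism of the group. -/
def involution22 : DihedralGroup 11 → DihedralGroup 11
  | r i => r ((![0, 8, 5, 3, 4, 2, 7, 6, 1, 10, 9] : Fin 11 → ZMod 11) i)
  | sr i => sr ((![1, 0, 6, 4, 3, 5, 2, 10, 8, 9, 7] : Fin 11 → ZMod 11) i)

/-- `multiplier22` as a permutation. -/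
noncomputable def multiplierPerm22 : Equiv.Perm (DihedralGroup 11) :=
  Equiv.ofBijective multiplier22 (Finite.injective_iff_bijective.mp
    (Function.LeftInverse.injective (g := multiplier22^[4])
      (by unfold Function.LeftInverse; decide +kernel)))

/-- `involution22` as a permutation. -/
noncomputable def involutionPerm22 : Equiv.Perm (DihedralGroup 11) :=
  Equiv.ofBijective involution22 (Finite.injective_iff_bijective.mp
    (Function.LeftInverse.injective (g := involution22)
      (by unfold Function.LeftInverse; decide +kernel)))

lemma multiplierPerm22_mem : multiplierPerm22 ∈ autPerm graph22 := by
  refine mem_autPerm_of_forall_adj ?_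
  change ∀ u v, graph22.Adj u v → graph22.Adj (multiplier22 u) (multiplier22 v)
  decide +kernel

lemma involutionPerm22_mem : involutionPerm22 ∈ autPerm graph22 := by
  refine mem_autPerm_of_forall_adj ?_
  change ∀ u v, graph22.Adj u v → graph22.Adj (involution22 u) (involution22 v)
  decide +kernel

theorem isGeodesicTransitive_two_graph22 : IsGeodesicTransitive graph22 2 := by
  have mem : ∀ i j : ℕ, involutionPerm22 ^ j * multiplierPerm22 ^ i ∈ autPerm graph22 := fun i j =>
    mul_mem (pow_mem involutionPerm22_mem j) (pow_mem multiplierPerm22_mem i)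
  have hcoe : ∀ (i j : ℕ) (x), (involutionPerm22 ^ j * multiplierPerm22 ^ i) x =
      involution22^[j] (multiplier22^[i] x) := fun i j x => by
    rw [Equiv.Perm.mul_apply, ← Equiv.Perm.iterate_eq_pow, ← Equiv.Perm.iterate_eq_pow]; rfl
  refine isGeodesicTransitive_two_of_perms (r 0) (sr 0) (r 1) (by decide +kernel)
    (by decide +kernel) (by decide) (by decide +kernel)
    (fun u v => exists_iso_mulCayley _ u v) (fun w hw => ?_) (fun w hw hne => ?_)
  · have : ∀ w, graph22.Adj (r 0) w → ∃ i : Fin 5, ∃ j : Fin 2,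
        involution22^[j] (multiplier22^[i] (r 0)) = r 0 ∧
        involution22^[j] (multiplier22^[i] w) = sr 0 := by decide +kernel
    obtain ⟨i, j, h⟩ := this w hw
    exact ⟨_, mem i j, by simpa only [hcoe] using h⟩
  · have : ∀ w, graph22.Adj (sr 0) w → w ≠ r 0 → ∃ i : Fin 5,
        multiplier22^[i] (r 0) = r 0 ∧ multiplier22^[i] (sr 0) = sr 0 ∧
        multiplier22^[i] w = r 1 := by decide +kernel
    obtain ⟨i, h⟩ := this w hw hne
    exact ⟨_, mem i 0, by simp only [hcoe]; exact h⟩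

theorem not_isGeodesicTransitive_three_graph22 : ¬ IsGeodesicTransitive graph22 3 := by
  have h01 : graph22.Adj (r 0) (sr 0) := by decide +kernel
  have h12 : graph22.Adj (sr 0) (r 9) := by decide +kernel
  have geo : ∀ x, graph22.Adj (r 9) x → ¬ graph22.Adj (r 0) x →
      (∀ z, graph22.Adj (r 0) z → ¬ graph22.Adj z x) → r 0 ≠ x →
      IsGeodesic graph22 3 ![r 0, sr 0, r 9, x] := fun x h1 h2 h3 h4 =>
    isGeodesic_of_chain (fun i => by
        fin_cases i
        · exact h01
        · exact h12
        · exact h1)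
      (dist_eq_three h4 h2 h3 h01 h12 h1)
  -- Some `4`-cycles through `p 0, p 1, p 2` and through `p 1, p 2, p 3` have adjacent fourth vertices.
  refine not_isGeodesicTransitive_of_invariant (by norm_num)
    (fun p => ∃ v w, graph22.Adj v (p 0) ∧ graph22.Adj v (p 2) ∧ v ≠ p 1 ∧
      graph22.Adj w (p 1) ∧ graph22.Adj w (p 3) ∧ w ≠ p 2 ∧ graph22.Adj v w) ?_
    (geo (sr 2) (by decide +kernel) (by decide +kernel) (by decide +kernel) (by decide))
    (geo (sr 6) (by decide +kernel) (by decide +kernel) (by decide +kernel) (by decide))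
    ?_ ?_
  · rintro φ p ⟨v, w, h⟩
    exact ⟨φ v, φ w, by simpa [φ.map_adj_iff] using h⟩
  · change ∃ v w, graph22.Adj v (r 0) ∧ graph22.Adj v (r 9) ∧ v ≠ sr 0 ∧
      graph22.Adj w (sr 0) ∧ graph22.Adj w (sr 2) ∧ w ≠ r 9 ∧ graph22.Adj v w
    decide +kernel
  · change ¬ ∃ v w, graph22.Adj v (r 0) ∧ graph22.Adj v (r 9) ∧ v ≠ sr 0 ∧
      graph22.Adj w (sr 0) ∧ graph22.Adj w (sr 6) ∧ w ≠ r 9 ∧ graph22.Adj v w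
    decide +kernel

end Graph22

/-! ### The graph on 64 vertices -/

section Graph64

open DihedralGroup

/-- The group in which the presentation `relators64` is realized. -/
abbrev Model64 : Type := DihedralGroup 4 × DihedralGroup 4 × Multiplicative (ZMod 2)

/-- The images of the generators in `Model64`. -/
def modelGen64 : Fin 4 → Model64 :=
  ![(sr 0, sr 0, 1), (r 1, 1, 1), (1, r 1, 1), (1, 1, Multiplicative.ofAdd 1)]

/-- The homomorphism from the presented group to its model. -/
def toModel64 : Group64 →* Model64 :=
  PresentedGroup.toGroup (f := modelGen64) (by
    intro w hw
    simp only [relators64, Set.mem_insert_iff, Set.mem_singleton_iff] at hw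
    rcases hw with rfl | rfl | rfl | rfl | rfl | rfl | rfl | rfl | rfl | rfl <;>
    · simp only [map_mul, map_pow, map_inv, FreeGroup.lift_apply_of]
      decide)

lemma toModel64_of (i : Fin 4) : toModel64 (PresentedGroup.of i) = modelGen64 i :=
  PresentedGroup.toGroup.of _

/-- The product `a ^ e * b ^ x * c ^ y * d ^ l` for the number with the mixed radix digits
`e, x, y, l` to the bases `2, 4, 4, 2`. -/
def digits64 {M : Type*} [Monoid M] (f : Fin 4 → M) (n : ℕ) : M :=
  f 0 ^ (n / 32 % 2) * f 1 ^ (n / 8 % 4) * f 2 ^ (n / 2 % 4) * f 3 ^ (n % 2)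

/-- The normal form of the elements of `Group64`. -/
def normalForm64 (n : Fin 64) : Group64 := digits64 PresentedGroup.of n

lemma toModel64_normalForm64 (n : Fin 64) :
    toModel64 (normalForm64 n) = digits64 modelGen64 n := by
  simp [normalForm64, digits64, toModel64_of]

/-- The class of a natural number modulo `n + 1`, in a form that evaluates quickly. -/
def zmodOfNat (n k : ℕ) : ZMod (n + 1) := (⟨k % (n + 1), Nat.mod_lt _ n.succ_pos⟩ : Fin (n + 1))

lemma zmodOfNat_eq (n k : ℕ) : zmodOfNat n k = (k : ZMod (n + 1)) := rfl

/-- The element of the model with given mixed radix digits. -/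
def model64 (n : ℕ) : Model64 :=
  if n / 32 % 2 = 0 then
    (r (zmodOfNat 3 (n / 8 % 4)), r (zmodOfNat 3 (n / 2 % 4)),
      Multiplicative.ofAdd (zmodOfNat 1 (n % 2)))
  else
    (sr (zmodOfNat 3 (n / 8 % 4)), sr (zmodOfNat 3 (n / 2 % 4)),
      Multiplicative.ofAdd (zmodOfNat 1 (n % 2)))

lemma digits64_modelGen64 (n : ℕ) : digits64 modelGen64 n = model64 n := by
  have h : n / 32 % 2 = 0 ∨ n / 32 % 2 = 1 := by omega
  rcases h with h | h <;>
  · simp only [digits64, modelGen64, model64, h, Matrix.cons_val, Prod.pow_mk, Prod.mk_mul_mk,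
      one_pow, r_one_pow, pow_zero, pow_one, one_mul, mul_one, sr_mul_r, zero_add, if_true,
      one_ne_zero, if_false, zmodOfNat_eq, Nat.reduceAdd, ← ofAdd_nsmul, nsmul_eq_mul]

lemma model64_injective : Function.Injective fun n : Fin 64 => model64 n := by
  unfold Function.Injective
  decide +kernel

lemma normalForm64_injective : Function.Injective normalForm64 := fun m n h =>
  model64_injective (by
    simp only [← digits64_modelGen64, ← toModel64_normalForm64, h])

lemma normalForm64_surjective : Function.Surjective normalForm64 := by
  have rel : ∀ w ∈ relators64, (QuotientGroup.mk w : Group64) = 1 := fun w hw =>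
    PresentedGroup.one_of_mem hw
  set a : Group64 := PresentedGroup.of 0 with ha
  set b : Group64 := PresentedGroup.of 1 with hb
  set c : Group64 := PresentedGroup.of 2 with hc
  set d : Group64 := PresentedGroup.of 3 with hd
  have ha2 : a ^ 2 = 1 := rel (FreeGroup.of 0 ^ 2) (by simp [relators64])
  have hb4 : b ^ 4 = 1 := rel (FreeGroup.of 1 ^ 4) (by simp [relators64])
  have hc4 : c ^ 4 = 1 := rel (FreeGroup.of 2 ^ 4) (by simp [relators64])
  have hd2 : d ^ 2 = 1 := rel (FreeGroup.of 3 ^ 2) (by simp [relators64])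
  have hab : a⁻¹ * b * a * b = 1 := rel _ (by
    simp only [relators64, Set.mem_insert_iff]; tauto)
  have hac : a⁻¹ * c * a * c = 1 := rel _ (by
    simp only [relators64, Set.mem_insert_iff]; tauto)
  have had : a⁻¹ * d⁻¹ * a * d = 1 := rel _ (by
    simp only [relators64, Set.mem_insert_iff]; tauto)
  have hbc : b⁻¹ * c⁻¹ * b * c = 1 := rel _ (by
    simp only [relators64, Set.mem_insert_iff]; tauto)
  have hbd : b⁻¹ * d⁻¹ * b * d = 1 := rel _ (by
    simp only [relators64, Set.mem_insert_iff]; tauto)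
  have hcd : c⁻¹ * d⁻¹ * c * d = 1 := rel _ (by
    simp only [relators64, Set.mem_insert_iff, Set.mem_singleton_iff]; tauto)
  have comm : ∀ {x y : Group64}, x⁻¹ * y⁻¹ * x * y = 1 → Commute x y := fun {x y} h => by
    have : y * x * (x⁻¹ * y⁻¹ * x * y) = x * y := by group
    rw [h, mul_one] at this
    exact this.symm
  have inv3 : ∀ {x : Group64}, x ^ 4 = 1 → x⁻¹ = x ^ 3 := fun {x} h => by
    rw [inv_eq_iff_mul_eq_one, ← pow_succ', h]
  have flip : ∀ {x : Group64}, x ^ 4 = 1 → a⁻¹ * x * a * x = 1 → x * a = a * x ^ 3 := by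
    intro x h h'
    rw [← inv3 h, ← eq_inv_of_mul_eq_one_left h']
    group
  -- the elements of the form `a ^ e * b ^ x * c ^ y * d ^ l`
  let P : Group64 → Prop := fun g =>
    ∃ e x y l : ℕ, e < 2 ∧ g = a ^ e * b ^ x * c ^ y * d ^ l
  have move : ∀ z : Group64, z ^ 4 = 1 → a⁻¹ * z * a * z = 1 →
      ∀ e < 2, ∃ k, z * a ^ e = a ^ e * z ^ k := by
    intro z h4 h' e he
    interval_cases e
    · exact ⟨1, by simp⟩
    · exact ⟨3, by simpa using flip h4 h'⟩
  have stepa : ∀ g, P g → P (a * g) := by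
    rintro _ ⟨e, x, y, l, he, rfl⟩
    interval_cases e
    · exact ⟨1, x, y, l, by norm_num, by simp [mul_assoc]⟩
    · refine ⟨0, x, y, l, by norm_num, ?_⟩
      simp only [← mul_assoc, pow_one, pow_zero, one_mul]
      rw [← pow_two, ha2, one_mul]
  have stepb : ∀ g, P g → P (b * g) := by
    rintro _ ⟨e, x, y, l, he, rfl⟩
    obtain ⟨k, hk⟩ := move b hb4 hab e he
    refine ⟨e, k + x, y, l, he, ?_⟩
    simp only [← mul_assoc, hk, pow_add]
  have stepc : ∀ g, P g → P (c * g) := by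
    rintro _ ⟨e, x, y, l, he, rfl⟩
    obtain ⟨k, hk⟩ := move c hc4 hac e he
    refine ⟨e, x, k + y, l, he, ?_⟩
    have h1 : c ^ k * b ^ x = b ^ x * c ^ k := ((comm hbc).pow_pow x k).eq.symm
    calc c * (a ^ e * b ^ x * c ^ y * d ^ l) = c * a ^ e * b ^ x * c ^ y * d ^ l := by group
      _ = a ^ e * (c ^ k * b ^ x) * c ^ y * d ^ l := by rw [hk]; group
      _ = _ := by rw [h1, pow_add]; group
  have stepd : ∀ g, P g → P (d * g) := by
    rintro _ ⟨e, x, y, l, he, rfl⟩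
    refine ⟨e, x, y, l + 1, he, ?_⟩
    have h1 : Commute d (a ^ e * b ^ x * c ^ y * d ^ l) :=
      ((((comm had).symm.pow_right e).mul_right ((comm hbd).symm.pow_right x)).mul_right
        ((comm hcd).symm.pow_right y)).mul_right ((Commute.refl d).pow_right l)
    rw [h1.eq, pow_succ, mul_assoc]
  have step : ∀ i : Fin 4, ∀ g, P g → P (PresentedGroup.of i * g) := by
    intro i
    fin_cases i
    exacts [stepa, stepb, stepc, stepd]
  have four : ∀ i : Fin 4, (PresentedGroup.of i : Group64) ^ 4 = 1 := by
    intro i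
    fin_cases i
    · change a ^ 4 = 1
      rw [pow_mul a 2 2, ha2, one_pow]
    · exact hb4
    · exact hc4
    · change d ^ 4 = 1
      rw [pow_mul d 2 2, hd2, one_pow]
  have all : ∀ g : Group64, P g := by
    intro g
    have hg : g ∈ Subgroup.closure (Set.range (PresentedGroup.of (rels := relators64))) := by
      rw [PresentedGroup.closure_range_of]; trivial
    induction hg using Subgroup.closure_induction_left with
    | one => exact ⟨0, 0, 0, 0, by norm_num, by simp⟩
    | mul_left x hx y _ hy =>
      obtain ⟨i, rfl⟩ := hx
      exact step i _ hy
    | inv_mul_cancel x hx y _ hy =>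
      obtain ⟨i, rfl⟩ := hx
      rw [inv3 (four i), pow_succ, pow_two, mul_assoc, mul_assoc]
      exact step i _ (step i _ (step i _ hy))
  intro g
  obtain ⟨e, x, y, l, he, rfl⟩ := all g
  refine ⟨⟨32 * e + 8 * (x % 4) + 2 * (y % 4) + l % 2, by omega⟩, ?_⟩
  have key : ∀ e' x' y' l', e' = e → x' = x % 4 → y' = y % 4 → l' = l % 2 →
      a ^ e' * b ^ x' * c ^ y' * d ^ l' = a ^ e * b ^ x * c ^ y * d ^ l := by
    rintro _ _ _ _ rfl rfl rfl rfl
    rw [← pow_eq_pow_mod x hb4, ← pow_eq_pow_mod y hc4, ← pow_eq_pow_mod l hd2]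
  exact key _ _ _ _ (by dsimp only; omega) (by dsimp only; omega) (by dsimp only; omega)
    (by dsimp only; omega)

/-- The adjacency relation of the graph on the normal forms: as all elements of the connection set
lie outside the abelian subgroup `⟨b, c, d⟩`, on which `a` acts by inversion, `u⁻¹ v` is in the
connection set if and only if the parities of `a` differ and the remaining digits of `u` and `v` add
up to those of an element of the connection set. -/
def adj64 (m n : Fin 64) : Bool :=
  m.1 / 32 != n.1 / 32 && [0, 8, 10, 9, 31, 22, 5, 7].contains
    (8 * ((m.1 / 8 + n.1 / 8) % 4) + 2 * ((m.1 / 2 + n.1 / 2) % 4) + (m.1 + n.1) % 2)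

/-- The connection set, written with an arbitrary choice of generators. -/
def connection64 {M : Type*} [Monoid M] (f : Fin 4 → M) : List M :=
  [f 0, f 0 * f 1, f 0 * f 1 * f 2, f 0 * f 1 * f 3, f 0 * f 1 ^ 3 * f 2 ^ 3 * f 3,
    f 0 * f 1 ^ 2 * f 2 ^ 3, f 0 * f 2 ^ 2 * f 3, f 0 * f 2 ^ 3 * f 3]

lemma adj64_iff (m n : Fin 64) : adj64 m n = true ↔
    (digits64 modelGen64 m)⁻¹ * digits64 modelGen64 n ∈ connection64 modelGen64 := by
  have h : connection64 modelGen64 =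
      [(sr 0, sr 0, Multiplicative.ofAdd 0), (sr 1, sr 0, Multiplicative.ofAdd 0),
        (sr 1, sr 1, Multiplicative.ofAdd 0), (sr 1, sr 0, Multiplicative.ofAdd 1),
        (sr 3, sr 3, Multiplicative.ofAdd 1), (sr 2, sr 3, Multiplicative.ofAdd 0),
        (sr 0, sr 2, Multiplicative.ofAdd 1), (sr 0, sr 3, Multiplicative.ofAdd 1)] := by
    decide
  rw [digits64_modelGen64, digits64_modelGen64, h]
  revert m n
  decide +kernel

/-- The graph on 64 vertices, on the normal forms. -/
def digitGraph64 : SimpleGraph (Fin 64) where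
  Adj m n := adj64 m n = true
  symm := ⟨by decide +kernel⟩
  loopless := ⟨by decide +kernel⟩

instance : DecidableRel digitGraph64.Adj := fun m n =>
  inferInstanceAs (Decidable (adj64 m n = true))

lemma graph64_adj_iff (u v : Group64) :
    graph64.Adj u v ↔ u ≠ v ∧
      (u⁻¹ * v ∈ connection64 PresentedGroup.of ∨ v⁻¹ * u ∈ connection64 PresentedGroup.of) := by
  have h : ∀ g : Group64, g ∈ connection64 (PresentedGroup.of (rels := relators64)) ↔
      g ∈ ({g | g ∈ connection64 (PresentedGroup.of (rels := relators64))} : Set Group64) :=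
    fun g => Iff.rfl
  have e : graph64 = SimpleGraph.mulCayley
      {g | g ∈ connection64 (PresentedGroup.of (rels := relators64))} := by
    rw [graph64]
    congr 1
    ext g
    simp [connection64]
  rw [e, SimpleGraph.mulCayley_adj']
  refine and_congr_right fun _ => ?_
  constructor
  · rintro ⟨g, hg, rfl | rfl⟩
    · left; simpa using hg
    · right; simpa using hg
  · rintro (hg | hg)
    · exact ⟨_, hg, Or.inl (by group)⟩
    · exact ⟨_, hg, Or.inr (by group)⟩

lemma toModel64_injective : Function.Injective toModel64 := by
  intro u v h
  obtain ⟨m, rfl⟩ := normalForm64_surjective u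
  obtain ⟨n, rfl⟩ := normalForm64_surjective v
  rw [toModel64_normalForm64, toModel64_normalForm64, digits64_modelGen64,
    digits64_modelGen64] at h
  rw [model64_injective h]

/-- `graph64` is isomorphic to `digitGraph64`. -/
noncomputable def digitGraphIso64 : digitGraph64 ≃g graph64 where
  toEquiv := Equiv.ofBijective normalForm64 ⟨normalForm64_injective, normalForm64_surjective⟩
  map_rel_iff' {m n} := by
    change graph64.Adj (normalForm64 m) (normalForm64 n) ↔ adj64 m n = true
    have hmap : connection64 modelGen64 = (connection64 PresentedGroup.of).map toModel64 := by
      simp [connection64, toModel64_of]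
    have hmem : ∀ m n : Fin 64, (normalForm64 m)⁻¹ * normalForm64 n ∈
        connection64 PresentedGroup.of ↔ adj64 m n = true := fun m n => by
      rw [adj64_iff, hmap, ← toModel64_normalForm64, ← toModel64_normalForm64, ← map_inv,
        ← map_mul, List.mem_map_of_injective toModel64_injective]
    rw [graph64_adj_iff, hmem, hmem]
    constructor
    · rintro ⟨-, h | h⟩
      · exact h
      · exact digitGraph64.symm.symm _ _ h
    · exact fun h => ⟨fun he => digitGraph64.ne_of_adj h (normalForm64_injective he), Or.inl h⟩

/-- An automorphism of order `7` that fixes `1` and `a`. -/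
def rotation64 : Fin 64 → Fin 64 := fun n =>
  [0, 3, 30, 13, 4, 7, 26, 9, 31, 8, 5, 2, 27, 12, 1, 6, 16, 19, 14, 29, 20, 23, 10, 25, 15, 24,
    21, 18, 11, 28, 17, 22, 32, 46, 43, 33, 36, 42, 47, 37, 41, 39, 54, 60, 45, 35, 50, 56, 48, 62,
    59, 49, 52, 58, 63, 53, 57, 55, 38, 44, 61, 51, 34, 40].getD n 0

/-- The effect on normal forms of a group automorphism of order `3` that preserves the connection
set and maps `a * b` to `a`. -/
def groupAut64 : Fin 64 → Fin 64 := fun n =>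
  [0, 5, 8, 13, 16, 21, 24, 29, 30, 27, 6, 3, 14, 11, 22, 19, 20, 17, 28, 25, 4, 1, 12, 9, 10, 15,
    18, 23, 26, 31, 2, 7, 42, 47, 50, 55, 58, 63, 34, 39, 32, 37, 40, 45, 48, 53, 56, 61, 62, 59,
    38, 35, 46, 43, 54, 51, 52, 49, 60, 57, 36, 33, 44, 41].getD n 0

/-- `rotation64` as a permutation. -/
noncomputable def rotationPerm64 : Equiv.Perm (Fin 64) :=
  Equiv.ofBijective rotation64 (Finite.injective_iff_bijective.mp
    (Function.LeftInverse.injective (g := rotation64^[6])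
      (by unfold Function.LeftInverse; decide +kernel)))

/-- `groupAut64` as a permutation. -/
noncomputable def groupAutPerm64 : Equiv.Perm (Fin 64) :=
  Equiv.ofBijective groupAut64 (Finite.injective_iff_bijective.mp
    (Function.LeftInverse.injective (g := groupAut64^[2])
      (by unfold Function.LeftInverse; decide +kernel)))

lemma rotationPerm64_mem : rotationPerm64 ∈ autPerm digitGraph64 := by
  refine mem_autPerm_of_forall_adj ?_
  change ∀ u v, digitGraph64.Adj u v → digitGraph64.Adj (rotation64 u) (rotation64 v)
  decide +kernel

lemma groupAutPerm64_mem : groupAutPerm64 ∈ autPerm digitGraph64 := by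
  refine mem_autPerm_of_forall_adj ?_
  change ∀ u v, digitGraph64.Adj u v → digitGraph64.Adj (groupAut64 u) (groupAut64 v)
  decide +kernel

theorem isGeodesicTransitive_two_digitGraph64 : IsGeodesicTransitive digitGraph64 2 := by
  have mem : ∀ i j : ℕ, groupAutPerm64 ^ j * rotationPerm64 ^ i ∈ autPerm digitGraph64 :=
    fun i j => mul_mem (pow_mem groupAutPerm64_mem j) (pow_mem rotationPerm64_mem i)
  have hcoe : ∀ (i j : ℕ) (x), (groupAutPerm64 ^ j * rotationPerm64 ^ i) x =
      groupAut64^[j] (rotation64^[i] x) := fun i j x => by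
    rw [Equiv.Perm.mul_apply, ← Equiv.Perm.iterate_eq_pow, ← Equiv.Perm.iterate_eq_pow]; rfl
  refine isGeodesicTransitive_two_of_perms 0 32 8 (by decide) (by decide) (by decide) (by decide)
    (fun u v => ?_) (fun w hw => ?_) (fun w hw hne => ?_)
  · let e := digitGraphIso64
    obtain ⟨φ, hφ⟩ := exists_iso_mulCayley _ (e u) (e v)
    exact ⟨(e.trans φ).trans e.symm, (congrArg e.symm hφ).trans (e.symm_apply_apply v)⟩
  · have : ∀ w, digitGraph64.Adj 0 w → ∃ i : Fin 7, ∃ j : Fin 2,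
        groupAut64^[j] (rotation64^[i] 0) = 0 ∧
        groupAut64^[j] (rotation64^[i] w) = 32 := by decide +kernel
    obtain ⟨i, j, h⟩ := this w hw
    exact ⟨_, mem i j, by simpa only [hcoe] using h⟩
  · have : ∀ w, digitGraph64.Adj 32 w → w ≠ 0 → ∃ i : Fin 7,
        rotation64^[i] 0 = 0 ∧ rotation64^[i] 32 = 32 ∧ rotation64^[i] w = 8 := by decide +kernel
    obtain ⟨i, h⟩ := this w hw hne
    exact ⟨_, mem i 0, by simp only [hcoe]; exact h⟩

theorem not_isGeodesicTransitive_three_digitGraph64 : ¬ IsGeodesicTransitive digitGraph64 3 := by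
  have h01 : digitGraph64.Adj 0 32 := by decide
  have h12 : digitGraph64.Adj 32 5 := by decide
  have geo : ∀ x, digitGraph64.Adj 5 x → ¬ digitGraph64.Adj 0 x →
      (∀ z, digitGraph64.Adj 0 z → ¬ digitGraph64.Adj z x) → 0 ≠ x →
      IsGeodesic digitGraph64 3 ![0, 32, 5, x] := fun x h1 h2 h3 h4 =>
    isGeodesic_of_chain (fun i => by
        fin_cases i
        · exact h01
        · exact h12
        · exact h1)
      (dist_eq_three h4 h2 h3 h01 h12 h1)
  -- A pattern of four further vertices that exists for one of two `3`-geodesics with the same first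
  -- three vertices, and not for the other.
  refine not_isGeodesicTransitive_of_invariant (by norm_num)
    (fun p => ∃ v, digitGraph64.Adj v (p 0) ∧ ¬ digitGraph64.Adj v (p 2) ∧
      ∃ w, digitGraph64.Adj w (p 2) ∧ ¬ digitGraph64.Adj w (p 0) ∧
      (∃ x, digitGraph64.Adj x v ∧ digitGraph64.Adj x w ∧ digitGraph64.Adj x (p 1) ∧
        ¬ digitGraph64.Adj x (p 3) ∧ x ≠ p 0) ∧
      ∃ y, digitGraph64.Adj y v ∧ digitGraph64.Adj y w ∧ digitGraph64.Adj y (p 3) ∧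
        ¬ digitGraph64.Adj y (p 1)) ?_
    (geo 34 (by decide) (by decide) (by decide +kernel) (by decide))
    (geo 45 (by decide) (by decide) (by decide +kernel) (by decide))
    ?_ ?_
  · rintro φ p ⟨v, h1, h2, w, h3, h4, ⟨x, hx⟩, ⟨y, hy⟩⟩
    simp only [← φ.map_adj_iff (v := v), ← φ.map_adj_iff (v := w), ← φ.map_adj_iff (v := x),
      ← φ.map_adj_iff (v := y), ← φ.injective.ne_iff (x := x)] at h1 h2 h3 h4 hx hy
    exact ⟨φ v, h1, h2, φ w, h3, h4, ⟨φ x, hx⟩, ⟨φ y, hy⟩⟩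
  · change ∃ v, digitGraph64.Adj v 0 ∧ ¬ digitGraph64.Adj v 5 ∧
      ∃ w, digitGraph64.Adj w 5 ∧ ¬ digitGraph64.Adj w 0 ∧
      (∃ x, digitGraph64.Adj x v ∧ digitGraph64.Adj x w ∧ digitGraph64.Adj x 32 ∧
        ¬ digitGraph64.Adj x 34 ∧ x ≠ 0) ∧
      ∃ y, digitGraph64.Adj y v ∧ digitGraph64.Adj y w ∧ digitGraph64.Adj y 34 ∧
        ¬ digitGraph64.Adj y 32
    decide +kernel
  · change ¬ ∃ v, digitGraph64.Adj v 0 ∧ ¬ digitGraph64.Adj v 5 ∧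
      ∃ w, digitGraph64.Adj w 5 ∧ ¬ digitGraph64.Adj w 0 ∧
      (∃ x, digitGraph64.Adj x v ∧ digitGraph64.Adj x w ∧ digitGraph64.Adj x 32 ∧
        ¬ digitGraph64.Adj x 45 ∧ x ≠ 0) ∧
      ∃ y, digitGraph64.Adj y v ∧ digitGraph64.Adj y w ∧ digitGraph64.Adj y 45 ∧
        ¬ digitGraph64.Adj y 32
    decide +kernel

theorem graph64_conclusion : IsGeodesicTransitive graph64 2 ∧ ¬ IsGeodesicTransitive graph64 3 := by
  rw [← isGeodesicTransitive_congr digitGraphIso64, ← isGeodesicTransitive_congr digitGraphIso64]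
  exact ⟨isGeodesicTransitive_two_digitGraph64, not_isGeodesicTransitive_three_digitGraph64⟩

end Graph64

/-! ### The fields of orders 4 and 16 -/

section Fields

/-- The field of order `4`; the elements are `0`, `1`, a generator `w` of the multiplicative group
and `v = w + 1 = w ^ 2`. It is given by tables so that the kernel computes quickly in it. -/
inductive F4
  | o | i | w | v
deriving DecidableEq

namespace F4

/-- Addition in `F4`. -/
def add : F4 → F4 → F4
  | o, y => y
  | x, o => x
  | i, i => o
  | i, w => v
  | i, v => w
  | w, i => v
  | w, w => o
  | w, v => i
  | v, i => w
  | v, w => i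
  | v, v => o

/-- Multiplication in `F4`. -/
def mul : F4 → F4 → F4
  | o, _ => o
  | _, o => o
  | i, y => y
  | x, i => x
  | w, w => v
  | w, v => i
  | v, w => i
  | v, v => w

/-- The inverse, which for nonzero elements is also the square and the conjugate over the prime
field. -/
def inv : F4 → F4
  | o => o
  | i => i
  | w => v
  | v => w

instance : Fintype F4 := ⟨{o, i, w, v}, fun x => by cases x <;> decide⟩

instance : Zero F4 := ⟨o⟩
instance : One F4 := ⟨i⟩
instance : Add F4 := ⟨add⟩
instance : Mul F4 := ⟨mul⟩
instance : Neg F4 := ⟨id⟩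
instance : Inv F4 := ⟨inv⟩

instance : Field F4 where
  nsmul := nsmulRec
  zsmul := zsmulRec
  nnqsmul := _
  qsmul := _
  add_assoc := by decide
  zero_add := by decide
  add_zero := by decide
  add_comm := by decide
  neg_add_cancel := by decide
  mul_assoc := by decide
  mul_comm := by decide
  one_mul := by decide
  mul_one := by decide
  left_distrib := by decide
  right_distrib := by decide
  zero_mul := by decide
  mul_zero := by decide
  exists_pair_ne := ⟨o, i, by decide⟩
  mul_inv_cancel := by decide
  inv_zero := rfl

instance : StarRing F4 where
  star := inv
  star_involutive := by unfold Function.Involutive; decide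
  star_mul := by decide
  star_add := by decide

lemma two_eq_zero : (2 : F4) = 0 := by decide
lemma three_eq_one : (3 : F4) = 1 := by decide
lemma four_eq_zero : (4 : F4) = 0 := by decide

lemma card : Fintype.card F4 = 4 := by decide

end F4

instance : Fact (∀ r : F4, r ^ 2 ≠ F4.w + 1 * r) := ⟨by decide⟩

/-- The field of order `16`, obtained from `F4` by adjoining a root of `T ^ 2 = T + w`. -/
abbrev F16 : Type := QuadraticAlgebra F4 F4.w 1

instance : Fintype F16 := Fintype.ofEquiv _ (QuadraticAlgebra.equivProd F4.w 1).symm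

lemma F16.card : Fintype.card F16 = 16 := by decide +kernel

end Fields

/-! ### Hermitian forms on the projective line over `F16` -/

section Forms

/-- Conjugation of `F16` over `F4`. -/
def conj16 (z : F16) : F16 := ⟨z.re + z.im, z.im⟩

/-- The norm from `F16` to `F4`. -/
def norm16 (z : F16) : F4 := z.re * (z.re + z.im) + F4.w * z.im * z.im

/-- The Hermitian forms `a x x̄ + b x ȳ + b̄ x̄ y + d y ȳ` over `F16 / F4`, as triples `(a, d, b)`. -/
abbrev Form2 : Type := F4 × F4 × F16

/-- The determinant of a Hermitian form. -/
def disc (M : Form2) : F4 := M.1 * M.2.1 + norm16 M.2.2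

/-- The projective line over `F16`; `none` is the point at infinity. -/
abbrev Line16 : Type := Option F16

/-- Whether a point of the projective line is isotropic for a form. The trace from `F16` to `F4` is
the imaginary part. -/
def isotropic (M : Form2) : Line16 → Bool
  | none => M.1 = 0
  | some z => M.1 * norm16 z + (M.2.2 * z).im + M.2.1 = 0

/-- The Hermitian forms of determinant `1`. As every nonzero element of `F4` is a square, every
nondegenerate form has exactly one multiple of determinant `1`. -/
abbrev Circle68 : Type := {M : Form2 // disc M = 1}

/-- The translation `z ↦ z + c` on the line. -/
def transLine (c : F16) : Line16 → Line16
  | none => none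
  | some z => some (z + c)

/-- The multiplication `z ↦ c z` on the line. -/
def scaleLine (c : F16) : Line16 → Line16
  | none => none
  | some z => some (c * z)

/-- The inversion `z ↦ z⁻¹` on the line. -/
def invLine : Line16 → Line16
  | none => some 0
  | some z => if z = 0 then none else some z⁻¹

/-- The Frobenius map on the line. -/
def frobLine : Line16 → Line16
  | none => none
  | some z => some (z * z)

/-- The action of a translation on forms. -/
def transForm (c : F16) (M : Form2) : Form2 :=
  (M.1, M.2.1 + M.1 * norm16 c + (M.2.2 * c).im, M.2.2 + M.1 • conj16 c)

/-- The action of a multiplication on forms, with the normalization that preserves the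
determinant. -/
def scaleForm (c : F16) (M : Form2) : Form2 :=
  (M.1 * norm16 c, M.2.1 * norm16 c * norm16 c, norm16 c • (M.2.2 * conj16 c))

/-- The action of the inversion on forms. -/
def invForm (M : Form2) : Form2 := (M.2.1, M.1, conj16 M.2.2)

/-- The action of the Frobenius map on forms. -/
def frobForm (M : Form2) : Form2 := (M.1 * M.1, M.2.1 * M.2.1, M.2.2 * M.2.2)

lemma transForm_add (c : F16) (M N : Form2) :
    transForm c (M + N) = transForm c M + transForm c N := by
  ext <;> simp [transForm] <;> ring

lemma scaleForm_add (c : F16) (M N : Form2) :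
    scaleForm c (M + N) = scaleForm c M + scaleForm c N := by
  ext <;> simp [scaleForm] <;> ring

lemma invForm_add (M N : Form2) : invForm (M + N) = invForm M + invForm N := by
  ext <;> simp [invForm, conj16] <;> ring

lemma frobForm_add (M N : Form2) : frobForm (M + N) = frobForm M + frobForm N := by
  ext <;> simp [frobForm] <;> ring_nf <;>
    simp only [F4.two_eq_zero, mul_zero, add_zero, zero_add]

lemma disc_transForm (c : F16) (M : Form2) : disc (transForm c M) = disc M := by
  simp only [disc, transForm, norm16, conj16, QuadraticAlgebra.re_add, QuadraticAlgebra.im_add,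
    QuadraticAlgebra.re_smul, QuadraticAlgebra.im_smul, QuadraticAlgebra.im_mul, smul_eq_mul]
  ring_nf
  simp only [F4.two_eq_zero, F4.four_eq_zero, mul_zero, add_zero]

lemma disc_scaleForm : ∀ c M, c ≠ 0 → disc (scaleForm c M) = disc M := by decide +kernel

lemma disc_invForm (M : Form2) : disc (invForm M) = disc M := by
  simp only [disc, invForm, norm16, conj16]
  ring_nf
  simp only [F4.two_eq_zero, F4.three_eq_one, mul_zero, add_zero, mul_one]

lemma disc_frobForm : ∀ M, disc (frobForm M) = disc M * disc M := by decide +kernel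

lemma isotropic_transForm (c : F16) (M : Form2) (p : Line16) :
    isotropic (transForm c M) (transLine c p) = isotropic M p := by
  cases p with
  | none => rfl
  | some z =>
    simp only [isotropic, transForm, transLine, norm16, conj16, QuadraticAlgebra.re_add,
      QuadraticAlgebra.im_add, QuadraticAlgebra.re_smul, QuadraticAlgebra.im_smul,
      QuadraticAlgebra.im_mul, smul_eq_mul]
    congr 1
    ring_nf
    simp only [F4.two_eq_zero, F4.four_eq_zero, mul_zero, add_zero, zero_add]

lemma norm16_ne_zero : ∀ c, c ≠ 0 → norm16 c ≠ 0 := by decide +kernel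

lemma norm16_mul : ∀ c z, norm16 (c * z) = norm16 c * norm16 z := by decide +kernel

lemma conj16_mul_self : ∀ c, conj16 c * c = ⟨norm16 c, 0⟩ := by decide +kernel

lemma isotropic_scaleForm (c : F16) (hc : c ≠ 0) (M : Form2) (p : Line16) :
    isotropic (scaleForm c M) (scaleLine c p) = isotropic M p := by
  have hn := norm16_ne_zero c hc
  cases p with
  | none => simp [isotropic, scaleForm, scaleLine, hn]
  | some z =>
    have h : M.1 * norm16 c * norm16 (c * z) +
        ((norm16 c • (M.2.2 * conj16 c)) * (c * z)).im + M.2.1 * norm16 c * norm16 c =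
        norm16 c * norm16 c * (M.1 * norm16 z + (M.2.2 * z).im + M.2.1) := by
      have e : (norm16 c • (M.2.2 * conj16 c)) * (c * z) =
          norm16 c • ((conj16 c * c) * (M.2.2 * z)) := by
        rw [smul_mul_assoc]; congr 1; ring
      rw [e, conj16_mul_self, norm16_mul, QuadraticAlgebra.im_smul, QuadraticAlgebra.im_mul]
      simp only [smul_eq_mul]
      ring
    simp only [isotropic, scaleForm, scaleLine, h]
    simp [hn]

lemma isotropic_invForm : ∀ M : Circle68, ∀ p,
    isotropic (invForm M) (invLine p) = isotropic M p := by decide +kernel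

lemma isotropic_frobForm : ∀ M : Circle68, ∀ p,
    isotropic (frobForm M) (frobLine p) = isotropic M p := by decide +kernel

lemma isotropic_injective : ∀ M N : Circle68, isotropic M = isotropic N → M = N := by
  decide +kernel

/-- Two circles are adjacent if they are disjoint as sets of isotropic points, which amounts to the
sum of the two forms having determinant `1`. -/
def circleGraph68 : SimpleGraph Circle68 where
  Adj M N := disc (M.1 + N.1) = 1
  symm := ⟨fun M N h => by rwa [add_comm]⟩
  loopless := ⟨fun M h => by
    have h0 : ∀ M : Form2, disc (M + M) ≠ 1 := by decide +kernel
    exact h0 _ h⟩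

instance : DecidableRel circleGraph68.Adj := fun M N =>
  inferInstanceAs (Decidable (disc (M.1 + N.1) = 1))

/-- The circle of the points of the projective line over `F4`. -/
def circle₀ : Circle68 := ⟨(0, 0, 1), by decide⟩

/-- A neighbour of `circle₀`. -/
def circle₁ : Circle68 := ⟨(.i, .w, ⟨.w, .i⟩), by decide⟩

/-- A neighbour of `circle₁` at distance `2` from `circle₀`. -/
def circle₂ : Circle68 := ⟨(0, 0, ⟨.w, .w⟩), by decide⟩

/-- The distance of a circle from `circle₀`. -/
def level68 (M : Circle68) : ℕ :=
  if M = circle₀ then 0 else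
    match disc (M.1 + circle₀.1) with
    | .i => 1
    | .o => 3
    | _ => 2

/-- A map of forms induced by an element of `PΓL₂(4)`, described by the Bruhat decomposition. -/
def subfieldMap (k : ℕ) (e : Option F4) (c d : F4) (M : Form2) : Form2 :=
  frobForm^[k] (transForm ⟨c, 0⟩ (scaleForm ⟨d, 0⟩
    (match e with | none => M | some e => invForm (transForm ⟨e, 0⟩ M))))

lemma level68_spec : ∀ M : Circle68, (level68 M = 0 ↔ M = circle₀) ∧
    (∀ N : Circle68, circleGraph68.Adj M N → level68 N ≤ level68 M + 1) ∧
    (level68 M ≠ 0 → ∃ N, circleGraph68.Adj M N ∧ level68 N + 1 = level68 M) := by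
  decide +kernel

lemma sphere68_one : ∀ M : Circle68, level68 M = 1 → ∃ (k : Fin 4) (e : Option F4) (c d : F4),
    d ≠ 0 ∧ subfieldMap k e c d M.1 = circle₁.1 := by
  decide +kernel

lemma sphere68_two : ∀ M : Circle68, circleGraph68.Adj circle₁ M → level68 M = 2 →
    ∃ (k : Fin 4) (e : Option F4) (c d : F4), d ≠ 0 ∧
      subfieldMap k e c d circle₁.1 = circle₁.1 ∧ subfieldMap k e c d M.1 = circle₂.1 := by
  decide +kernel

lemma sphere68_three : ∀ M : Circle68, level68 M = 3 →
    ∃ (k : Fin 4) (e : Option F4) (c d : F4), d ≠ 0 ∧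
      subfieldMap k e c d M.1 = (.i, .v, ⟨.v, .o⟩) := by
  decide +kernel

end Forms

/-! ### Counting with group actions -/

section Counting

variable {G X : Type*} [Group G] [MulAction G X]

/-- The orbit-stabilizer theorem for a subgroup `K`, with the stabilizer as a subgroup of `G`. -/
lemma card_eq_ncard_orbit_mul (K : Subgroup G) (x : X) :
    Nat.card K = (MulAction.orbit K x).ncard *
      Nat.card (K ⊓ MulAction.stabilizer G x : Subgroup G) := by
  have h : (MulAction.stabilizer G x).subgroupOf K = MulAction.stabilizer K x := rfl
  rw [← MulAction.index_stabilizer, ← h, ← Subgroup.card_mul_index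
    ((MulAction.stabilizer G x).subgroupOf K), mul_comm, ← Subgroup.inf_subgroupOf_left,
    Nat.card_congr (Subgroup.subgroupOfEquivOfLe (inf_le_left :
      K ⊓ MulAction.stabilizer G x ≤ K)).toEquiv]

/-- An element whose `p`-th power is trivial acts on the points of an invariant set that it moves
in cycles of length `p`. -/
lemma ncard_modEq_ncard_fixed [Finite X] {p : ℕ} [Fact p.Prime] {t : G} (ht : t ^ p = 1)
    {S : Set X} (hS : ∀ x ∈ S, t • x ∈ S) : S.ncard ≡ {x ∈ S | t • x = x}.ncard [MOD p] := by
  classical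
  have := Fintype.ofFinite S
  let f : Function.End S := fun x => ⟨t • x.1, hS x x.2⟩
  have hf : ∀ (n : ℕ) (x : S), ((f ^ n) x).1 = t ^ n • x.1 := by
    intro n
    induction n with
    | zero => intro x; simp; rfl
    | succ n ih =>
      intro x
      rw [pow_succ', pow_succ', mul_smul, ← ih]
      rfl
  have h := Equiv.Perm.card_fixedPoints_modEq (f := f) (p := p) (n := 1) (by
    funext x
    apply Subtype.ext
    rw [hf, pow_one, ht, one_smul]; rfl)
  rw [← Nat.card_coe_set_eq, ← Nat.card_coe_set_eq, Nat.card_eq_fintype_card]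
  refine h.trans (congrArg (· % p) ?_)
  rw [← Nat.card_eq_fintype_card]
  refine Nat.card_congr ⟨fun x => ⟨x.1.1, x.1.2, congrArg Subtype.val x.2⟩,
    fun x => ⟨⟨x.1, x.2.1⟩, Subtype.ext x.2.2⟩, fun _ => rfl, fun _ => rfl⟩

end Counting

/-! ### The action of `PΓL₂(16)` on the projective line over `F16` -/

section Line

/-- The model `F16` of the field of order `16` is isomorphic to Mathlib's. -/
noncomputable def fieldEquiv16 : F16 ≃+* GaloisField 2 4 :=
  letI := Fintype.ofFinite (GaloisField 2 4)
  FiniteField.ringEquivOfCardEq <| by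
    rw [← Nat.card_eq_fintype_card (α := GaloisField 2 4), GaloisField.card 2 4 (by norm_num),
      F16.card]
    norm_num

/-- Homogeneous coordinates of the points of `Line16`. -/
noncomputable def lineCoord : Line16 → Fin 2 → GaloisField 2 4
  | none => ![1, 0]
  | some t => ![fieldEquiv16 t, 1]

lemma lineCoord_ne_zero (p : Line16) : lineCoord p ≠ 0 := by
  cases p with
  | none => intro h; simpa [lineCoord] using congrFun h 0
  | some t => intro h; simpa [lineCoord] using congrFun h 1

lemma exists_smul_lineCoord (v : Fin 2 → GaloisField 2 4) (hv : v ≠ 0) :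
    ∃ (a : GaloisField 2 4) (p : Line16), a ≠ 0 ∧ v = a • lineCoord p := by
  by_cases h : v 1 = 0
  · refine ⟨v 0, none, fun h0 => hv ?_, ?_⟩
    · ext i; fin_cases i <;> simp [h, h0]
    · ext i; fin_cases i <;> simp [h, lineCoord]
  · refine ⟨v 1, some (fieldEquiv16.symm ((v 1)⁻¹ * v 0)), h, ?_⟩
    ext i; fin_cases i <;> simp [h, lineCoord]

lemma eq_of_lineCoord_eq_smul {p q : Line16} {a : GaloisField 2 4}
    (h : lineCoord p = a • lineCoord q) : p = q := by
  cases p with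
  | none =>
    cases q with
    | none => rfl
    | some t =>
      have h1 := congrFun h 1
      have h0 := congrFun h 0
      simp [lineCoord] at h0 h1
      simp [← h1] at h0
  | some s =>
    cases q with
    | none => simpa [lineCoord] using congrFun h 1
    | some t =>
      have h1 := congrFun h 1
      have h0 := congrFun h 0
      simp [lineCoord] at h0 h1
      rw [← h1, one_mul] at h0
      rw [fieldEquiv16.injective h0]

/-- The points of `Line16` are those of Mathlib's projective line. -/
noncomputable def lineEquiv : Line16 ≃ ℙ (GaloisField 2 4) (Fin 2 → GaloisField 2 4) :=
  Equiv.ofBijective (fun p => Projectivization.mk _ (lineCoord p) (lineCoord_ne_zero p)) <| by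
    constructor
    · intro p q h
      obtain ⟨a, ha⟩ := (Projectivization.mk_eq_mk_iff' _ _ _ _ _).mp h
      exact eq_of_lineCoord_eq_smul ha.symm
    · intro x
      induction x using Projectivization.ind with
      | h v hv =>
        obtain ⟨a, p, ha, rfl⟩ := exists_smul_lineCoord v hv
        refine ⟨p, ?_⟩
        rw [Projectivization.mk_eq_mk_iff']
        exact ⟨a⁻¹, by rw [inv_smul_smul₀ ha]⟩

lemma lineEquiv_apply (p : Line16) : lineEquiv p =
    Projectivization.mk _ (lineCoord p) (lineCoord_ne_zero p) := rfl

/-- The action of `PΓL₂(16)` on the projective line, transported along `lineEquiv`. -/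
noncomputable instance : MulAction PGammaL216 Line16 where
  smul g p := lineEquiv.symm (g.1 (lineEquiv p))
  one_smul p := lineEquiv.symm_apply_apply p
  mul_smul g h p := by
    change lineEquiv.symm ((g * h).1 (lineEquiv p)) =
      lineEquiv.symm (g.1 (lineEquiv (lineEquiv.symm (h.1 (lineEquiv p)))))
    rw [Equiv.apply_symm_apply]; rfl

lemma lineEquiv_smul (g : PGammaL216) (p : Line16) :
    lineEquiv (g • p) = g.1 (lineEquiv p) := lineEquiv.apply_symm_apply _

lemma pGammaL216_ext {g h : PGammaL216} (hgh : ∀ p : Line16, g • p = h • p) : g = h := by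
  apply Subtype.ext
  ext x
  obtain ⟨p, rfl⟩ := lineEquiv.surjective x
  rw [← lineEquiv_smul, ← lineEquiv_smul, hgh]

/-- A permutation of the line that is semilinear in homogeneous coordinates. -/
lemma exists_smul_eq_of_semilinear (τ : Line16 → Line16)
    (σ : GaloisField 2 4 ≃+* GaloisField 2 4)
    (f : (Fin 2 → GaloisField 2 4) → (Fin 2 → GaloisField 2 4))
    (hadd : ∀ v w, f (v + w) = f v + f w) (hsmul : ∀ t v, f (t • v) = σ t • f v)
    (hf : ∀ p, ∃ a : GaloisField 2 4, a ≠ 0 ∧ f (lineCoord p) = a • lineCoord (τ p)) :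
    ∃ g : PGammaL216, ∀ p : Line16, g • p = τ p := by
  let f' : (Fin 2 → GaloisField 2 4) →+ (Fin 2 → GaloisField 2 4) := AddMonoidHom.mk' f hadd
  have hinj : Function.Injective f' := by
    rw [injective_iff_map_eq_zero]
    intro v hv
    by_contra hv0
    obtain ⟨a, p, ha, rfl⟩ := exists_smul_lineCoord v hv0
    obtain ⟨b, hb, hp⟩ := hf p
    change f _ = 0 at hv
    rw [hsmul, hp, smul_smul] at hv
    have := smul_ne_zero (mul_ne_zero ((map_ne_zero_iff σ σ.injective).mpr ha) hb)
      (lineCoord_ne_zero (τ p))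
    exact this hv
  let e : (Fin 2 → GaloisField 2 4) ≃+ (Fin 2 → GaloisField 2 4) :=
    AddEquiv.ofBijective f' (Finite.injective_iff_bijective.mp hinj)
  have hτ : Function.Injective τ := by
    intro p q hpq
    obtain ⟨a, ha, hp⟩ := hf p
    obtain ⟨b, hb, hq⟩ := hf q
    apply eq_of_lineCoord_eq_smul (a := σ.symm (a * b⁻¹))
    apply hinj
    change f _ = f _
    rw [hsmul, hp, hq, hpq, σ.apply_symm_apply, smul_smul, inv_mul_cancel_right₀ hb]
  let τ' : Equiv.Perm Line16 := Equiv.ofBijective τ (Finite.injective_iff_bijective.mp hτ)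
  refine ⟨⟨lineEquiv.permCongr τ', σ, e, hsmul, fun v hv => ?_⟩, fun p => ?_⟩
  · obtain ⟨a, p, ha, rfl⟩ := exists_smul_lineCoord v hv
    obtain ⟨b, hb, hp⟩ := hf p
    have h1 : Projectivization.mk (GaloisField 2 4) (a • lineCoord p) hv = lineEquiv p := by
      rw [lineEquiv_apply, Projectivization.mk_eq_mk_iff']
      exact ⟨a, rfl⟩
    rw [h1, Equiv.permCongr_apply, Equiv.symm_apply_apply]
    change lineEquiv (τ p) = _
    rw [lineEquiv_apply, Projectivization.mk_eq_mk_iff']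
    refine ⟨(σ a * b)⁻¹, ?_⟩
    change _ • f _ = _
    rw [hsmul, hp, smul_smul, smul_smul, mul_assoc, inv_mul_cancel₀, one_smul]
    exact mul_ne_zero ((map_ne_zero_iff σ σ.injective).mpr ha) hb
  · apply lineEquiv.injective
    rw [lineEquiv_smul, Equiv.permCongr_apply, Equiv.symm_apply_apply]
    rfl

lemma exists_smul_eq_transLine (c : F16) : ∃ g : PGammaL216, ∀ p, g • p = transLine c p := by
  refine exists_smul_eq_of_semilinear _ (RingEquiv.refl _)
    (fun v => ![v 0 + fieldEquiv16 c * v 1, v 1]) (fun v w => ?_) (fun t v => ?_)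
    (fun p => ⟨1, one_ne_zero, ?_⟩)
  · ext i; fin_cases i <;> (simp; try ring)
  · ext i; fin_cases i <;> (simp; try ring)
  · ext i; cases p <;> fin_cases i <;> simp [lineCoord, transLine]

lemma exists_smul_eq_scaleLine {c : F16} (hc : c ≠ 0) :
    ∃ g : PGammaL216, ∀ p, g • p = scaleLine c p := by
  refine exists_smul_eq_of_semilinear _ (RingEquiv.refl _)
    (fun v => ![fieldEquiv16 c * v 0, v 1]) (fun v w => ?_) (fun t v => ?_)
    (fun p => ⟨if p = none then fieldEquiv16 c else 1, ?_, ?_⟩)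
  · ext i; fin_cases i <;> (simp; try ring)
  · ext i; fin_cases i <;> (simp; try ring)
  · split_ifs <;> simp [hc]
  · ext i; cases p <;> fin_cases i <;> simp [lineCoord, scaleLine]

lemma exists_smul_eq_invLine : ∃ g : PGammaL216, ∀ p, g • p = invLine p := by
  refine exists_smul_eq_of_semilinear _ (RingEquiv.refl _) (fun v => ![v 1, v 0])
    (fun v w => ?_) (fun t v => ?_)
    (fun p => ⟨match p with | none => 1 | some t => if t = 0 then 1 else fieldEquiv16 t, ?_, ?_⟩)
  · ext i; fin_cases i <;> simp
  · ext i; fin_cases i <;> simp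
  · cases p with
    | none => simp
    | some t => by_cases ht : t = 0 <;> simp [ht]
  · cases p with
    | none => ext i; fin_cases i <;> simp [lineCoord, invLine]
    | some t =>
      by_cases ht : t = 0
      · ext i; fin_cases i <;> simp [lineCoord, invLine, ht]
      · ext i; fin_cases i <;> simp [lineCoord, invLine, ht]

lemma exists_smul_eq_frobLine : ∃ g : PGammaL216, ∀ p, g • p = frobLine p := by
  refine exists_smul_eq_of_semilinear _ (frobeniusEquiv (GaloisField 2 4) 2)
    (fun v => ![v 0 ^ 2, v 1 ^ 2])
    (fun v w => ?_) (fun t v => ?_) (fun p => ⟨1, one_ne_zero, ?_⟩)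
  · ext i; fin_cases i <;> simp [add_pow_char]
  · have h : frobeniusEquiv (GaloisField 2 4) 2 t = t ^ 2 := rfl
    ext i; fin_cases i <;> simp [mul_pow, h]
  · ext i; cases p <;> fin_cases i <;> simp [lineCoord, frobLine, pow_two]

/-- The Frobenius powers are the only elements that fix `∞`, `0` and `1`. -/
lemma exists_smul_eq_frobLine_iterate (g : PGammaL216) (h : g • (none : Line16) = none)
    (h0 : g • (some 0 : Line16) = some 0) (h1 : g • (some 1 : Line16) = some 1) :
    ∃ k : Fin 4, ∀ p : Line16, g • p = frobLine^[k] p := by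
  obtain ⟨⟨g', σ, f, hsmul, hg⟩, rfl⟩ : ∃ g', g' = g := ⟨g, rfl⟩
  have key : ∀ p q : Line16, (⟨g', σ, f, hsmul, hg⟩ : PGammaL216) • p = q →
      ∃ a : GaloisField 2 4, a ≠ 0 ∧ f (lineCoord p) = a • lineCoord q := by
    intro p q hpq
    have := congrArg lineEquiv hpq
    rw [lineEquiv_smul, lineEquiv_apply, hg, lineEquiv_apply,
      Projectivization.mk_eq_mk_iff] at this
    obtain ⟨a, ha⟩ := this
    exact ⟨a, a.ne_zero, ha.symm⟩
  obtain ⟨a, ha, hfa⟩ := key _ _ h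
  obtain ⟨b, hb, hfb⟩ := key _ _ h0
  obtain ⟨c, hc, hfc⟩ := key _ _ h1
  have hsum : ∀ t : F16, lineCoord (some t) =
      fieldEquiv16 t • lineCoord none + lineCoord (some 0) := by
    intro t; ext i; fin_cases i <;> simp [lineCoord]
  have hft : ∀ t : F16, f (lineCoord (some t)) = ![σ (fieldEquiv16 t) * a, b] := by
    intro t
    rw [hsum, map_add, hsmul, hfa, hfb]
    ext i; fin_cases i <;> simp [lineCoord]
  have hab : a = b := by
    have := (hft 1).symm.trans hfc
    have e0 := congrFun this 0
    have e1 := congrFun this 1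
    simp [lineCoord] at e0 e1
    rw [e0, e1]
  subst hab
  let τ : F16 ≃+* F16 := (fieldEquiv16.trans σ).trans fieldEquiv16.symm
  have hτ : ∀ t : F16, (⟨g', σ, f, hsmul, hg⟩ : PGammaL216) • (some t : Line16) = some (τ t) := by
    intro t
    apply lineEquiv.injective
    rw [lineEquiv_smul, lineEquiv_apply, hg, lineEquiv_apply, Projectivization.mk_eq_mk_iff']
    refine ⟨a, ?_⟩
    rw [hft]
    ext i; fin_cases i <;> simp [lineCoord, τ, mul_comm]
  -- The generator `T = ω` satisfies `T ^ 4 = T + 1`, and so does its image.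
  have hT : ∀ y : F16, y ^ 4 = y + 1 → ∃ k : Fin 4, y = (fun z => z * z)^[k] (⟨.o, .i⟩ : F16) := by
    decide +kernel
  have hpow : ∀ z : F16, z = 0 ∨ ∃ j : Fin 15, z = (⟨.o, .i⟩ : F16) ^ (j : ℕ) := by
    decide +kernel
  obtain ⟨k, hk⟩ := hT (τ ⟨.o, .i⟩) (by
    have : (⟨.o, .i⟩ : F16) ^ 4 = ⟨.o, .i⟩ + 1 := by decide +kernel
    rw [← map_pow, this, map_add, map_one])
  have hsq : ∀ n : ℕ, (fun z : F16 => z * z)^[n] = fun z => z ^ (2 ^ n) := by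
    intro n
    induction n with
    | zero => ext z <;> simp
    | succ n ih =>
      rw [Function.iterate_succ', ih]
      funext z
      simp only [Function.comp]
      ring
  have hfrob : ∀ (n : ℕ) (t : F16), frobLine^[n] (some t) = some (t ^ (2 ^ n)) := by
    intro n t
    rw [← congrFun (hsq n) t]
    induction n with
    | zero => rfl
    | succ n ih => rw [Function.iterate_succ_apply', Function.iterate_succ_apply', ih]; rfl
  have hfix : ∀ n : ℕ, frobLine^[n] none = none := fun n =>
    Function.iterate_fixed (f := frobLine) rfl n
  refine ⟨k, fun p => ?_⟩
  cases p with
  | none => rw [hfix, h]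
  | some t =>
    rw [hτ, hfrob]
    congr 1
    obtain rfl | ⟨j, rfl⟩ := hpow t
    · simp
    · rw [map_pow, hk, hsq]
      ring

/-- A subgroup that contains the translations, the multiplications and the inversion is transitive
on triples of distinct points. -/
lemma exists_mem_smul_eq_triple (K : Subgroup PGammaL216)
    (ht : ∀ (c : F16) (g : PGammaL216), (∀ p, g • p = transLine c p) → g ∈ K)
    (hs : ∀ (c : F16) (g : PGammaL216), c ≠ 0 → (∀ p, g • p = scaleLine c p) → g ∈ K)
    (hi : ∀ g : PGammaL216, (∀ p, g • p = invLine p) → g ∈ K)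
    {p q r : Line16} (hpq : p ≠ q) (hpr : p ≠ r) (hqr : q ≠ r) :
    ∃ g ∈ K, g • p = none ∧ g • q = some 0 ∧ g • r = some 1 := by
  have add_self : ∀ z : F16, z + z = 0 := by decide +kernel
  obtain ⟨g₁, h₁, e₁⟩ : ∃ g ∈ K, g • p = none := by
    cases p with
    | none => exact ⟨1, one_mem K, one_smul _ _⟩
    | some z =>
      obtain ⟨g, hg⟩ := exists_smul_eq_transLine z
      obtain ⟨g', hg'⟩ := exists_smul_eq_invLine
      refine ⟨g' * g, mul_mem (hi _ hg') (ht _ _ hg), ?_⟩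
      rw [mul_smul, hg, hg']
      simp [transLine, invLine, add_self]
  obtain ⟨b, hb⟩ : ∃ b, g₁ • q = some b := by
    rw [← Option.ne_none_iff_exists', ← e₁]
    exact (MulAction.injective g₁).ne hpq.symm
  obtain ⟨g₂, e₂⟩ := exists_smul_eq_transLine b
  have f2 : (g₂ * g₁) • p = none := by rw [mul_smul, e₁, e₂]; rfl
  have f2' : (g₂ * g₁) • q = some 0 := by rw [mul_smul, hb, e₂]; simp [transLine, add_self]
  obtain ⟨c, hc⟩ : ∃ c, (g₂ * g₁) • r = some c := by
    rw [← Option.ne_none_iff_exists', ← f2]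
    exact (MulAction.injective _).ne hpr.symm
  have hc0 : c ≠ 0 := by
    rintro rfl
    exact hqr (MulAction.injective (g₂ * g₁) (f2'.trans hc.symm))
  obtain ⟨g₃, e₃⟩ := exists_smul_eq_scaleLine (inv_ne_zero hc0)
  exact ⟨g₃ * (g₂ * g₁), mul_mem (hs _ _ (inv_ne_zero hc0) e₃) (mul_mem (ht _ _ e₂) h₁),
    by rw [mul_smul, f2, e₃]; rfl, by rw [mul_smul, f2', e₃]; simp [scaleLine],
    by rw [mul_smul, hc, e₃]; simp [scaleLine, hc0]⟩

lemma exists_smul_eq_triple {p q r : Line16} (hpq : p ≠ q) (hpr : p ≠ r) (hqr : q ≠ r) :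
    ∃ g : PGammaL216, g • p = none ∧ g • q = some 0 ∧ g • r = some 1 := by
  obtain ⟨g, -, h⟩ := exists_mem_smul_eq_triple ⊤ (fun _ _ _ => trivial)
    (fun _ _ _ _ => trivial) (fun _ _ => trivial) hpq hpr hqr
  exact ⟨g, h⟩

/-- The group `PΓL₂(16)` is generated by the translations, the multiplications, the inversion and
the Frobenius map. -/
lemma pGammaL216_eq_top (K : Subgroup PGammaL216)
    (ht : ∀ (c : F16) (g : PGammaL216), (∀ p, g • p = transLine c p) → g ∈ K)
    (hs : ∀ (c : F16) (g : PGammaL216), c ≠ 0 → (∀ p, g • p = scaleLine c p) → g ∈ K)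
    (hi : ∀ g : PGammaL216, (∀ p, g • p = invLine p) → g ∈ K)
    (hf : ∀ g : PGammaL216, (∀ p, g • p = frobLine p) → g ∈ K) : K = ⊤ := by
  rw [eq_top_iff]
  intro g _
  obtain ⟨x, hx, h, h0, h1⟩ := exists_mem_smul_eq_triple K ht hs hi (p := g • none)
    (q := g • some 0) (r := g • some 1) ((MulAction.injective g).ne (by simp))
    ((MulAction.injective g).ne (by simp)) ((MulAction.injective g).ne (by simp))
  rw [← mul_smul] at h h0 h1
  obtain ⟨k, hk⟩ := exists_smul_eq_frobLine_iterate _ h h0 h1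
  obtain ⟨φ, hφ⟩ := exists_smul_eq_frobLine
  have hφk : ∀ (n : ℕ) (p : Line16), φ ^ n • p = frobLine^[n] p := by
    intro n
    induction n with
    | zero => intro p; simp
    | succ n ih => intro p; rw [pow_succ', mul_smul, ih, hφ, Function.iterate_succ_apply']
  have : x * g = φ ^ (k : ℕ) := pGammaL216_ext fun p => by rw [hk, hφk]
  rw [← inv_mul_cancel_left x g, this]
  exact mul_mem (inv_mem hx) (pow_mem (hf _ hφ) _)

lemma exists_ne_ne (p q : Line16) : ∃ r, r ≠ p ∧ r ≠ q := by
  revert p q; decide +kernel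

lemma exists_smul_eq_pair {p q : Line16} (hpq : p ≠ q) :
    ∃ g : PGammaL216, g • p = none ∧ g • q = some 0 := by
  obtain ⟨r, h1, h2⟩ := exists_ne_ne p q
  obtain ⟨g, hg, hg', -⟩ := exists_smul_eq_triple hpq h1.symm h2.symm
  exact ⟨g, hg, hg'⟩

lemma ncard_orbit_line (p : Line16) : (MulAction.orbit (⊤ : Subgroup PGammaL216) p).ncard = 17 := by
  have : MulAction.orbit (⊤ : Subgroup PGammaL216) p = Set.univ := by
    refine Set.eq_univ_of_forall fun q => ?_
    by_cases hpq : p = q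
    · exact hpq ▸ MulAction.mem_orbit_self p
    obtain ⟨r, h1, h2⟩ := exists_ne_ne p q
    obtain ⟨g, hg, -⟩ := exists_smul_eq_pair h1.symm
    obtain ⟨g', hg', -⟩ := exists_smul_eq_pair h2.symm
    refine ⟨⟨g'⁻¹ * g, trivial⟩, ?_⟩
    change (g'⁻¹ * g) • p = q
    rw [mul_smul, hg, inv_smul_eq_iff, hg']
  rw [this, Set.ncard_univ, Nat.card_eq_fintype_card]
  decide +kernel

lemma ncard_orbit_stabilizer {p q : Line16} (hpq : p ≠ q) :
    (MulAction.orbit (MulAction.stabilizer PGammaL216 p) q).ncard = 16 := by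
  have : MulAction.orbit (MulAction.stabilizer PGammaL216 p) q =
      ((Finset.univ.erase p : Finset Line16) : Set Line16) := by
    ext r
    simp only [Finset.coe_erase, Finset.coe_univ, Set.mem_sdiff, Set.mem_univ, true_and,
      Set.mem_singleton_iff]
    constructor
    · rintro ⟨g, rfl⟩ h
      have h2 : g.1 • q = g.1 • p := h.trans (MulAction.mem_stabilizer_iff.mp g.2).symm
      exact hpq (MulAction.injective _ h2).symm
    · intro hr
      obtain ⟨g, hg, hg'⟩ := exists_smul_eq_pair hpq
      obtain ⟨x, hx, hx'⟩ := exists_smul_eq_pair (Ne.symm hr)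
      refine ⟨⟨x⁻¹ * g, ?_⟩, ?_⟩
      · rw [MulAction.mem_stabilizer_iff, mul_smul, hg, inv_smul_eq_iff, hx]
      · change (x⁻¹ * g) • q = r
        rw [mul_smul, hg', inv_smul_eq_iff, hx']
  rw [this, Set.ncard_coe_finset, Finset.card_erase_of_mem (Finset.mem_univ _), Finset.card_univ]
  have : Fintype.card Line16 - 1 = 16 := by decide +kernel
  exact this

lemma card_pGammaL216 : Nat.card PGammaL216 = 16320 := by
  let S := MulAction.stabilizer PGammaL216 (none : Line16)
  let T := S ⊓ MulAction.stabilizer PGammaL216 (some 0 : Line16)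
  let U := T ⊓ MulAction.stabilizer PGammaL216 (some 1 : Line16)
  have hS := card_eq_ncard_orbit_mul (⊤ : Subgroup PGammaL216) (none : Line16)
  have hT := card_eq_ncard_orbit_mul S (some 0 : Line16)
  have hU := card_eq_ncard_orbit_mul T (some 1 : Line16)
  rw [ncard_orbit_line, top_inf_eq, Subgroup.card_top] at hS
  rw [ncard_orbit_stabilizer (by simp)] at hT
  have horb : (MulAction.orbit T (some 1 : Line16)).ncard = 15 := by
    have : MulAction.orbit T (some 1 : Line16) =
        (((Finset.univ.erase none).erase (some 0) : Finset Line16) : Set Line16) := by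
      ext p
      simp only [Finset.coe_erase, Finset.coe_univ, Set.mem_sdiff, Set.mem_univ, true_and,
        Set.mem_singleton_iff]
      constructor
      · rintro ⟨g, rfl⟩
        constructor <;> intro h
        · have h2 : g.1 • (some 1 : Line16) = g.1 • none :=
            h.trans (MulAction.mem_stabilizer_iff.mp g.2.1).symm
          simpa using MulAction.injective _ h2
        · have h2 : g.1 • (some 1 : Line16) = g.1 • some 0 :=
            h.trans (MulAction.mem_stabilizer_iff.mp g.2.2).symm
          simpa using MulAction.injective _ h2
      · rintro ⟨hp, hp'⟩
        obtain ⟨g, hg, hg', hg''⟩ := exists_smul_eq_triple (p := none) (q := some 0) (r := p)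
          (by simp) (Ne.symm hp) (Ne.symm hp')
        refine ⟨⟨g, hg, hg'⟩⁻¹, ?_⟩
        change g⁻¹ • (some 1 : Line16) = p
        rw [inv_smul_eq_iff]; exact hg''.symm
    rw [this, Set.ncard_coe_finset]
    decide +kernel
  have hcard : Nat.card U = 4 := by
    obtain ⟨φ, hφ⟩ := exists_smul_eq_frobLine
    have hφk : ∀ (n : ℕ) (p : Line16), φ ^ n • p = frobLine^[n] p := by
      intro n
      induction n with
      | zero => intro p; simp
      | succ n ih => intro p; rw [pow_succ', mul_smul, ih, hφ, Function.iterate_succ_apply']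
    have h1 : ∀ k : Fin 4, frobLine^[k] none = none ∧ frobLine^[k] (some 0) = some 0 ∧
      frobLine^[k] (some 1) = some 1 := by decide +kernel
    have h2 : ∀ k l : Fin 4, frobLine^[k] (some ⟨.o, .i⟩) = frobLine^[l] (some ⟨.o, .i⟩) →
      k = l := by decide +kernel
    let F : Fin 4 → U := fun k => ⟨φ ^ (k : ℕ), ⟨(hφk _ _).trans (h1 k).1,
      (hφk _ _).trans (h1 k).2.1⟩, (hφk _ _).trans (h1 k).2.2⟩
    have hF : Function.Bijective F := by
      constructor
      · intro k l hkl
        have : φ ^ (k : ℕ) = φ ^ (l : ℕ) := congrArg (fun u : U => u.1) hkl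
        apply h2
        rw [← hφk, ← hφk, this]
      · rintro ⟨g, ⟨hg, hg'⟩, hg''⟩
        obtain ⟨k, hk⟩ := exists_smul_eq_frobLine_iterate g hg hg' hg''
        exact ⟨k, Subtype.ext <| pGammaL216_ext fun p => (hφk _ _).trans (hk p).symm⟩
    rw [← Nat.card_eq_of_bijective F hF, Nat.card_eq_fintype_card, Fintype.card_fin]
  rw [hS, hT, hU, horb, hcard]

/-- The pointwise stabilizer of two points has order `60`. -/
lemma card_dvd_sixty (K : Subgroup PGammaL216) {p q : Line16} (hpq : p ≠ q)
    (hp : K ≤ MulAction.stabilizer PGammaL216 p) (hq : K ≤ MulAction.stabilizer PGammaL216 q) :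
    Nat.card K ∣ 60 := by
  have hS := card_eq_ncard_orbit_mul (⊤ : Subgroup PGammaL216) p
  have hT := card_eq_ncard_orbit_mul (MulAction.stabilizer PGammaL216 p) q
  rw [ncard_orbit_line, top_inf_eq, Subgroup.card_top, card_pGammaL216] at hS
  rw [ncard_orbit_stabilizer hpq] at hT
  have : 60 = Nat.card
    (MulAction.stabilizer PGammaL216 p ⊓ MulAction.stabilizer PGammaL216 q : Subgroup _) := by
    omega
  rw [this]
  exact Subgroup.card_dvd_of_le (le_inf hp hq)

end Line

/-! ### The action of `PΓL₂(16)` on the circles -/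

section Circles

lemma mem_of_isotropic_eq {M N : Circle68} (h : ∀ p, isotropic M p = isotropic N p) : M = N :=
  isotropic_injective M N (funext h)

lemma exists_iso_of_form (g : PGammaL216) (τ : Line16 → Line16) (F : Form2 → Form2)
    (hg : ∀ p, g • p = τ p) (hadd : ∀ M N, F (M + N) = F M + F N)
    (hdisc : ∀ M, disc M = 1 → disc (F M) = 1)
    (hiso : ∀ (M : Circle68) (p : Line16), isotropic (F M) (τ p) = isotropic M p) :
    ∃ φ : circleGraph68 ≃g circleGraph68, ∀ M, (φ M).1 = F M ∧
      ∀ p : Line16, isotropic (φ M) (g • p) = isotropic M p := by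
  let f : Circle68 → Circle68 := fun M => ⟨F M, hdisc M M.2⟩
  have hinj : Function.Injective f := by
    intro M N h
    refine mem_of_isotropic_eq fun p => ?_
    rw [← hiso, ← hiso]
    exact congrArg (fun A : Circle68 => isotropic A.1 (τ p)) h
  let e : Equiv.Perm Circle68 := Equiv.ofBijective f (Finite.injective_iff_bijective.mp hinj)
  refine ⟨autPerm.toIso (e := e) (mem_autPerm_of_forall_adj fun M N h => ?_),
    fun M => ⟨rfl, fun p => ?_⟩⟩
  · change disc (F M + F N) = 1
    rw [← hadd]
    exact hdisc _ h
  · rw [hg]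
    exact hiso M p

lemma exists_iso_transLine {c : F16} {g : PGammaL216} (hg : ∀ p, g • p = transLine c p) :
    ∃ φ : circleGraph68 ≃g circleGraph68, ∀ M, (φ M).1 = transForm c M ∧
      ∀ p : Line16, isotropic (φ M) (g • p) = isotropic M p :=
  exists_iso_of_form g _ _ hg (transForm_add c) (fun M hM => by rw [disc_transForm, hM])
    (fun M p => isotropic_transForm c M p)

lemma exists_iso_scaleLine {c : F16} (hc : c ≠ 0) {g : PGammaL216}
    (hg : ∀ p, g • p = scaleLine c p) :
    ∃ φ : circleGraph68 ≃g circleGraph68, ∀ M, (φ M).1 = scaleForm c M ∧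
      ∀ p : Line16, isotropic (φ M) (g • p) = isotropic M p :=
  exists_iso_of_form g _ _ hg (scaleForm_add c) (fun M hM => by rw [disc_scaleForm c M hc, hM])
    (fun M p => isotropic_scaleForm c hc M p)

lemma exists_iso_invLine {g : PGammaL216} (hg : ∀ p, g • p = invLine p) :
    ∃ φ : circleGraph68 ≃g circleGraph68, ∀ M, (φ M).1 = invForm M ∧
      ∀ p : Line16, isotropic (φ M) (g • p) = isotropic M p :=
  exists_iso_of_form g _ _ hg invForm_add (fun M hM => by rw [disc_invForm, hM]) isotropic_invForm

lemma exists_iso_frobLine {g : PGammaL216} (hg : ∀ p, g • p = frobLine p) :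
    ∃ φ : circleGraph68 ≃g circleGraph68, ∀ M, (φ M).1 = frobForm M ∧
      ∀ p : Line16, isotropic (φ M) (g • p) = isotropic M p :=
  exists_iso_of_form g _ _ hg frobForm_add (fun M hM => by rw [disc_frobForm, hM, one_mul])
    isotropic_frobForm

lemma exists_iso_circleGraph68 (g : PGammaL216) : ∃ φ : circleGraph68 ≃g circleGraph68,
    ∀ M, ∀ p : Line16, isotropic (φ M) (g • p) = isotropic M p := by
  let K : Subgroup PGammaL216 :=
    { carrier := {g | ∃ φ : circleGraph68 ≃g circleGraph68,
        ∀ M, ∀ p : Line16, isotropic (φ M) (g • p) = isotropic M p}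
      one_mem' := ⟨SimpleGraph.Iso.refl, fun M p => by rw [one_smul]; rfl⟩
      mul_mem' := by
        rintro g h ⟨φ, hφ⟩ ⟨ψ, hψ⟩
        exact ⟨ψ.trans φ, fun M p => by rw [mul_smul]; exact (hφ _ _).trans (hψ _ _)⟩
      inv_mem' := by
        rintro g ⟨φ, hφ⟩
        refine ⟨φ.symm, fun M p => ?_⟩
        rw [← hφ, smul_inv_smul, RelIso.apply_symm_apply] }
  have hK : K = ⊤ := pGammaL216_eq_top K
    (fun c g hg => (exists_iso_transLine hg).imp fun φ h M => (h M).2)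
    (fun c g hc hg => (exists_iso_scaleLine hc hg).imp fun φ h M => (h M).2)
    (fun g hg => (exists_iso_invLine hg).imp fun φ h M => (h M).2)
    (fun g hg => (exists_iso_frobLine hg).imp fun φ h M => (h M).2)
  have : g ∈ K := hK ▸ trivial
  exact this

/-- The image of a circle is the circle whose isotropic points are the images of those of the given
one. -/
noncomputable instance : SMul PGammaL216 Circle68 where
  smul g M := (exists_iso_circleGraph68 g).choose M

lemma isotropic_smul (g : PGammaL216) (M : Circle68) (p : Line16) :
    isotropic (g • M).1 (g • p) = isotropic M p :=
  (exists_iso_circleGraph68 g).choose_spec M p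

lemma smul_circle_eq {g : PGammaL216} {M N : Circle68}
    (h : ∀ p : Line16, isotropic N (g • p) = isotropic M p) : g • M = N := by
  refine mem_of_isotropic_eq fun p => ?_
  obtain ⟨q, rfl⟩ := MulAction.surjective g p
  rw [isotropic_smul, h]

noncomputable instance : MulAction PGammaL216 Circle68 where
  one_smul M := smul_circle_eq fun p => by rw [one_smul]
  mul_smul g h M := smul_circle_eq fun p => by rw [mul_smul, isotropic_smul, isotropic_smul]

lemma smul_circle_adj (g : PGammaL216) {M N : Circle68} (h : circleGraph68.Adj M N) :
    circleGraph68.Adj (g • M) (g • N) :=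
  (exists_iso_circleGraph68 g).choose.map_adj_iff.mpr h

lemma exists_smul_circle_eq_subfieldMap (k : ℕ) (e : Option F4) (c d : F4) (hd : d ≠ 0) :
    ∃ g : PGammaL216, ∀ M : Circle68, (g • M).1 = subfieldMap k e c d M.1 := by
  have hT : ∀ c : F16, ∃ g : PGammaL216, ∀ M : Circle68, (g • M).1 = transForm c M := by
    intro c
    obtain ⟨g, hg⟩ := exists_smul_eq_transLine c
    obtain ⟨φ, hφ⟩ := exists_iso_transLine hg
    exact ⟨g, fun M => by rw [← (hφ M).1, smul_circle_eq (hφ M).2]⟩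
  have hS : ∃ g : PGammaL216, ∀ M : Circle68, (g • M).1 = scaleForm ⟨d, 0⟩ M := by
    have hd' : (⟨d, 0⟩ : F16) ≠ 0 := fun h => hd (congrArg QuadraticAlgebra.re h)
    obtain ⟨g, hg⟩ := exists_smul_eq_scaleLine hd'
    obtain ⟨φ, hφ⟩ := exists_iso_scaleLine hd' hg
    exact ⟨g, fun M => by rw [← (hφ M).1, smul_circle_eq (hφ M).2]⟩
  have hI : ∃ g : PGammaL216, ∀ M : Circle68, (g • M).1 = invForm M := by
    obtain ⟨g, hg⟩ := exists_smul_eq_invLine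
    obtain ⟨φ, hφ⟩ := exists_iso_invLine hg
    exact ⟨g, fun M => by rw [← (hφ M).1, smul_circle_eq (hφ M).2]⟩
  have hF : ∃ g : PGammaL216, ∀ M : Circle68, (g • M).1 = frobForm M := by
    obtain ⟨g, hg⟩ := exists_smul_eq_frobLine
    obtain ⟨φ, hφ⟩ := exists_iso_frobLine hg
    exact ⟨g, fun M => by rw [← (hφ M).1, smul_circle_eq (hφ M).2]⟩
  obtain ⟨t, ht⟩ := hT ⟨c, 0⟩
  obtain ⟨s, hs⟩ := hS
  obtain ⟨i, hi⟩ := hI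
  obtain ⟨f, hf⟩ := hF
  have hfk : ∀ (n : ℕ) (M : Circle68), (f ^ n • M).1 = frobForm^[n] M := by
    intro n
    induction n with
    | zero => intro M; simp
    | succ n ih => intro M; rw [pow_succ', mul_smul, hf, ih, Function.iterate_succ_apply']
  cases e with
  | none =>
    exact ⟨f ^ k * (t * s), fun M => by rw [mul_smul, mul_smul, hfk, ht, hs]; rfl⟩
  | some e =>
    obtain ⟨t', ht'⟩ := hT ⟨e, 0⟩
    exact ⟨f ^ k * (t * (s * (i * t'))), fun M => by
      rw [mul_smul, mul_smul, mul_smul, mul_smul, hfk, ht, hs, hi, ht']; rfl⟩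

lemma subfieldMap_circle₀ : ∀ (k : Fin 4) (e : Option F4) (c d : F4), d ≠ 0 →
    subfieldMap k e c d circle₀.1 = circle₀.1 := by
  decide +kernel

lemma reachable_and_dist_circle₀ (M : Circle68) :
    circleGraph68.Reachable circle₀ M ∧ circleGraph68.dist circle₀ M = level68 M :=
  dist_eq_of_level circle₀ level68 (fun M => (level68_spec M).1) (fun M => (level68_spec M).2.1)
    (fun M => (level68_spec M).2.2) M

lemma dist_circle₀ (M : Circle68) : circleGraph68.dist circle₀ M = level68 M :=
  (reachable_and_dist_circle₀ M).2

end Circles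

/-! ### Geodesics of the graph of circles -/

section Conclusion68

/-- A circle at distance `3` from `circle₀`. -/
def circle₃ : Circle68 := ⟨(.i, .v, ⟨.v, .o⟩), by decide +kernel⟩

/-- The automorphism of the graph of circles given by an element of `PΓL₂(16)`. -/
noncomputable def circleIso (g : PGammaL216) : circleGraph68 ≃g circleGraph68 :=
  (exists_iso_circleGraph68 g).choose

lemma circleIso_apply (g : PGammaL216) (M : Circle68) : circleIso g M = g • M := rfl

lemma level68_smul {g : PGammaL216} (hg : g • circle₀ = circle₀) (M : Circle68) :
    level68 (g • M) = level68 M := by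
  have h := dist_map_iso (circleIso g) circle₀ M
  rwa [circleIso_apply, circleIso_apply, hg, dist_circle₀, dist_circle₀] at h

lemma exists_smul_eq_of_subfieldMap {k : Fin 4} {e : Option F4} {c d : F4} (hd : d ≠ 0) :
    ∃ g : PGammaL216, g • circle₀ = circle₀ ∧ ∀ M N : Circle68,
      subfieldMap k e c d M.1 = N.1 → g • M = N := by
  obtain ⟨g, hg⟩ := exists_smul_circle_eq_subfieldMap k e c d hd
  exact ⟨g, Subtype.ext ((hg _).trans (subfieldMap_circle₀ k e c d hd)),
    fun M N h => Subtype.ext ((hg M).trans h)⟩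

lemma exists_smul_eq_circle₁ {M : Circle68} (hM : level68 M = 1) :
    ∃ g : PGammaL216, g • circle₀ = circle₀ ∧ g • M = circle₁ := by
  obtain ⟨k, e, c, d, hd, h⟩ := sphere68_one M hM
  obtain ⟨g, hg, hg'⟩ := exists_smul_eq_of_subfieldMap hd
  exact ⟨g, hg, hg' _ _ h⟩

lemma exists_smul_eq_circle₂ {M : Circle68} (ha : circleGraph68.Adj circle₁ M)
    (hM : level68 M = 2) :
    ∃ g : PGammaL216, g • circle₀ = circle₀ ∧ g • circle₁ = circle₁ ∧ g • M = circle₂ := by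
  obtain ⟨k, e, c, d, hd, h, h'⟩ := sphere68_two M ha hM
  obtain ⟨g, hg, hg'⟩ := exists_smul_eq_of_subfieldMap hd
  exact ⟨g, hg, hg' _ _ h, hg' _ _ h'⟩

lemma exists_smul_eq_of_level (M N : Circle68) (h : level68 M = level68 N) :
    ∃ g : PGammaL216, g • circle₀ = circle₀ ∧ g • M = N := by
  suffices hs : ∀ l, ∃ B, ∀ M, level68 M = l → ∃ g : PGammaL216, g • circle₀ = circle₀ ∧ g • M = B by
    obtain ⟨B, hB⟩ := hs (level68 N)
    obtain ⟨g, hg, hg'⟩ := hB M h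
    obtain ⟨x, hx, hx'⟩ := hB N rfl
    refine ⟨x⁻¹ * g, ?_, ?_⟩
    · rw [mul_smul, hg, inv_smul_eq_iff, hx]
    · rw [mul_smul, hg', inv_smul_eq_iff, hx']
  intro l
  match l with
  | 0 => exact ⟨circle₀, fun M hM => ⟨1, one_smul _ _, by
      rw [one_smul]; exact (level68_spec M).1.mp hM⟩⟩
  | 1 => exact ⟨circle₁, fun M hM => exists_smul_eq_circle₁ hM⟩
  | 2 =>
    refine ⟨circle₂, fun M hM => ?_⟩
    obtain ⟨N, hN, hN'⟩ := (level68_spec M).2.2 (by omega)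
    obtain ⟨g, hg, hg'⟩ := exists_smul_eq_circle₁ (M := N) (by omega)
    obtain ⟨x, hx, -, hx'⟩ := exists_smul_eq_circle₂ (M := g • M)
      (by rw [← hg']; exact smul_circle_adj g hN.symm) (by rw [level68_smul hg, hM])
    exact ⟨x * g, by rw [mul_smul, hg, hx], by rw [mul_smul, hx']⟩
  | 3 =>
    refine ⟨circle₃, fun M hM => ?_⟩
    obtain ⟨k, e, c, d, hd, h⟩ := sphere68_three M hM
    obtain ⟨g, hg, hg'⟩ := exists_smul_eq_of_subfieldMap hd
    exact ⟨g, hg, hg' _ circle₃ h⟩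
  | l + 4 =>
    refine ⟨circle₀, fun M hM => ?_⟩
    have : ∀ M, level68 M ≤ 3 := by decide +kernel
    have := this M
    omega

/-- If `G` acts on a connected graph and moves the vertex `x₀` to each of its neighbours, then it
is transitive. -/
lemma exists_smul_eq_of_connected {G X : Type*} [Group G] [MulAction G X] {Γ : SimpleGraph X}
    (hΓ : Γ.Connected) (hadj : ∀ (g : G) {x y : X}, Γ.Adj x y → Γ.Adj (g • x) (g • y)) {x₀ : X}
    (h : ∀ y, Γ.Adj x₀ y → ∃ g : G, g • x₀ = y) (x : X) : ∃ g : G, g • x₀ = x := by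
  obtain ⟨p⟩ := hΓ x x₀
  induction p with
  | nil => exact ⟨1, one_smul _ _⟩
  | cons ha _ ih =>
    obtain ⟨g, rfl⟩ := ih h
    obtain ⟨k, hk⟩ := h (g⁻¹ • _) (by simpa using hadj g⁻¹ ha.symm)
    exact ⟨g * k, by rw [mul_smul, hk, smul_inv_smul]⟩

lemma connected_circleGraph68 : circleGraph68.Connected where
  preconnected M N := (reachable_and_dist_circle₀ M).1.symm.trans (reachable_and_dist_circle₀ N).1
  nonempty := ⟨circle₀⟩

lemma exists_adj_smul_circle₀ : ∃ g : PGammaL216, circleGraph68.Adj circle₀ (g • circle₀) := by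
  have : ∃ c d e : F16, d ≠ 0 ∧
      disc (circle₀.1 + transForm e (scaleForm d (invForm (transForm c circle₀)))) = 1 := by
    decide +kernel
  obtain ⟨c, d, e, hd, h⟩ := this
  obtain ⟨t, ht⟩ := exists_smul_eq_transLine c
  obtain ⟨t', ht'⟩ := exists_smul_eq_transLine e
  obtain ⟨s, hs⟩ := exists_smul_eq_scaleLine hd
  obtain ⟨i, hi⟩ := exists_smul_eq_invLine
  obtain ⟨φ, hφ⟩ := exists_iso_transLine ht
  obtain ⟨φ', hφ'⟩ := exists_iso_transLine ht'
  obtain ⟨ψ, hψ⟩ := exists_iso_scaleLine hd hs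
  obtain ⟨χ, hχ⟩ := exists_iso_invLine hi
  refine ⟨t' * (s * (i * t)), ?_⟩
  rw [mul_smul, mul_smul, mul_smul, smul_circle_eq (hφ _).2, smul_circle_eq (hχ _).2,
    smul_circle_eq (hψ _).2, smul_circle_eq (hφ' _).2]
  change disc (circle₀.1 + (φ' _).1) = 1
  rwa [(hφ' _).1, (hψ _).1, (hχ _).1, (hφ _).1]

lemma isSphereTransitive_circleGraph68 :
    IsSphereTransitive PGammaL216 circleGraph68 circle₀ 12 where
  transitive := by
    refine exists_smul_eq_of_connected connected_circleGraph68 smul_circle_adj fun M hM => ?_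
    obtain ⟨g, hg⟩ := exists_adj_smul_circle₀
    obtain ⟨x, hx, hx'⟩ := exists_smul_eq_of_level (g • circle₀) M (by
      rw [← dist_circle₀, ← dist_circle₀, SimpleGraph.dist_eq_one_iff_adj.mpr hg,
        SimpleGraph.dist_eq_one_iff_adj.mpr hM])
    exact ⟨x * g, by rw [mul_smul, hx']⟩
  smul_adj g := smul_circle_adj g
  connected := connected_circleGraph68
  sphere M N h := exists_smul_eq_of_level M N (by rwa [dist_circle₀, dist_circle₀] at h)
  valency := by
    have : circleGraph68.neighborSet circle₀ =
        ((Finset.univ.filter fun M => circleGraph68.Adj circle₀ M : Finset Circle68) :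
          Set Circle68) := by
      ext M; simp
    rw [this, Set.ncard_coe_finset]
    decide +kernel
  pos := by norm_num
  large M h0 h1 := by
    have : {N | circleGraph68.dist circle₀ N = circleGraph68.dist circle₀ M} =
        ((Finset.univ.filter fun N => level68 N = level68 M : Finset Circle68) :
          Set Circle68) := by
      ext N; simp [dist_circle₀]
    rw [this, Set.ncard_coe_finset]
    have hc : ∀ l : Fin 4, l = 0 ∨ l = 1 ∨
        12 < (Finset.univ.filter fun N => level68 N = l : Finset Circle68).card := by
      decide +kernel
    have hl : ∀ M, level68 M < 4 := by decide +kernel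
    have h1' : level68 M ≠ 1 := fun h => h1 (by
      rwa [← SimpleGraph.dist_eq_one_iff_adj, dist_circle₀])
    have h0' : level68 M ≠ 0 := fun h => h0 ((level68_spec M).1.mp h)
    rcases hc ⟨level68 M, hl M⟩ with h | h | h
    · exact absurd (congrArg Fin.val h) h0'
    · exact absurd (congrArg Fin.val h) h1'
    · exact h

lemma isGeodesicTransitive_two_circleGraph68 : IsGeodesicTransitive circleGraph68 2 := by
  have H := isSphereTransitive_circleGraph68
  refine isGeodesicTransitive_of_steps (fun i => match i with
    | 0 => circle₀ | 1 => circle₁ | _ => circle₂) ?_ ?_ ?_ ?_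
  · have h1 : circleGraph68.Adj circle₀ circle₁ := by decide +kernel
    have h2 : circleGraph68.Adj circle₁ circle₂ := by decide +kernel
    intro i hi
    match i, hi with
    | 0, _ => exact h1
    | 1, _ => exact h2
  · change circleGraph68.dist circle₀ circle₂ = 2
    rw [dist_circle₀]
    decide +kernel
  · intro M
    obtain ⟨g, hg⟩ := H.transitive M
    exact ⟨circleIso g⁻¹, by rw [circleIso_apply, inv_smul_eq_iff]; exact hg.symm⟩
  · intro i hi w ha hd
    match i, hi with
    | 0, _ =>
      obtain ⟨g, hg, hg'⟩ := exists_smul_eq_circle₁ (M := w) (by rw [← dist_circle₀]; exact hd)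
      refine ⟨circleIso g, fun j hj => ?_, hg'⟩
      obtain rfl : j = 0 := by omega
      exact hg
    | 1, _ =>
      obtain ⟨g, hg, hg', hg''⟩ := exists_smul_eq_circle₂ (M := w) ha
        (by rw [← dist_circle₀]; exact hd)
      refine ⟨circleIso g, fun j hj => ?_, hg''⟩
      obtain rfl | rfl : j = 0 ∨ j = 1 := by omega
      · exact hg
      · exact hg'

lemma not_isGeodesicTransitive_three_circleGraph68 : ¬ IsGeodesicTransitive circleGraph68 3 := by
  have h01 : circleGraph68.Adj circle₀ circle₁ := by decide +kernel
  have h12 : circleGraph68.Adj circle₁ circle₂ := by decide +kernel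
  have geo : ∀ M, circleGraph68.Adj circle₂ M → level68 M = 3 →
      IsGeodesic circleGraph68 3 ![circle₀, circle₁, circle₂, M] := fun M h1 h2 =>
    isGeodesic_of_chain (fun i => by
        fin_cases i
        · exact h01
        · exact h12
        · exact h1)
      ((dist_circle₀ M).trans h2)
  -- Some triangles on the first and on the last edge of the geodesic have adjacent third vertices,
  -- which are not adjacent to `p 2` and to `p 1`, respectively.
  have inv : ∀ (φ : circleGraph68 ≃g circleGraph68) (p : Fin 4 → Circle68),
      (∃ v w, circleGraph68.Adj v (p 0) ∧ circleGraph68.Adj v (p 1) ∧ circleGraph68.Adj w (p 2) ∧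
        circleGraph68.Adj w (p 3) ∧ circleGraph68.Adj v w ∧ ¬ circleGraph68.Adj v (p 2) ∧
        ¬ circleGraph68.Adj w (p 1)) →
      (∃ v w, circleGraph68.Adj v (φ (p 0)) ∧ circleGraph68.Adj v (φ (p 1)) ∧
        circleGraph68.Adj w (φ (p 2)) ∧ circleGraph68.Adj w (φ (p 3)) ∧ circleGraph68.Adj v w ∧
        ¬ circleGraph68.Adj v (φ (p 2)) ∧ ¬ circleGraph68.Adj w (φ (p 1))) := by
    rintro φ p ⟨v, w, h⟩
    exact ⟨φ v, φ w, by simpa only [φ.map_adj_iff] using h⟩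
  refine not_isGeodesicTransitive_of_invariant (by norm_num) _ inv
    (geo circle₃ (by decide +kernel) (by decide +kernel))
    (geo ⟨(.v, .i, ⟨.v, .o⟩), by decide +kernel⟩ (by decide +kernel) (by decide +kernel)) ?_ ?_
  · change ∃ v w, circleGraph68.Adj v circle₀ ∧ circleGraph68.Adj v circle₁ ∧
      circleGraph68.Adj w circle₂ ∧ circleGraph68.Adj w circle₃ ∧ circleGraph68.Adj v w ∧
      ¬ circleGraph68.Adj v circle₂ ∧ ¬ circleGraph68.Adj w circle₁
    decide +kernel
  · change ¬ ∃ v w, circleGraph68.Adj v circle₀ ∧ circleGraph68.Adj v circle₁ ∧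
      circleGraph68.Adj w circle₂ ∧ circleGraph68.Adj w ⟨(.v, .i, ⟨.v, .o⟩), _⟩ ∧
      circleGraph68.Adj v w ∧ ¬ circleGraph68.Adj v circle₂ ∧ ¬ circleGraph68.Adj w circle₁
    decide +kernel

end Conclusion68

/-! ### The subgroups of index `68` in `PΓL₂(16)` -/

section Index68

/-- The elements of order `5` are conjugate to multiplications. -/
lemma exists_conj_eq_scaleLine {t : PGammaL216} (ht : orderOf t = 5) :
    ∃ (x : PGammaL216) (c : F16), c ≠ 0 ∧ c ≠ 1 ∧ c ^ 5 = 1 ∧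
      ∀ p : Line16, (x * t * x⁻¹) • p = scaleLine c p := by
  have : Fact (Nat.Prime 5) := ⟨by norm_num⟩
  have ht5 : t ^ 5 = 1 := ht ▸ pow_orderOf_eq_one t
  have hcard := ncard_modEq_ncard_fixed ht5 (S := (Set.univ : Set Line16)) (fun _ _ => trivial)
  have h17 : (Set.univ : Set Line16).ncard = 17 := by
    rw [Set.ncard_univ, Nat.card_eq_fintype_card]; decide +kernel
  rw [h17] at hcard
  obtain ⟨p, hp, q, hq, hpq⟩ : ∃ p ∈ {x ∈ (Set.univ : Set Line16) | t • x = x},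
      ∃ q ∈ {x ∈ (Set.univ : Set Line16) | t • x = x}, p ≠ q := by
    refine (Set.one_lt_ncard (Set.toFinite _)).mp ?_
    unfold Nat.ModEq at hcard
    omega
  obtain ⟨x, hx, hx'⟩ := exists_smul_eq_pair hpq
  have h0 : (x * t * x⁻¹) • (none : Line16) = none := by
    rw [← hx, mul_smul, inv_smul_smul, mul_smul, hp.2]
  have h1 : (x * t * x⁻¹) • (some 0 : Line16) = some 0 := by
    rw [← hx', mul_smul, inv_smul_smul, mul_smul, hq.2]
  obtain ⟨c, hc⟩ : ∃ c, (x * t * x⁻¹) • (some 1 : Line16) = some c := by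
    rw [← Option.ne_none_iff_exists', ← h0]
    exact (MulAction.injective _).ne (by simp)
  have hc0 : c ≠ 0 := by
    rintro rfl
    have := MulAction.injective _ (hc.trans h1.symm)
    simp at this
  obtain ⟨s, hs⟩ := exists_smul_eq_scaleLine hc0
  have hs' : ∀ p q, s⁻¹ • p = q ↔ p = scaleLine c q := fun p q => by rw [inv_smul_eq_iff, hs]
  obtain ⟨k, hk⟩ := exists_smul_eq_frobLine_iterate (s⁻¹ * (x * t * x⁻¹))
    (by rw [mul_smul, h0, hs']; rfl) (by rw [mul_smul, h1, hs']; simp [scaleLine])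
    (by rw [mul_smul, hc, hs']; simp [scaleLine])
  have key : ∀ p : Line16, (x * t * x⁻¹) • p = scaleLine c (frobLine^[k] p) := fun p => by
    rw [← hk, ← hs, ← mul_smul, mul_inv_cancel_left]
  have hpow : ∀ (n : ℕ) (p : Line16),
      (x * t * x⁻¹) ^ n • p = (fun p => scaleLine c (frobLine^[k] p))^[n] p := by
    intro n
    induction n with
    | zero => intro p; simp
    | succ n ih => intro p; rw [pow_succ', mul_smul, ih, key, Function.iterate_succ_apply']
  have h5 : ∀ p : Line16, (fun p => scaleLine c (frobLine^[k] p))^[5] p = p := by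
    intro p
    rw [← hpow, conj_pow, ht5]
    simp
  have hdec : ∀ (k : Fin 4) (c : F16), c ≠ 0 →
      (fun p => scaleLine c (frobLine^[k] p))^[5] (some 1) = some 1 →
      (fun p => scaleLine c (frobLine^[k] p))^[5] (some ⟨.o, .i⟩) = some ⟨.o, .i⟩ →
      k = 0 ∧ c ^ 5 = 1 := by decide +kernel
  obtain ⟨rfl, hc5⟩ := hdec k c hc0 (h5 _) (h5 _)
  refine ⟨x, c, hc0, ?_, hc5, key⟩
  rintro rfl
  have : x * t * x⁻¹ = 1 := pGammaL216_ext fun p => by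
    rw [key, one_smul]
    cases p <;> simp [scaleLine]
  rw [conj_eq_one_iff] at this
  rw [this, orderOf_one] at ht
  norm_num at ht

/-- An element of order `5` has two fixed points, and its other orbits are circles. -/
lemma exists_fixed_points_of_orderOf {t : PGammaL216} (ht : orderOf t = 5) :
    ∃ p q : Line16, p ≠ q ∧ (∀ z, t • z = z ↔ z = p ∨ z = q) ∧
      ∀ z, z ≠ p → z ≠ q → ∃ M : Circle68, ∀ y, isotropic M y = true → ∃ i : ℕ, y = t ^ i • z := by
  obtain ⟨x, c, hc0, hc1, hc5, hx⟩ := exists_conj_eq_scaleLine ht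
  have ht' : ∀ z : Line16, t • z = x⁻¹ • scaleLine c (x • z) := fun z => by
    rw [← hx, mul_smul, inv_smul_smul, mul_smul, inv_smul_smul]
  have htn : ∀ (n : ℕ) (z : Line16), t ^ n • z = x⁻¹ • (scaleLine c)^[n] (x • z) := by
    intro n
    induction n with
    | zero => intro z; simp
    | succ n ih =>
      intro z; rw [pow_succ', mul_smul, ih, ht', smul_inv_smul, Function.iterate_succ_apply']
  refine ⟨x⁻¹ • none, x⁻¹ • some 0, (MulAction.injective _).ne (by simp), fun z => ?_, fun z => ?_⟩
  · rw [ht', inv_smul_eq_iff, eq_inv_smul_iff, eq_inv_smul_iff]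
    generalize x • z = y
    cases y with
    | none => simp [scaleLine]
    | some y =>
      have : c * y = y ↔ y = 0 := by
        rw [← sub_eq_zero, ← sub_one_mul, mul_eq_zero, sub_eq_zero, or_iff_right hc1]
      simp [scaleLine, this]
  · rw [Ne, eq_inv_smul_iff, Ne, eq_inv_smul_iff]
    intro h1 h2
    obtain ⟨y, hy⟩ := Option.ne_none_iff_exists'.mp h1
    have hy0 : y ≠ 0 := by rintro rfl; exact h2 hy
    -- The circle consists of the points with the same norm as `y`.
    have hdec : ∀ c : F16, c ≠ 0 → c ≠ 1 → c ^ 5 = 1 → ∀ y, y ≠ 0 →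
        disc ((norm16 y, norm16 y * norm16 y, 0) : Form2) = 1 ∧
        ∀ u, isotropic ((norm16 y, norm16 y * norm16 y, 0) : Form2) u = true →
          ∃ i : Fin 5, u = (scaleLine c)^[i] (some y) := by decide +kernel
    obtain ⟨hM, hM'⟩ := hdec c hc0 hc1 hc5 y hy0
    refine ⟨x⁻¹ • ⟨_, hM⟩, fun u hu => ?_⟩
    obtain ⟨i, hi⟩ := hM' (x • u) (by
      rw [← hu, ← isotropic_smul x⁻¹ ⟨_, hM⟩ (x • u), inv_smul_smul])
    exact ⟨i, by rw [htn, hy, ← hi, inv_smul_smul]⟩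

lemma ncard_isotropic (M : Circle68) : {p | isotropic M p = true}.ncard = 5 := by
  have : {p | isotropic M p = true} =
      ((Finset.univ.filter fun p => isotropic M p = true : Finset Line16) : Set Line16) := by
    ext; simp
  rw [this, Set.ncard_coe_finset]
  have hdec : ∀ M : Circle68,
      (Finset.univ.filter fun p => isotropic M p = true : Finset Line16).card = 5 := by
    decide +kernel
  exact hdec M

variable {H : Subgroup PGammaL216}

lemma card_of_index_68 (hH : H.index = 68) : Nat.card H = 240 := by
  have := H.card_mul_index
  rw [hH, card_pGammaL216] at this
  omega

/-- If a subgroup `H` of index `68` fixes the point `p`, and the stabilizers in `H` of the other points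
have order at most `15`, then the orbit under `H` of a coset `g H` with `g p ≠ p` has length at least
`240 / 15 = 16`. Hence `g p` is constant on the components of an orbital graph of valency `12`, which
is therefore not connected. -/
lemma false_of_fixed_point (hH : H.index = 68) {Γ : SimpleGraph (PGammaL216 ⧸ H)}
    (hΓ : IsDistanceTransitiveOrbitalGraph H 12 Γ) {p : Line16}
    (hp : H ≤ MulAction.stabilizer PGammaL216 p)
    (hst : ∀ r, r ≠ p → Nat.card (H ⊓ MulAction.stabilizer PGammaL216 r : Subgroup _) ≤ 15) :
    False := by
  obtain ⟨a, b, -, ho⟩ := hΓ.orbital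
  have hsm : ∀ (g : PGammaL216) {x y}, Γ.Adj x y → Γ.Adj (g • x) (g • y) := by
    intro g x y hxy
    obtain ⟨k, hk⟩ := (ho x y).mp hxy
    refine (ho _ _).mpr ⟨g * k, ?_⟩
    rcases hk with ⟨rfl, rfl⟩ | ⟨rfl, rfl⟩
    · exact Or.inl ⟨mul_smul _ _ _, mul_smul _ _ _⟩
    · exact Or.inr ⟨mul_smul _ _ _, mul_smul _ _ _⟩
  have nbr : ∀ g : PGammaL216, Γ.Adj ((1 : PGammaL216) : PGammaL216 ⧸ H) (g : PGammaL216 ⧸ H) →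
      g • p = p := by
    intro g hg
    by_contra hne
    have h1 := card_eq_ncard_orbit_mul H (g : PGammaL216 ⧸ H)
    have h2 : (MulAction.orbit H (g : PGammaL216 ⧸ H)).ncard ≤ 12 := by
      rw [← hΓ.valency ((1 : PGammaL216) : PGammaL216 ⧸ H)]
      have : Finite (PGammaL216 ⧸ H) := Subgroup.finite_quotient_of_finiteIndex (H := H)
      refine Set.ncard_le_ncard ?_ (Set.toFinite _)
      rintro _ ⟨h, rfl⟩
      have h3 := hsm h.1 hg
      have h4 : h.1 • ((1 : PGammaL216) : PGammaL216 ⧸ H) = ((1 : PGammaL216) : PGammaL216 ⧸ H) := by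
        rw [MulAction.Quotient.smul_coe, QuotientGroup.eq]
        simp
      rw [h4] at h3
      exact h3
    have h3 : Nat.card (H ⊓ MulAction.stabilizer PGammaL216 (g : PGammaL216 ⧸ H) : Subgroup _) ≤
        15 := by
      refine le_trans ?_ (hst _ hne)
      refine Nat.le_of_dvd Nat.card_pos (Subgroup.card_dvd_of_le ?_)
      rintro h ⟨hh, hh'⟩
      refine ⟨hh, ?_⟩
      have h5 : h • (g : PGammaL216 ⧸ H) = g := hh'
      rw [MulAction.Quotient.smul_coe, QuotientGroup.eq] at h5
      have h6 := MulAction.mem_stabilizer_iff.mp (hp (inv_mem h5))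
      change h • g • p = g • p
      rw [mul_inv_rev, inv_inv, mul_smul, inv_smul_eq_iff, smul_eq_mul, mul_smul] at h6
      exact h6
    rw [card_of_index_68 hH] at h1
    have := h1.le.trans (Nat.mul_le_mul h2 h3)
    omega
  have step : ∀ x y : PGammaL216, Γ.Adj (x : PGammaL216 ⧸ H) (y : PGammaL216 ⧸ H) →
      x • p = y • p := by
    intro x y hxy
    have h1 := hsm x⁻¹ hxy
    rw [MulAction.Quotient.smul_coe, MulAction.Quotient.smul_coe, smul_eq_mul,
      inv_mul_cancel] at h1
    have h2 := nbr _ h1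
    rw [smul_eq_mul, mul_smul, inv_smul_eq_iff] at h2
    exact h2.symm
  have const : ∀ x y : PGammaL216 ⧸ H, Γ.Reachable x y → ∀ g h : PGammaL216,
      (g : PGammaL216 ⧸ H) = x → (h : PGammaL216 ⧸ H) = y → g • p = h • p := by
    rintro x y ⟨w⟩
    induction w with
    | nil =>
      rintro g h rfl he
      rw [QuotientGroup.eq] at he
      have := MulAction.mem_stabilizer_iff.mp (hp he)
      rw [mul_smul, inv_smul_eq_iff] at this
      exact this
    | @cons _ v _ ha _ ih =>
      rintro g h rfl he
      obtain ⟨k, rfl⟩ := QuotientGroup.mk_surjective v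
      exact (step _ _ ha).trans (ih k h rfl he)
  obtain ⟨q, hq⟩ := exists_ne p
  obtain ⟨x, hx, -⟩ := exists_smul_eq_pair hq.symm
  obtain ⟨y, hy, -⟩ := exists_smul_eq_pair hq
  have := const _ _ (hΓ.connected _ _) 1 (y⁻¹ * x) rfl rfl
  rw [one_smul, mul_smul, hx, ← hy, inv_smul_smul] at this
  exact hq this.symm

set_option maxHeartbeats 1000000 in
/-- A subgroup of index `68` with a connected orbital graph of valency `12` is the stabilizer of a
circle. An element of order `5` has two fixed points; the union of the orbits of these two points
has `12` elements, and its complement is a circle. -/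
lemma exists_eq_stabilizer_circle (hH : H.index = 68) {Γ : SimpleGraph (PGammaL216 ⧸ H)}
    (hΓ : IsDistanceTransitiveOrbitalGraph H 12 Γ) :
    ∃ M : Circle68, H = MulAction.stabilizer PGammaL216 M := by
  have : Fact (Nat.Prime 5) := ⟨by norm_num⟩
  have hcard := card_of_index_68 hH
  obtain ⟨t₀, ht₀⟩ := exists_prime_orderOf_dvd_card' (G := H) 5 (by rw [hcard]; norm_num)
  obtain ⟨t, ht⟩ := t₀
  have ho : orderOf t = 5 := by rwa [Subgroup.orderOf_mk] at ht₀
  have ht5 : t ^ 5 = 1 := ho ▸ pow_orderOf_eq_one t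
  obtain ⟨p, q, hpq, hfix, hcirc⟩ := exists_fixed_points_of_orderOf ho
  -- The invariant sets of `H` are counted modulo `5` by the fixed points of `t`.
  have hinv : ∀ (x y : Line16), y ∈ MulAction.orbit H x → ∀ h ∈ H, h • y ∈ MulAction.orbit H x := by
    rintro x _ ⟨k, rfl⟩ h hh
    exact ⟨⟨h, hh⟩ * k, mul_smul _ _ _⟩
  have hmod : ∀ S : Set Line16, (∀ y ∈ S, ∀ h ∈ H, h • y ∈ S) →
      S.ncard ≡ {y ∈ S | y = p ∨ y = q}.ncard [MOD 5] := by
    intro S hS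
    have := ncard_modEq_ncard_fixed ht5 (S := S) (fun y hy => hS y hy t ht)
    simpa only [hfix] using this
  have hle : ∀ S : Set Line16, S.ncard ≤ 17 := fun S => by
    refine (Set.ncard_le_card S).trans_eq ?_
    rw [Nat.card_eq_fintype_card]; decide +kernel
  have hstab := fun x : Line16 => card_eq_ncard_orbit_mul H x
  rw [hcard] at hstab
  have sizes : ∀ n m : ℕ, 240 = n * m → n ≤ 17 → n ≡ 1 [MOD 5] → n = 1 ∨ n = 6 ∨ n = 16 := by
    intro n m h1 h2 h3
    unfold Nat.ModEq at h3
    interval_cases n <;> omega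
  -- It is impossible that `H` fixes one of the two points: the orbit of the other has length `1` or
  -- `6`, which contradicts `card_dvd_sixty`, or `16`, which contradicts `false_of_fixed_point`.
  have fixed : ∀ p q : Line16, p ≠ q → (MulAction.orbit H p).ncard = 1 →
      ((MulAction.orbit H q).ncard = 1 ∨ (MulAction.orbit H q).ncard = 6 ∨
        (MulAction.orbit H q).ncard = 16) → False := by
    intro p q hpq hp hq
    have hpH : H ≤ MulAction.stabilizer PGammaL216 p := by
      intro h hh
      obtain ⟨z, hz⟩ := Set.ncard_eq_one.mp hp
      have h1 : p ∈ MulAction.orbit H p := MulAction.mem_orbit_self p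
      have h2 := hinv p p h1 h hh
      rw [hz] at h1 h2
      exact h2.trans h1.symm
    have h60 := card_dvd_sixty (H ⊓ MulAction.stabilizer PGammaL216 q) hpq
      (inf_le_left.trans hpH) inf_le_right
    have h240 := hstab q
    rcases hq with hq | hq | hq
    · rw [hq, one_mul] at h240
      rw [← h240] at h60
      norm_num at h60
    · rw [hq] at h240
      have : Nat.card (H ⊓ MulAction.stabilizer PGammaL216 q : Subgroup _) = 40 := by omega
      rw [this] at h60
      norm_num at h60
    · have hsub : MulAction.orbit H q = {p}ᶜ := by
        refine Set.eq_of_subset_of_ncard_le ?_ ?_ (Set.toFinite _)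
        · rintro _ ⟨h, rfl⟩ he
          have h1 : h.1 • q = h.1 • p := he.trans (MulAction.mem_stabilizer_iff.mp (hpH h.2)).symm
          exact hpq (MulAction.injective _ h1).symm
        · rw [hq, Set.ncard_compl, Set.ncard_singleton, Nat.card_eq_fintype_card]
          have : Fintype.card Line16 - 1 ≤ 16 := by decide +kernel
          exact this
      refine false_of_fixed_point hH hΓ hpH fun r hr => ?_
      have hr' : r ∈ MulAction.orbit H q := by rw [hsub]; exact hr
      have h1 := hstab r
      rw [MulAction.orbit_eq_iff.mpr hr', hq] at h1
      omega
  have hU : (MulAction.orbit H p ∪ MulAction.orbit H q).ncard = 12 := by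
    by_cases hqp : q ∈ MulAction.orbit H p
    · rw [MulAction.orbit_eq_iff.mpr hqp, Set.union_self]
      have h1 := hmod _ (hinv p)
      have h2 : {y ∈ MulAction.orbit H p | y = p ∨ y = q} = {p, q} := by
        ext y
        simp only [Set.mem_ofPred_eq, Set.mem_insert_iff, Set.mem_singleton_iff, and_iff_right_iff_imp]
        rintro (rfl | rfl)
        · exact MulAction.mem_orbit_self _
        · exact hqp
      rw [h2, Set.ncard_pair hpq] at h1
      have h3 := hle (MulAction.orbit H p)
      have h4 := hstab p
      have h5 : (MulAction.orbit H p).ncard ≠ 2 := by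
        intro h5
        have h6 : MulAction.orbit H p = {p, q} := by
          rw [← h2]
          symm
          refine Set.eq_of_subset_of_ncard_le (fun y hy => hy.1) ?_ (Set.toFinite _)
          rw [h5, h2, Set.ncard_pair hpq]
        have h7 := card_dvd_sixty (H ⊓ MulAction.stabilizer PGammaL216 p) hpq inf_le_right (by
          rintro h ⟨hh, hh'⟩
          have h8 := hinv p q hqp h hh
          rw [h6] at h8
          rcases h8 with h8 | h8
          · exact absurd (MulAction.injective h (h8.trans (MulAction.mem_stabilizer_iff.mp hh').symm))
              hpq.symm
          · exact h8)
        rw [h5] at h4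
        have : Nat.card (H ⊓ MulAction.stabilizer PGammaL216 p : Subgroup _) = 120 := by omega
        rw [this] at h7
        norm_num at h7
      unfold Nat.ModEq at h1
      generalize (MulAction.orbit H p).ncard = n at *
      interval_cases n <;> omega
    · have hdisj : Disjoint (MulAction.orbit H p) (MulAction.orbit H q) := by
        rw [Set.disjoint_left]
        intro y hy hy'
        exact hqp (MulAction.orbit_eq_iff.mp
          ((MulAction.orbit_eq_iff.mpr hy').symm.trans (MulAction.orbit_eq_iff.mpr hy)))
      have single : ∀ x ∈ ({p, q} : Set Line16), (MulAction.orbit H x).ncard = 1 ∨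
          (MulAction.orbit H x).ncard = 6 ∨ (MulAction.orbit H x).ncard = 16 := by
        intro x hx
        refine sizes _ _ (hstab x) (hle _) ((hmod _ (hinv x)).trans ?_)
        have : {y ∈ MulAction.orbit H x | y = p ∨ y = q} = {x} := by
          ext y
          simp only [Set.mem_ofPred_eq, Set.mem_singleton_iff]
          constructor
          · rintro ⟨hy, rfl | rfl⟩ <;> rcases hx with rfl | rfl
            · rfl
            · exact absurd (MulAction.orbit_eq_iff.mp (MulAction.orbit_eq_iff.mpr hy).symm) hqp
            · exact absurd hy hqp
            · rfl
          · rintro rfl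
            exact ⟨MulAction.mem_orbit_self _, hx⟩
        rw [this, Set.ncard_singleton]
      have hp := single p (by simp)
      have hq := single q (by simp)
      have hsum := Set.ncard_union_eq hdisj (Set.toFinite _) (Set.toFinite _)
      have h17 := hle (MulAction.orbit H p ∪ MulAction.orbit H q)
      have hp1 : (MulAction.orbit H p).ncard ≠ 1 := fun h => fixed p q hpq h hq
      have hq1 : (MulAction.orbit H q).ncard ≠ 1 := fun h => fixed q p hpq.symm h hp
      omega
  -- The complement of the two orbits has `5` elements, and is thus an orbit of `t`.
  set C : Set Line16 := (MulAction.orbit H p ∪ MulAction.orbit H q)ᶜ with hC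
  have hCcard : C.ncard = 5 := by
    rw [hC, Set.ncard_compl, hU, Nat.card_eq_fintype_card]
    have : Fintype.card Line16 - 12 = 5 := by decide +kernel
    exact this
  have hCinv : ∀ y, ∀ h ∈ H, h • y ∈ C ↔ y ∈ C := by
    intro y h hh
    have aux : ∀ x, h • y ∈ MulAction.orbit H x ↔ y ∈ MulAction.orbit H x := fun x => by
      refine ⟨fun hy => ?_, fun hy => hinv x y hy h hh⟩
      simpa using hinv x _ hy h⁻¹ (inv_mem hh)
    rw [hC, Set.mem_compl_iff, Set.mem_compl_iff, Set.mem_union, Set.mem_union, aux, aux]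
  obtain ⟨z, hz⟩ : C.Nonempty := Set.nonempty_of_ncard_ne_zero (by rw [hCcard]; norm_num)
  obtain ⟨M, hM⟩ := hcirc z
    (by rintro rfl; exact hz (Or.inl (MulAction.mem_orbit_self _)))
    (by rintro rfl; exact hz (Or.inr (MulAction.mem_orbit_self _)))
  have hMC : {y | isotropic M y = true} = C := by
    refine Set.eq_of_subset_of_ncard_le (fun y hy => ?_) ?_ (Set.toFinite _)
    · obtain ⟨i, rfl⟩ := hM y hy
      exact (hCinv z _ (pow_mem ht i)).mpr hz
    · rw [hCcard, ncard_isotropic]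
  refine ⟨M, Subgroup.eq_of_le_of_card_ge (fun h hh => ?_) ?_⟩
  · refine smul_circle_eq fun y => ?_
    have h1 : h • y ∈ {y | isotropic M y = true} ↔ y ∈ {y | isotropic M y = true} := by
      rw [hMC, hCinv y h hh]
    exact Bool.eq_iff_iff.mpr h1
  · rw [hcard]
    have h1 := (MulAction.stabilizer PGammaL216 M).card_mul_index
    rw [MulAction.index_stabilizer] at h1
    have h2 : MulAction.orbit PGammaL216 M = Set.univ := by
      refine Set.eq_univ_of_forall fun N => ?_
      obtain ⟨g, hg⟩ := isSphereTransitive_circleGraph68.transitive M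
      obtain ⟨k, hk⟩ := isSphereTransitive_circleGraph68.transitive N
      exact ⟨k * g⁻¹, by simp [← hg, ← hk, mul_smul]⟩
    have h3 : Nat.card Circle68 = 68 := by
      rw [Nat.card_eq_fintype_card]; decide +kernel
    rw [h2, Set.ncard_univ, h3, card_pGammaL216] at h1
    omega

theorem graph68_conclusion :
    (∃ (H : Subgroup PGammaL216) (Γ : SimpleGraph (PGammaL216 ⧸ H)),
      H.index = 68 ∧ IsDistanceTransitiveOrbitalGraph H 12 Γ) ∧
    ∀ (H : Subgroup PGammaL216) (Γ : SimpleGraph (PGammaL216 ⧸ H)), H.index = 68 →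
      IsDistanceTransitiveOrbitalGraph H 12 Γ →
        IsGeodesicTransitive Γ 2 ∧ ¬ IsGeodesicTransitive Γ 3 := by
  refine isSphereTransitive_circleGraph68.orbital_conclusion
    isGeodesicTransitive_two_circleGraph68 not_isGeodesicTransitive_three_circleGraph68
    (fun H => H.index = 68) ?_ (fun H Γ hH hΓ => exists_eq_stabilizer_circle hH hΓ)
  have : MulAction.orbit PGammaL216 circle₀ = Set.univ :=
    Set.eq_univ_of_forall isSphereTransitive_circleGraph68.transitive
  rw [MulAction.index_stabilizer, this, Set.ncard_univ, Nat.card_eq_fintype_card]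
  decide +kernel

end Index68

/-! ### Hermitian matrices of size three over `F4` -/

section Herm

open Matrix

/-- The Hermitian matrices of size three over `F4`, as tuples of the diagonal entries, which lie in
the prime field, and of the entries `(0, 1)`, `(0, 2)`, `(1, 2)`. -/
abbrev Herm3 : Type := Bool × Bool × Bool × F4 × F4 × F4

/-- The element of the prime field given by a truth value. -/
def F4.ofBool (b : Bool) : F4 := if b then 1 else 0

/-- The truth value of an element of the prime field. -/
def F4.toBool (x : F4) : Bool := x ≠ 0

/-- The matrix given by its code. -/
def toMat : Herm3 → Matrix (Fin 3) (Fin 3) F4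
  | (a, b, c, x, y, z) => !![F4.ofBool a, x, y; star x, F4.ofBool b, z; star y, star z, F4.ofBool c]

/-- The code of a Hermitian matrix. -/
def ofMat (A : Matrix (Fin 3) (Fin 3) F4) : Herm3 :=
  (F4.toBool (A 0 0), F4.toBool (A 1 1), F4.toBool (A 2 2), A 0 1, A 0 2, A 1 2)

/-- The determinant. -/
def detH : Herm3 → F4
  | (a, b, c, x, y, z) => F4.ofBool a * F4.ofBool b * F4.ofBool c + F4.ofBool a * (z * star z) +
    F4.ofBool b * (y * star y) + F4.ofBool c * (x * star x) + x * z * star y + star x * star z * y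

/-- Whether a Hermitian matrix has rank one. -/
def rankOne : Herm3 → Bool
  | (a, b, c, x, y, z) => (a || b || c) && ((a && b) == F4.toBool x) && ((a && c) == F4.toBool y) &&
    ((b && c) == F4.toBool z) && (F4.ofBool a * z == star x * y) &&
    (F4.ofBool b * y == x * z) && (F4.ofBool c * x == y * star z)

/-- The sum of two Hermitian matrices. -/
def addH : Herm3 → Herm3 → Herm3
  | (a, b, c, x, y, z), (a', b', c', x', y', z') =>
    (a ^^ a', b ^^ b', c ^^ c', x + x', y + y', z + z')

/-- The rank one matrix `v v*`. -/
def outer (v : F4 × F4 × F4) : Herm3 :=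
  (F4.toBool v.1, F4.toBool v.2.1, F4.toBool v.2.2, v.1 * star v.2.1, v.1 * star v.2.2,
    v.2.1 * star v.2.2)

/-- The matrix `g M g*`. -/
def congrH (g : Matrix (Fin 3) (Fin 3) F4) : Herm3 → Herm3
  | (a, b, c, x, y, z) =>
    let B : F4 → F4 → F4 → F4 → F4 → F4 → F4 := fun p q r p' q' r' =>
      (p * F4.ofBool a + q * star x + r * star y) * star p' +
      (p * x + q * F4.ofBool b + r * star z) * star q' + (p * y + q * z + r * F4.ofBool c) * star r'
    (F4.toBool (B (g 0 0) (g 0 1) (g 0 2) (g 0 0) (g 0 1) (g 0 2)),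
      F4.toBool (B (g 1 0) (g 1 1) (g 1 2) (g 1 0) (g 1 1) (g 1 2)),
      F4.toBool (B (g 2 0) (g 2 1) (g 2 2) (g 2 0) (g 2 1) (g 2 2)),
      B (g 0 0) (g 0 1) (g 0 2) (g 1 0) (g 1 1) (g 1 2),
      B (g 0 0) (g 0 1) (g 0 2) (g 2 0) (g 2 1) (g 2 2),
      B (g 1 0) (g 1 1) (g 1 2) (g 2 0) (g 2 1) (g 2 2))

/-- The adjugate of a Hermitian matrix, which for determinant `1` is the inverse. -/
def adjH : Herm3 → Herm3
  | (a, b, c, x, y, z) => ((b && c) ^^ F4.toBool z, (a && c) ^^ F4.toBool y, (a && b) ^^ F4.toBool x,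
      x * F4.ofBool c + y * star z, x * z + y * F4.ofBool b, F4.ofBool a * z + star x * y)

lemma toMat_isHermitian (h : Herm3) : (toMat h).IsHermitian := by
  obtain ⟨a, b, c, x, y, z⟩ := h
  have hb : ∀ b : Bool, star (F4.ofBool b) = F4.ofBool b := by decide
  ext i j
  fin_cases i <;> fin_cases j <;> simp [toMat, Matrix.conjTranspose_apply, hb]

lemma toMat_ofMat {A : Matrix (Fin 3) (Fin 3) F4} (hA : A.IsHermitian) : toMat (ofMat A) = A := by
  have hb : ∀ x : F4, star x = x → F4.ofBool (F4.toBool x) = x := by decide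
  rw [Matrix.eta_fin_three (toMat _)]
  conv_rhs => rw [Matrix.eta_fin_three A]
  have h00 : F4.ofBool (F4.toBool (A 0 0)) = A 0 0 := hb _ (hA.apply 0 0)
  have h11 : F4.ofBool (F4.toBool (A 1 1)) = A 1 1 := hb _ (hA.apply 1 1)
  have h22 : F4.ofBool (F4.toBool (A 2 2)) = A 2 2 := hb _ (hA.apply 2 2)
  have h10 : star (A 0 1) = A 1 0 := hA.apply 1 0
  have h20 : star (A 0 2) = A 2 0 := hA.apply 2 0
  have h21 : star (A 1 2) = A 2 1 := hA.apply 2 1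
  rw [← h00, ← h11, ← h22, ← h10, ← h20, ← h21]
  rfl

lemma ofMat_toMat (h : Herm3) : ofMat (toMat h) = h := by
  obtain ⟨a, b, c, x, y, z⟩ := h
  have hb : ∀ b : Bool, F4.toBool (F4.ofBool b) = b := by decide
  simp [toMat, ofMat, hb]

lemma toMat_injective : Function.Injective toMat := Function.LeftInverse.injective ofMat_toMat

lemma det_toMat (h : Herm3) : (toMat h).det = detH h := by
  obtain ⟨a, b, c, x, y, z⟩ := h
  have h2 : ∀ x : F4, -x = x := by decide
  rw [Matrix.det_fin_three]
  simp [toMat, detH, sub_eq_add_neg, h2]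
  ring

lemma toMat_congrH (g : Matrix (Fin 3) (Fin 3) F4) (h : Herm3) :
    toMat (congrH g h) = g * toMat h * gᴴ := by
  have : congrH g h = ofMat (g * toMat h * gᴴ) := by
    obtain ⟨a, b, c, x, y, z⟩ := h
    simp [congrH, ofMat, Matrix.mul_apply, Fin.sum_univ_three, toMat]
  rw [this, toMat_ofMat]
  rw [Matrix.IsHermitian, Matrix.conjTranspose_mul, Matrix.conjTranspose_mul,
    Matrix.conjTranspose_conjTranspose, toMat_isHermitian, Matrix.mul_assoc]

lemma toMat_adjH : ∀ h : Herm3, toMat h * toMat (adjH h) = detH h • 1 := by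
  decide +kernel

lemma toMat_addH (h k : Herm3) : toMat (addH h k) = toMat h + toMat k := by
  obtain ⟨a, b, c, x, y, z⟩ := h
  obtain ⟨a', b', c', x', y', z'⟩ := k
  have hb : ∀ b b' : Bool, F4.ofBool (b ^^ b') = F4.ofBool b + F4.ofBool b' := by decide
  simp only [toMat, addH, hb, star_add]
  ext i j
  fin_cases i <;> fin_cases j <;> rfl

lemma toMat_outer (v : F4 × F4 × F4) :
    toMat (outer v) = vecMulVec ![v.1, v.2.1, v.2.2] (star ![v.1, v.2.1, v.2.2]) := by
  obtain ⟨x, y, z⟩ := v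
  have hb : ∀ x : F4, F4.ofBool (F4.toBool x) = x * star x := by decide
  ext i j
  fin_cases i <;> fin_cases j <;> simp [toMat, outer, vecMulVec_apply, hb, mul_comm]

/-- Representatives of the points of the projective plane over `F4`. -/
def points : List (F4 × F4 × F4) :=
  (1, 0, 0) :: [F4.o, .i, .w, .v].map (fun x => (x, 1, 0)) ++
    [F4.o, .i, .w, .v].flatMap fun x => [F4.o, .i, .w, .v].map fun y => (x, y, 1)

lemma rankOne_iff : ∀ h : Herm3, rankOne h = true ↔ ∃ v ∈ points, outer v = h := by
  decide +kernel

lemma rankOne_outer : ∀ v : F4 × F4 × F4, v ≠ 0 → rankOne (outer v) = true := by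
  decide +kernel

lemma ne_zero_of_mem_points : ∀ v ∈ points, v ≠ 0 := by decide +kernel

lemma rankOne_iff_exists (h : Herm3) :
    rankOne h = true ↔ ∃ v : Fin 3 → F4, v ≠ 0 ∧ toMat h = vecMulVec v (star v) := by
  rw [rankOne_iff]
  constructor
  · rintro ⟨v, hv, rfl⟩
    refine ⟨_, fun h0 => ne_zero_of_mem_points v hv ?_, toMat_outer v⟩
    have e0 := congrFun h0 0
    have e1 := congrFun h0 1
    have e2 := congrFun h0 2
    exact Prod.ext e0 (Prod.ext e1 e2)
  · rintro ⟨v, hv, h1⟩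
    rw [← rankOne_iff]
    have : h = outer (v 0, v 1, v 2) := by
      apply toMat_injective
      rw [h1, toMat_outer]
      have : ![v 0, v 1, v 2] = v := by ext i; fin_cases i <;> rfl
      simp [this]
    rw [this]
    apply rankOne_outer
    intro h0
    apply hv
    ext i
    fin_cases i
    · exact congrArg Prod.fst h0
    · exact congrArg (fun x => x.2.1) h0
    · exact congrArg (fun x => x.2.2) h0

lemma rankOne_congrH {g : Matrix (Fin 3) (Fin 3) F4} (hg : IsUnit g) {h : Herm3}
    (hh : rankOne h = true) : rankOne (congrH g h) = true := by
  rw [rankOne_iff_exists] at hh ⊢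
  obtain ⟨v, hv, hv'⟩ := hh
  refine ⟨g *ᵥ v, fun h0 => hv ?_, ?_⟩
  · exact Matrix.mulVec_injective_of_isUnit hg (h0.trans (Matrix.mulVec_zero g).symm)
  · rw [toMat_congrH, hv', Matrix.mul_vecMulVec, Matrix.vecMulVec_mul, Matrix.star_mulVec]

lemma congrH_addH (g : Matrix (Fin 3) (Fin 3) F4) (h k : Herm3) :
    congrH g (addH h k) = addH (congrH g h) (congrH g k) := by
  apply toMat_injective
  simp only [toMat_congrH, toMat_addH, Matrix.mul_add, Matrix.add_mul]

end Herm

/-! ### The graph on 280 vertices -/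

section Graph280

open Matrix

/-- The Hermitian matrices of determinant `1`. -/
abbrev Vert280 : Type := {h : Herm3 // detH h = 1}

instance : DecidableEq Herm3 := instDecidableEqProd

instance : DecidableEq Vert280 := fun M N => decidable_of_iff (M.1 = N.1) Subtype.ext_iff.symm

/-- Two Hermitian matrices of determinant `1` are adjacent if they differ by a matrix of rank one. -/
def graph280 : SimpleGraph Vert280 where
  Adj M N := rankOne (addH M N) = true
  symm := ⟨fun M N h => by
    have : addH N.1 M.1 = addH M.1 N.1 := toMat_injective (by
      rw [toMat_addH, toMat_addH, add_comm])
    rwa [this]⟩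
  loopless := ⟨fun M => by
    have : ∀ h, rankOne (addH h h) = false := by decide +kernel
    simp [this]⟩

instance : DecidableRel graph280.Adj := fun M N =>
  inferInstanceAs (Decidable (rankOne (addH M.1 N.1) = true))

/-- The identity matrix. -/
def herm₀ : Vert280 := ⟨(true, true, true, 0, 0, 0), by decide⟩

/-- A neighbour of `herm₀`. -/
def herm₁ : Vert280 := ⟨(false, false, true, 1, 0, 0), by decide⟩

/-- A neighbour of `herm₁` at distance `2` from `herm₀`. -/
def herm₂ : Vert280 := ⟨(false, true, true, 1, 0, 0), by decide⟩

/-- A neighbour of `herm₂` at distance `3` from `herm₀`. -/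
def herm₃ : Vert280 := ⟨(true, false, false, 0, 1, 1), by decide⟩

/-- A neighbour of `herm₃` at distance `4` from `herm₀`. -/
def herm₄ : Vert280 := ⟨(false, true, false, 1, 1, 1), by decide⟩

/-- The distance of a matrix from the identity, in terms of the trace `t` and of the sum `e` of the
principal minors of size two. -/
def levelH : Herm3 → ℕ
  | (a, b, c, x, y, z) =>
    let t := a ^^ b ^^ c
    let e := (a && b) ^^ (a && c) ^^ (b && c) ^^ F4.toBool x ^^ F4.toBool y ^^ F4.toBool z
    if t ≠ e then 3 else if t = false then 2 else
      if (a, b, c, x, y, z) = herm₀.1 then 0 else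
        if rankOne (addH herm₀.1 (a, b, c, x, y, z)) then 1 else 4

lemma addH_addH_cancel (h k : Herm3) : addH h (addH h k) = k := by
  have h2 : ∀ A : Matrix (Fin 3) (Fin 3) F4, A + A = 0 := fun A => by
    ext i j
    have : ∀ x : F4, x + x = 0 := by decide
    exact this _
  apply toMat_injective
  rw [toMat_addH, toMat_addH, ← add_assoc, h2, zero_add]

/-- The neighbours of `M` are among the `21` matrices `M + v v*`. -/
lemma exists_point_of_adj {M N : Vert280} (h : graph280.Adj M N) :
    ∃ v ∈ points, N.1 = addH M (outer v) := by
  obtain ⟨v, hv, hv'⟩ := (rankOne_iff _).mp h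
  exact ⟨v, hv, by rw [hv', addH_addH_cancel]⟩

lemma adj_of_point {M N : Vert280} {v : F4 × F4 × F4} (hv : v ∈ points)
    (h : N.1 = addH M (outer v)) : graph280.Adj M N := by
  change rankOne (addH M.1 N.1) = true
  rw [h, addH_addH_cancel]
  exact (rankOne_iff _).mpr ⟨v, hv, rfl⟩

lemma levelH_eq_zero : ∀ M : Vert280, levelH M = 0 ↔ M = herm₀ := by decide +kernel

lemma levelH_le : ∀ M : Vert280, ∀ v ∈ points, detH (addH M (outer v)) = 1 →
    levelH (addH M (outer v)) ≤ levelH M + 1 := by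
  decide +kernel

lemma levelH_desc : ∀ M : Vert280, levelH M ≠ 0 → ∃ v ∈ points, detH (addH M (outer v)) = 1 ∧
    levelH (addH M (outer v)) + 1 = levelH M := by
  decide +kernel

lemma exists_adj_of_levelH {M : Vert280} (h : levelH M ≠ 0) :
    ∃ N : Vert280, graph280.Adj M N ∧ levelH N + 1 = levelH M := by
  obtain ⟨v, hv, hd, hl⟩ := levelH_desc M h
  exact ⟨⟨_, hd⟩, adj_of_point hv rfl, hl⟩

lemma reachable_and_dist_herm₀ (M : Vert280) :
    graph280.Reachable herm₀ M ∧ graph280.dist herm₀ M = levelH M :=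
  dist_eq_of_level herm₀ (fun M => levelH M) levelH_eq_zero
    (fun M N h => by
      obtain ⟨v, hv, he⟩ := exists_point_of_adj h
      have := levelH_le M v hv (he ▸ N.2)
      rwa [← he] at this)
    (fun M h => exists_adj_of_levelH h) M

lemma dist_herm₀ (M : Vert280) : graph280.dist herm₀ M = levelH M :=
  (reachable_and_dist_herm₀ M).2

lemma levelH_eq_one_iff (M : Vert280) : levelH M = 1 ↔ graph280.Adj herm₀ M := by
  rw [← dist_herm₀, SimpleGraph.dist_eq_one_iff_adj]

lemma connected_graph280 : graph280.Connected where
  preconnected M N := (reachable_and_dist_herm₀ M).1.symm.trans (reachable_and_dist_herm₀ N).1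
  nonempty := ⟨herm₀⟩

/-- The diagonal matrix with entries `1, w, w²`. -/
def matDiag : Matrix (Fin 3) (Fin 3) F4 := !![.i, .o, .o; .o, .w, .o; .o, .o, .v]

/-- The matrix of a cyclic permutation. -/
def matCycle : Matrix (Fin 3) (Fin 3) F4 := !![.o, .i, .o; .o, .o, .i; .i, .o, .o]

/-- The character table of the cyclic group of order three. -/
def matFourier : Matrix (Fin 3) (Fin 3) F4 := !![.i, .i, .i; .i, .w, .v; .i, .v, .w]

/-- A unitary matrix that, together with `matDiag`, `matCycle` and `matFourier`, generates a group
whose orbits on the vertices, other than the neighbours of `herm₀`, do not have length `9`. -/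
def matFourier' : Matrix (Fin 3) (Fin 3) F4 := !![.i, .i, .w; .i, .w, .i; .v, .w, .w]

/-- The action of `matDiag ^ i * matCycle ^ j`. -/
def heisenberg (i j : ℕ) (h : Herm3) : Herm3 := (congrH matDiag)^[i] ((congrH matCycle)^[j] h)

lemma heisenberg_neighbor : ∀ v ∈ points, detH (addH herm₀ (outer v)) = 1 →
    ∃ i j : Fin 3, heisenberg i j (addH herm₀ (outer v)) = herm₁ := by
  decide +kernel

lemma eq_herm₀_of_heisenberg : ∀ (M : Vert280) (i j : Fin 3), heisenberg i j M = M →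
    (i = 0 ∧ j = 0) ∨ M = herm₀ := by
  decide +kernel

lemma matFourier_moves : ∀ M : Vert280, levelH M ≤ 1 ∨
    (∀ i j : Fin 3, heisenberg i j M ≠ congrH matFourier M) ∨
    (∀ i j : Fin 3, heisenberg i j M ≠ congrH matFourier' M) := by
  decide +kernel

/-- Unitary matrices that fix `herm₁`. -/
def unitaries₁ : List (Matrix (Fin 3) (Fin 3) F4) :=
  [1, !![.o, .i, .o; .i, .o, .o; .o, .o, .i], !![.i, .v, .w; .v, .i, .w; .i, .i, .i],
    !![.i, .w, .v; .w, .i, .v; .i, .i, .i], !![.i, .w, .i; .w, .i, .i; .i, .i, .w],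
    !![.i, .v, .v; .v, .i, .v; .i, .i, .w], !![.i, .v, .i; .v, .i, .i; .i, .i, .v],
    !![.i, .w, .w; .w, .i, .w; .i, .i, .v]]

/-- Unitary matrices that fix `herm₁` and either fix `herm₂` or map `herm₂` to its inverse. -/
def unitaries₂ : List (Matrix (Fin 3) (Fin 3) F4 × Bool) :=
  [(1, false), (!![.i, .o, .o; .o, .i, .o; .o, .o, .v], false),
    (!![.i, .o, .o; .o, .i, .o; .o, .o, .w], false),
    (!![.o, .i, .o; .i, .o, .o; .o, .o, .w], true), (!![.o, .i, .o; .i, .o, .o; .o, .o, .i], true),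
    (!![.o, .i, .o; .i, .o, .o; .o, .o, .v], true)]

/-- Unitary matrices that fix `herm₃`. -/
def unitaries₃ : List (Matrix (Fin 3) (Fin 3) F4) :=
  [1, !![.i, .i, .w; .i, .v, .v; .w, .v, .w], !![.i, .i, .v; .i, .w, .w; .v, .w, .v]]

lemma unitaries₁_spec : ∀ s ∈ unitaries₁, congrH s herm₀ = herm₀ ∧ congrH s herm₁ = herm₁ := by
  have h : unitaries₁.all (fun s => congrH s herm₀ = herm₀ ∧ congrH s herm₁ = herm₁) = true := by
    decide +kernel
  exact fun s hs => of_decide_eq_true (List.all_eq_true.mp h s hs)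

lemma unitaries₂_spec : ∀ s ∈ unitaries₂, congrH s.1 herm₀ = herm₀ ∧
    congrH s.1 (if s.2 then adjH herm₁ else herm₁) = herm₁ ∧
    congrH s.1 (if s.2 then adjH herm₂ else herm₂) = herm₂ := by
  have h : unitaries₂.all (fun s => congrH s.1 herm₀ = herm₀ ∧
    congrH s.1 (if s.2 then adjH herm₁ else herm₁) = herm₁ ∧
    congrH s.1 (if s.2 then adjH herm₂ else herm₂) = herm₂) = true := by
    decide +kernel
  exact fun s hs => of_decide_eq_true (List.all_eq_true.mp h s hs)

lemma unitaries₃_spec : ∀ s ∈ unitaries₃, congrH s herm₀ = herm₀ ∧ congrH s herm₃ = herm₃ := by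
  have h : unitaries₃.all (fun s => congrH s herm₀ = herm₀ ∧ congrH s herm₃ = herm₃) = true := by
    decide +kernel
  exact fun s hs => of_decide_eq_true (List.all_eq_true.mp h s hs)

lemma sphere280_two : ∀ v ∈ points, detH (addH herm₁ (outer v)) = 1 →
    levelH (addH herm₁ (outer v)) = 2 →
      ∃ s ∈ unitaries₁, congrH s (addH herm₁ (outer v)) = herm₂ := by
  decide +kernel

lemma sphere280_three : ∀ v ∈ points, detH (addH herm₂ (outer v)) = 1 →
    levelH (addH herm₂ (outer v)) = 3 → ∃ s ∈ unitaries₂, congrH s.1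
      (if s.2 then adjH (addH herm₂ (outer v)) else addH herm₂ (outer v)) = herm₃ := by
  decide +kernel

lemma sphere280_four : ∀ v ∈ points, detH (addH herm₃ (outer v)) = 1 →
    levelH (addH herm₃ (outer v)) = 4 →
      ∃ s ∈ unitaries₃, congrH s (addH herm₃ (outer v)) = herm₄ := by
  decide +kernel

lemma levelH_lt_five : ∀ M : Vert280, levelH M < 5 := by decide +kernel

lemma card_sphere280 : ∀ l : Fin 5,
    (Finset.univ.filter fun M : Vert280 => levelH M = l).card = ![1, 9, 72, 144, 54] l := by
  decide +kernel

lemma card_vert280 : Fintype.card Vert280 = 280 := by decide +kernel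

end Graph280

/-! ### The action of `PSL₃(4)` on the vertices -/

section Action280

open Matrix

/-- The special linear group over `F4`. -/
abbrev SL34 : Type := Matrix.SpecialLinearGroup (Fin 3) F4

/-- The group `PSL₃(4)`. -/
abbrev L34 : Type := Matrix.ProjectiveSpecialLinearGroup (Fin 3) (GaloisField 2 2)

/-- The model `F4` of the field of order `4` is isomorphic to Mathlib's. -/
noncomputable def fieldEquiv4 : F4 ≃+* GaloisField 2 2 :=
  letI := Fintype.ofFinite (GaloisField 2 2)
  FiniteField.ringEquivOfCardEq <| by
    rw [← Nat.card_eq_fintype_card (α := GaloisField 2 2), GaloisField.card 2 2 (by norm_num),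
      F4.card]
    norm_num

/-- The isomorphism of special linear groups given by `fieldEquiv4`. -/
noncomputable def slEquiv : SL34 ≃* Matrix.SpecialLinearGroup (Fin 3) (GaloisField 2 2) :=
  MulEquiv.ofBijective (Matrix.SpecialLinearGroup.map (fieldEquiv4 : F4 →+* GaloisField 2 2)) <| by
    constructor
    · intro u v h
      ext i j
      apply fieldEquiv4.injective
      exact congrFun (congrFun (congrArg Subtype.val h) i) j
    · intro v
      refine ⟨Matrix.SpecialLinearGroup.map (fieldEquiv4.symm : GaloisField 2 2 →+* F4) v, ?_⟩
      ext i j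
      exact fieldEquiv4.apply_symm_apply _

/-- The projection of `SL₃(4)` onto `PSL₃(4)`. -/
noncomputable def proj : SL34 →* L34 :=
  (QuotientGroup.mk' _).comp slEquiv.toMonoidHom

lemma proj_surjective : Function.Surjective proj :=
  (QuotientGroup.mk'_surjective _).comp slEquiv.surjective

lemma proj_eq_one_iff {u : SL34} : proj u = 1 ↔ u ∈ Subgroup.center SL34 := by
  change (slEquiv u : L34) = 1 ↔ _
  rw [QuotientGroup.eq_one_iff, Subgroup.mem_center_iff, Subgroup.mem_center_iff]
  constructor
  · intro h v
    apply slEquiv.injective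
    rw [map_mul, map_mul, h]
  · intro h v
    obtain ⟨v, rfl⟩ := slEquiv.surjective v
    rw [← map_mul, ← map_mul, h]

lemma proj_eq_iff {u v : SL34} : proj u = proj v ↔ u⁻¹ * v ∈ Subgroup.center SL34 := by
  rw [← proj_eq_one_iff, map_mul, map_inv, inv_mul_eq_one]

lemma card_L34 : Nat.card L34 = 20160 := by
  have := Fintype.ofFinite (GaloisField 2 2)
  have hK : Nat.card (GaloisField 2 2) = 4 := by rw [GaloisField.card 2 2 (by norm_num)]; norm_num
  have hGL : Nat.card (GL (Fin 3) F4) = 181440 := by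
    rw [Matrix.card_GL_field, F4.card]
    simp [Fin.prod_univ_succ]
  have hdet : Function.Surjective (Matrix.GeneralLinearGroup.det : GL (Fin 3) F4 →* F4ˣ) := by
    intro c
    refine ⟨Matrix.GeneralLinearGroup.mkOfDetNeZero (Matrix.diagonal ![(c : F4), 1, 1]) ?_, ?_⟩
    · simp [Fin.prod_univ_succ]
    · ext
      simp [Fin.prod_univ_succ, Matrix.GeneralLinearGroup.mkOfDetNeZero]
  have hker : Nat.card (MonoidHom.ker (Matrix.GeneralLinearGroup.det : GL (Fin 3) F4 →* F4ˣ)) =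
      Nat.card SL34 := by
    refine (Nat.card_congr (Equiv.ofBijective
      (fun u : SL34 => (⟨(u : GL (Fin 3) F4), ?_⟩ : MonoidHom.ker _)) ⟨?_, ?_⟩)).symm
    · rw [MonoidHom.mem_ker]; ext; simp
    · intro u v h
      have h1 := congrArg (fun g => (g.1 : Matrix (Fin 3) (Fin 3) F4)) h
      exact Subtype.ext h1
    · rintro ⟨g, hg⟩
      refine ⟨⟨g, congrArg Units.val hg⟩, ?_⟩
      ext; rfl
  have hSL : Nat.card SL34 = 60480 := by
    have h1 := (MonoidHom.ker (Matrix.GeneralLinearGroup.det : GL (Fin 3) F4 →* F4ˣ)).card_mul_index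
    rw [hker, Subgroup.index_ker, MonoidHom.range_eq_top.mpr hdet, Subgroup.card_top, hGL] at h1
    have h2 : Nat.card F4ˣ = 3 := by
      rw [Nat.card_eq_fintype_card, Fintype.card_units, F4.card]
    rw [h2] at h1
    omega
  have hcenter : Nat.card (Subgroup.center SL34) = 3 := by
    have h3 : ∀ r : F4, r ≠ 0 → r ^ Fintype.card (Fin 3) = 1 := by decide
    refine (Nat.card_congr (Equiv.ofBijective (fun r : F4ˣ => (⟨⟨Matrix.scalar (Fin 3) (r : F4), by
      simpa using h3 r r.ne_zero⟩, ?_⟩ : Subgroup.center SL34)) ⟨?_, ?_⟩)).symm.trans ?_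
    · exact Matrix.SpecialLinearGroup.mem_center_iff.mpr ⟨r, h3 r r.ne_zero, rfl⟩
    · intro r s h
      have := congrArg (fun u => u.1.1 0 0) h
      simpa [Units.ext_iff] using this
    · rintro ⟨u, hu⟩
      obtain ⟨r, hr, h⟩ := Matrix.SpecialLinearGroup.mem_center_iff.mp hu
      refine ⟨Units.mk0 r ?_, ?_⟩
      · rintro rfl; simp at hr
      · ext i j; simp [← h]
    · rw [Nat.card_eq_fintype_card, Fintype.card_units, F4.card]
  have hproj : proj.ker = Subgroup.center SL34 := by
    ext u; rw [MonoidHom.mem_ker, proj_eq_one_iff]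
  have h1 := proj.ker.card_mul_index
  rw [hproj, hcenter, ← hproj, Subgroup.index_ker, MonoidHom.range_eq_top.mpr proj_surjective,
    Subgroup.card_top, hSL] at h1
  omega

/-- `SL₃(4)` acts on the Hermitian matrices of determinant `1` by `M ↦ u M u*`. -/
instance : MulAction SL34 Vert280 where
  smul u M := ⟨congrH u M, by
    have h : (star u.1.det : F4) = 1 := by rw [u.2, star_one]
    rw [← det_toMat, toMat_congrH, Matrix.det_mul, Matrix.det_mul, u.2, Matrix.det_conjTranspose, h,
      det_toMat, M.2, one_mul, mul_one]⟩
  one_smul M := Subtype.ext <| toMat_injective <| by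
    change toMat (congrH _ _) = _
    simp [toMat_congrH]
  mul_smul u v M := Subtype.ext <| toMat_injective <| by
    change toMat (congrH _ _) = toMat (congrH _ (congrH _ _))
    simp [toMat_congrH, Matrix.conjTranspose_mul, Matrix.mul_assoc]

lemma sl_smul_val (u : SL34) (M : Vert280) : (u • M).1 = congrH u M := rfl

lemma toMat_sl_smul (u : SL34) (M : Vert280) :
    toMat (u • M).1 = u.1 * toMat M.1 * u.1ᴴ := toMat_congrH _ _

lemma center_smul {u : SL34} (hu : u ∈ Subgroup.center SL34) (M : Vert280) : u • M = M := by
  obtain ⟨r, hr, h⟩ := Matrix.SpecialLinearGroup.mem_center_iff.mp hu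
  have h1 : ∀ r : F4, r ^ Fintype.card (Fin 3) = 1 → r * star r = 1 := by decide
  apply Subtype.ext
  apply toMat_injective
  rw [toMat_sl_smul]
  have h2 : u.1 = r • (1 : Matrix (Fin 3) (Fin 3) F4) := by
    rw [← h, Matrix.scalar_apply, Matrix.smul_one_eq_diagonal]
  rw [h2, Matrix.conjTranspose_smul, Matrix.conjTranspose_one]
  simp [smul_smul, h1 r hr, mul_comm]

/-- The scalar matrices of determinant `1` act trivially on the vertices, so that `PSL₃(4)` acts. -/
noncomputable instance : SMul L34 Vert280 where
  smul l M := (proj_surjective l).choose • M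

@[simp] lemma proj_smul (u : SL34) (M : Vert280) : proj u • M = u • M := by
  have h := (proj_surjective (proj u)).choose_spec
  change (proj_surjective (proj u)).choose • M = u • M
  rw [proj_eq_iff] at h
  have h1 := center_smul h M
  rw [mul_smul, inv_smul_eq_iff] at h1
  exact h1.symm

noncomputable instance : MulAction L34 Vert280 where
  one_smul M := by rw [← map_one proj, proj_smul, one_smul]
  mul_smul k l M := by
    obtain ⟨u, rfl⟩ := proj_surjective k
    obtain ⟨v, rfl⟩ := proj_surjective l
    rw [← map_mul, proj_smul, proj_smul, proj_smul, mul_smul]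

lemma psl_smul_adj (l : L34) {M N : Vert280} (h : graph280.Adj M N) :
    graph280.Adj (l • M) (l • N) := by
  obtain ⟨u, rfl⟩ := proj_surjective l
  rw [proj_smul, proj_smul]
  change rankOne (addH (congrH _ _) (congrH _ _)) = true
  rw [← congrH_addH]
  refine rankOne_congrH ?_ h
  rw [Matrix.isUnit_iff_isUnit_det, u.2]
  exact isUnit_one

/-- `PSL₃(4)` acts faithfully on the vertices. -/
lemma eq_one_of_smul_eq {l : L34} (h : ∀ M : Vert280, l • M = M) : l = 1 := by
  obtain ⟨u, rfl⟩ := proj_surjective l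
  rw [proj_eq_one_iff, Matrix.SpecialLinearGroup.mem_center_iff]
  have h1 : u.1 * u.1ᴴ = 1 := by
    have := congrArg (fun M : Vert280 => toMat M.1) (h herm₀)
    simp only [proj_smul, toMat_sl_smul] at this
    have h0 : toMat herm₀.1 = 1 := by decide +kernel
    rwa [h0, mul_one] at this
  have comm : ∀ M : Vert280, u.1 * toMat M.1 = toMat M.1 * u.1 := by
    intro M
    have := congrArg (fun M : Vert280 => toMat M.1) (h M)
    simp only [proj_smul, toMat_sl_smul] at this
    rw [← mul_one (u.1 * toMat M.1), ← mul_eq_one_comm.mp h1, ← mul_assoc, this]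
  have c1 := comm ⟨(false, false, true, 1, 0, 0), by decide⟩
  have c2 := comm ⟨(true, false, false, 0, 0, 1), by decide⟩
  have c3 := comm ⟨(true, false, false, 0, 0, .w), by decide⟩
  have entry : ∀ {A B : Matrix (Fin 3) (Fin 3) F4}, A = B → ∀ i j, A i j = B i j :=
    fun h i j => congrFun (congrFun h i) j
  have a1 : u.1 0 1 = u.1 1 0 := by
    simpa [Matrix.mul_apply, Fin.sum_univ_three, toMat, F4.ofBool] using entry c1 0 0
  have a2 : u.1 0 0 = u.1 1 1 := by
    simpa [Matrix.mul_apply, Fin.sum_univ_three, toMat, F4.ofBool] using entry c1 0 1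
  have a3 : u.1 0 2 = u.1 1 2 := by
    simpa [Matrix.mul_apply, Fin.sum_univ_three, toMat, F4.ofBool] using entry c1 0 2
  have a4 : u.1 2 1 = u.1 2 0 := by
    simpa [Matrix.mul_apply, Fin.sum_univ_three, toMat, F4.ofBool] using entry c1 2 0
  have b1 : u.1 1 2 = u.1 2 1 := by
    simpa [Matrix.mul_apply, Fin.sum_univ_three, toMat, F4.ofBool] using entry c2 1 1
  have b2 : u.1 1 1 = u.1 2 2 := by
    simpa [Matrix.mul_apply, Fin.sum_univ_three, toMat, F4.ofBool] using entry c2 1 2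
  have b3 : u.1 0 1 = u.1 0 2 := by
    simpa [Matrix.mul_apply, Fin.sum_univ_three, toMat, F4.ofBool] using entry c2 0 2
  have d1 : u.1 0 1 * .w = u.1 0 2 := by
    simpa [Matrix.mul_apply, Fin.sum_univ_three, toMat, F4.ofBool] using entry c3 0 2
  have hz : ∀ x : F4, x * .w = x → x = 0 := by decide
  have h01 := hz _ (d1.trans b3.symm)
  have h21 : u.1 2 1 = 0 := by rw [← b1, ← a3, ← b3, h01]
  have hu : Matrix.scalar (Fin 3) (u.1 0 0) = u.1 := by
    ext i j
    fin_cases i <;> fin_cases j <;>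
      simp [← a1, ← a2, ← a3, ← a4, ← b2, ← b3, h01, h21]
  refine ⟨u.1 0 0, ?_, hu⟩
  have hdet := u.2
  rw [← hu] at hdet
  simpa using hdet

end Action280

/-! ### The Sylow `3`-subgroups of `PSL₃(4)` -/

section Sylow280

open Matrix
open scoped Pointwise

/-- The element `matDiag` of `SL₃(4)`. -/
def slDiag : SL34 := ⟨matDiag, by rw [Matrix.det_fin_three]; decide +kernel⟩

/-- The element `matCycle` of `SL₃(4)`. -/
def slCycle : SL34 := ⟨matCycle, by rw [Matrix.det_fin_three]; decide +kernel⟩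

/-- The element `matFourier` of `SL₃(4)`. -/
def slFourier : SL34 := ⟨matFourier, by rw [Matrix.det_fin_three]; decide +kernel⟩

/-- The element `matFourier'` of `SL₃(4)`. -/
def slFourier' : SL34 := ⟨matFourier', by rw [Matrix.det_fin_three]; decide +kernel⟩

lemma slDiag_pow : slDiag ^ 3 = 1 := by
  apply Subtype.ext
  change matDiag ^ 3 = 1
  decide +kernel

lemma slCycle_pow : slCycle ^ 3 = 1 := by
  apply Subtype.ext
  change matCycle ^ 3 = 1
  decide +kernel

lemma proj_slDiag_pow : proj slDiag ^ 3 = 1 := by rw [← map_pow, slDiag_pow, map_one]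

lemma proj_slCycle_pow : proj slCycle ^ 3 = 1 := by rw [← map_pow, slCycle_pow, map_one]

lemma commute_proj : Commute (proj slDiag) (proj slCycle) := by
  let z : SL34 := ⟨Matrix.scalar (Fin 3) F4.v, by simp; decide⟩
  have hz : z ∈ Subgroup.center SL34 :=
    Matrix.SpecialLinearGroup.mem_center_iff.mpr ⟨.v, by decide, rfl⟩
  have h : slDiag * slCycle = z * (slCycle * slDiag) := by
    apply Subtype.ext
    change matDiag * matCycle = Matrix.scalar (Fin 3) F4.v * (matCycle * matDiag)
    decide +kernel
  rw [Commute, SemiconjBy, ← map_mul, h, map_mul, proj_eq_one_iff.mpr hz, one_mul, map_mul]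

/-- A Sylow `3`-subgroup of `PSL₃(4)`: the image of the extraspecial group that is generated by
`matDiag` and `matCycle`. -/
noncomputable def heisenbergSubgroup : Subgroup L34 where
  carrier := {g | ∃ i j : ℕ, g = proj slDiag ^ i * proj slCycle ^ j}
  one_mem' := ⟨0, 0, by simp⟩
  mul_mem' := by
    rintro _ _ ⟨i, j, rfl⟩ ⟨k, l, rfl⟩
    refine ⟨i + k, j + l, ?_⟩
    have h := (commute_proj.pow_pow k j).eq
    rw [pow_add, pow_add, mul_assoc, ← mul_assoc (_ ^ j), ← h]
    simp only [mul_assoc]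
  inv_mem' := by
    rintro _ ⟨i, j, rfl⟩
    refine ⟨2 * i, 2 * j, ?_⟩
    rw [inv_eq_iff_mul_eq_one]
    have h := (commute_proj.pow_pow (2 * i) j).eq
    rw [mul_assoc, ← mul_assoc (_ ^ j), ← h, mul_assoc, ← mul_assoc, ← pow_add, ← pow_add,
      show i + 2 * i = 3 * i by ring, show j + 2 * j = 3 * j by ring, pow_mul, pow_mul,
      proj_slDiag_pow, proj_slCycle_pow]
    simp

lemma heisenberg_smul (i j : ℕ) (M : Vert280) :
    ((proj slDiag ^ i * proj slCycle ^ j) • M).1 = heisenberg i j M := by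
  have h1 : ∀ (u : SL34) (n : ℕ) (M : Vert280), (proj u ^ n • M).1 = (congrH u.1)^[n] M := by
    intro u n
    induction n with
    | zero => intro M; simp
    | succ n ih =>
      intro M
      rw [pow_succ', mul_smul, proj_smul, sl_smul_val, ih, Function.iterate_succ_apply']
  rw [mul_smul, h1, h1]
  rfl

lemma mem_heisenbergSubgroup_iff {g : L34} : g ∈ heisenbergSubgroup ↔
    ∃ i j : Fin 3, g = proj slDiag ^ (i : ℕ) * proj slCycle ^ (j : ℕ) := by
  constructor
  · rintro ⟨i, j, rfl⟩
    refine ⟨⟨i % 3, Nat.mod_lt _ (by norm_num)⟩, ⟨j % 3, Nat.mod_lt _ (by norm_num)⟩, ?_⟩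
    rw [pow_eq_pow_mod i proj_slDiag_pow, pow_eq_pow_mod j proj_slCycle_pow]
  · rintro ⟨i, j, rfl⟩
    exact ⟨i, j, rfl⟩

lemma card_heisenbergSubgroup : Nat.card heisenbergSubgroup = 9 := by
  let f : Fin 3 × Fin 3 → heisenbergSubgroup := fun p =>
    ⟨proj slDiag ^ (p.1 : ℕ) * proj slCycle ^ (p.2 : ℕ), p.1, p.2, rfl⟩
  have hf : Function.Bijective f := by
    constructor
    · intro p q h
      have h0 : proj slDiag ^ (p.1 : ℕ) * proj slCycle ^ (p.2 : ℕ) =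
          proj slDiag ^ (q.1 : ℕ) * proj slCycle ^ (q.2 : ℕ) := congrArg Subtype.val h
      have h1 := heisenberg_smul p.1 p.2 herm₁
      rw [h0, heisenberg_smul] at h1
      have h2 : ∀ p q : Fin 3 × Fin 3,
          heisenberg p.1 p.2 herm₁ = heisenberg q.1 q.2 herm₁ → p = q := by decide +kernel
      exact h2 p q h1.symm
    · rintro ⟨g, hg⟩
      obtain ⟨i, j, rfl⟩ := mem_heisenbergSubgroup_iff.mp hg
      exact ⟨(i, j), rfl⟩
  rw [← Nat.card_eq_of_bijective f hf, Nat.card_eq_fintype_card]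
  rfl

lemma smul_herm₀_of_mem {g : L34} (hg : g ∈ heisenbergSubgroup) : g • herm₀ = herm₀ := by
  obtain ⟨i, j, rfl⟩ := mem_heisenbergSubgroup_iff.mp hg
  have : ∀ i j : Fin 3, heisenberg i j herm₀ = herm₀ := by decide +kernel
  exact Subtype.ext ((heisenberg_smul _ _ _).trans (this i j))

lemma eq_herm₀_of_smul_eq {g : L34} (hg : g ∈ heisenbergSubgroup) (h1 : g ≠ 1) {M : Vert280}
    (h : g • M = M) : M = herm₀ := by
  obtain ⟨i, j, rfl⟩ := mem_heisenbergSubgroup_iff.mp hg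
  rcases eq_herm₀_of_heisenberg M i j ((heisenberg_smul _ _ _).symm.trans
    (congrArg Subtype.val h)) with ⟨rfl, rfl⟩ | h
  · simp at h1
  · exact h

lemma exists_mem_smul_eq_herm₁ {M : Vert280} (h : graph280.Adj herm₀ M) :
    ∃ g ∈ heisenbergSubgroup, g • M = herm₁ := by
  obtain ⟨v, hv, he⟩ := exists_point_of_adj h
  obtain ⟨i, j, hij⟩ := heisenberg_neighbor v hv (he ▸ M.2)
  refine ⟨_, ⟨i, j, rfl⟩, Subtype.ext ((heisenberg_smul _ _ _).trans ?_)⟩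
  rw [he, hij]

lemma psl_transitive (M : Vert280) : ∃ l : L34, l • herm₀ = M := by
  refine exists_smul_eq_of_connected connected_graph280 psl_smul_adj (fun N hN => ?_) M
  let u : SL34 := ⟨!![.i, .i, .o; .w, .v, .o; .o, .o, .i], by
    rw [Matrix.det_fin_three]; decide +kernel⟩
  have hu : proj u • herm₀ = herm₁ := by
    rw [proj_smul]
    apply Subtype.ext
    change congrH !![.i, .i, .o; .w, .v, .o; .o, .o, .i] herm₀ = herm₁
    decide +kernel
  obtain ⟨g, -, hg⟩ := exists_mem_smul_eq_herm₁ hN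
  exact ⟨g⁻¹ * proj u, by rw [mul_smul, hu, inv_smul_eq_iff, hg]⟩

instance : Finite L34 := Nat.finite_of_card_ne_zero (by rw [card_L34]; norm_num)

lemma card_stabilizer_L34 (M : Vert280) : Nat.card (MulAction.stabilizer L34 M) = 72 := by
  have h1 := (MulAction.stabilizer L34 M).card_mul_index
  have h2 : MulAction.orbit L34 M = Set.univ := by
    refine Set.eq_univ_of_forall fun N => ?_
    obtain ⟨g, rfl⟩ := psl_transitive M
    obtain ⟨k, rfl⟩ := psl_transitive N
    exact ⟨k * g⁻¹, by simp [mul_smul]⟩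
  rw [MulAction.index_stabilizer, h2, Set.ncard_univ,
    Nat.card_eq_fintype_card (α := Vert280), card_vert280, card_L34] at h1
  omega

instance : Fact (Nat.Prime 3) := ⟨Nat.prime_three⟩

lemma factorization_card_L34 : (Nat.card L34).factorization 3 = 2 := by
  rw [card_L34, show 20160 = 3 ^ 2 * 2240 by norm_num, Nat.factorization_mul (by norm_num)
    (by norm_num), Nat.prime_three.factorization_pow, Finsupp.add_apply,
    Nat.factorization_eq_zero_of_not_dvd (n := 2240) (by norm_num)]
  simp

/-- The Sylow subgroup `heisenbergSubgroup`. -/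
noncomputable def heisenbergSylow : Sylow 3 L34 :=
  Sylow.ofCard heisenbergSubgroup (by
    rw [card_heisenbergSubgroup, factorization_card_L34]; norm_num)

lemma card_sylow3 (P : Sylow 3 L34) : Nat.card P = 9 := by
  rw [P.card_eq_multiplicity, factorization_card_L34]; norm_num

lemma exists_fixed_point_of_sylow (P : Sylow 3 L34) : ∃ M : Vert280,
    (∀ g ∈ P, g • M = M) ∧ ∀ g ∈ P, g ≠ 1 → ∀ N : Vert280, g • N = N → N = M := by
  obtain ⟨l, rfl⟩ := MulAction.exists_smul_eq L34 heisenbergSylow P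
  have hmem : ∀ g ∈ l • heisenbergSylow, l⁻¹ * g * l ∈ heisenbergSubgroup := by
    intro g hg
    have hg' : g ∈ MulAut.conj l • heisenbergSubgroup := hg
    rw [Subgroup.mem_pointwise_smul_iff_inv_smul_mem] at hg'
    simpa [← map_inv, mul_assoc] using hg'
  refine ⟨l • herm₀, fun g hg => ?_, fun g hg h1 N hN => ?_⟩
  · have := smul_herm₀_of_mem (hmem g hg)
    rwa [mul_smul, mul_smul, inv_smul_eq_iff] at this
  · rw [← inv_smul_eq_iff]
    refine eq_herm₀_of_smul_eq (hmem g hg) (fun h => h1 ?_) ?_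
    · have : g = l * (l⁻¹ * g * l) * l⁻¹ := by group
      rw [this, h]; simp
    · rw [mul_smul, mul_smul, smul_inv_smul, hN]

/-- The only fixed point of a Sylow `3`-subgroup. -/
noncomputable def fixedVertex (P : Sylow 3 L34) : Vert280 := (exists_fixed_point_of_sylow P).choose

lemma smul_fixedVertex {P : Sylow 3 L34} {g : L34} (hg : g ∈ P) :
    g • fixedVertex P = fixedVertex P := (exists_fixed_point_of_sylow P).choose_spec.1 g hg

lemma eq_fixedVertex {P : Sylow 3 L34} {g : L34} (hg : g ∈ P) (h1 : g ≠ 1) {N : Vert280}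
    (h : g • N = N) : N = fixedVertex P :=
  (exists_fixed_point_of_sylow P).choose_spec.2 g hg h1 N h

lemma exists_ne_one_mem (P : Sylow 3 L34) : ∃ g ∈ P, g ≠ 1 := by
  have h : 1 < Nat.card P := by rw [card_sylow3]; norm_num
  have : Nontrivial P := Finite.one_lt_card_iff_nontrivial.mp h
  obtain ⟨g, hg⟩ := exists_ne (1 : P)
  exact ⟨g, g.2, fun h => hg (Subtype.ext h)⟩

lemma fixedVertex_eq_iff {P : Sylow 3 L34} {M : Vert280} :
    fixedVertex P = M ↔ ∀ g ∈ P, g • M = M := by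
  constructor
  · rintro rfl g hg
    exact smul_fixedVertex hg
  · intro h
    obtain ⟨g, hg, h1⟩ := exists_ne_one_mem P
    exact (eq_fixedVertex hg h1 (h g hg)).symm

lemma fixedVertex_smul (l : L34) (P : Sylow 3 L34) : fixedVertex (l • P) = l • fixedVertex P := by
  rw [fixedVertex_eq_iff]
  intro g hg
  have hg' : g ∈ MulAut.conj l • (P : Subgroup L34) := hg
  rw [Subgroup.mem_pointwise_smul_iff_inv_smul_mem] at hg'
  have h : l⁻¹ * g * l ∈ (P : Subgroup L34) := by simpa [← map_inv, mul_assoc] using hg'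
  have := smul_fixedVertex h
  rwa [mul_smul, mul_smul, inv_smul_eq_iff] at this

lemma fixedVertex_heisenbergSylow : fixedVertex heisenbergSylow = herm₀ :=
  fixedVertex_eq_iff.mpr fun _ hg => smul_herm₀_of_mem hg

lemma fixedVertex_surjective : Function.Surjective fixedVertex := by
  intro M
  obtain ⟨l, rfl⟩ := psl_transitive M
  exact ⟨l • heisenbergSylow, by rw [fixedVertex_smul, fixedVertex_heisenbergSylow]⟩

/-- The normalizer of a Sylow `3`-subgroup contains an element of order `4`, so that its order is
divisible by `36`; it is contained in the stabilizer of the fixed vertex, which has order `72`. The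
number of the Sylow subgroups is thus `280` or `560`, and the second is not `1` modulo `3`. -/
lemma card_sylow280 : Nat.card (Sylow 3 L34) = 280 := by
  set S := Subgroup.normalizer (heisenbergSylow : Set L34) with hS
  have hidx : Nat.card (Sylow 3 L34) = S.index := Sylow.card_eq_index_normalizer _
  have hmod := card_sylow_modEq_one 3 L34
  have hcard := S.card_mul_index
  rw [card_L34, ← hidx] at hcard
  have h9 : 9 ∣ Nat.card S := by
    rw [← card_sylow3 heisenbergSylow]
    exact Subgroup.card_dvd_of_le Subgroup.le_normalizer
  have h72 : Nat.card S ∣ 72 := by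
    rw [← card_stabilizer_L34 herm₀]
    refine Subgroup.card_dvd_of_le fun g hg => ?_
    have h1 : g • heisenbergSylow = heisenbergSylow := Sylow.smul_eq_iff_mem_normalizer.mpr hg
    have h2 := fixedVertex_smul g heisenbergSylow
    rw [h1, fixedVertex_heisenbergSylow] at h2
    exact h2.symm
  have h4 : 4 ∣ Nat.card S := by
    have hF : proj slFourier ∈ S := by
      have e1 : slFourier * slDiag = slCycle * slFourier := by
        apply Subtype.ext
        change matFourier * matDiag = matCycle * matFourier
        decide +kernel
      have e2 : slFourier * slCycle = slDiag ^ 2 * slFourier := by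
        apply Subtype.ext
        change matFourier * matCycle = matDiag ^ 2 * matFourier
        decide +kernel
      have f1 : proj slFourier * proj slDiag * (proj slFourier)⁻¹ = proj slCycle := by
        rw [mul_inv_eq_iff_eq_mul, ← map_mul, e1, map_mul]
      have f2 : proj slFourier * proj slCycle * (proj slFourier)⁻¹ = proj slDiag ^ 2 := by
        rw [mul_inv_eq_iff_eq_mul, ← map_mul, e2, map_mul, map_pow]
      refine Subgroup.mem_normalizer_fintype ?_
      rintro _ ⟨i, j, rfl⟩
      have : proj slFourier * (proj slDiag ^ i * proj slCycle ^ j) * (proj slFourier)⁻¹ =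
          proj slCycle ^ i * (proj slDiag ^ 2) ^ j := by
        have g1 : proj slCycle ^ i = proj slFourier * proj slDiag ^ i * (proj slFourier)⁻¹ := by
          rw [← f1, conj_pow]
        have g2 : (proj slDiag ^ 2) ^ j =
            proj slFourier * proj slCycle ^ j * (proj slFourier)⁻¹ := by
          rw [← f2, conj_pow]
        rw [g1, g2]
        group
      rw [this]
      have hc : proj slCycle ∈ heisenbergSubgroup := ⟨0, 1, by simp⟩
      have hd : proj slDiag ∈ heisenbergSubgroup := ⟨1, 0, by simp⟩
      exact mul_mem (pow_mem hc i) (pow_mem (pow_mem hd 2) j)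
    have ho : orderOf (proj slFourier) = 2 ^ (1 + 1) := by
      have : Fact (Nat.Prime 2) := ⟨Nat.prime_two⟩
      refine orderOf_eq_prime_pow (fun h => ?_) ?_
      · have h1 : proj slFourier • proj slFourier • herm₁ = herm₁ := by
          rw [← mul_smul, ← pow_two]
          rw [pow_one] at h
          rw [h, one_smul]
        have h2 : congrH matFourier (congrH matFourier herm₁) ≠ herm₁ := by decide +kernel
        rw [proj_smul, proj_smul] at h1
        exact h2 (congrArg Subtype.val h1)
      · have h1 : slFourier ^ 4 = 1 := by
          apply Subtype.ext
          change matFourier ^ 4 = 1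
          decide +kernel
        change proj slFourier ^ 4 = 1
        rw [← map_pow, h1, map_one]
    have := Subgroup.orderOf_dvd_natCard S hF
    rwa [ho] at this
  have h36 : 36 ∣ Nat.card S := Nat.Coprime.mul_dvd_of_dvd_of_dvd (by norm_num) h4 h9
  obtain ⟨k, hk⟩ := h36
  unfold Nat.ModEq at hmod
  rw [hk] at hcard h72
  have hk2 : k ∣ 2 := Nat.dvd_of_mul_dvd_mul_left (by norm_num : 0 < 36) h72
  have := Nat.le_of_dvd (by norm_num) hk2
  interval_cases k <;> omega

/-- The Sylow `3`-subgroups correspond to the vertices that they fix. -/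
noncomputable def sylowEquiv : Sylow 3 L34 ≃ Vert280 := Equiv.ofBijective fixedVertex <| by
  rw [Nat.bijective_iff_surjective_and_card]
  refine ⟨fixedVertex_surjective, ?_⟩
  rw [card_sylow280, Nat.card_eq_fintype_card, card_vert280]

/-- The Sylow `3`-subgroup that fixes a given vertex. -/
noncomputable def sylowAt (M : Vert280) : Sylow 3 L34 := sylowEquiv.symm M

lemma sylowAt_eq_iff {M : Vert280} {P : Sylow 3 L34} :
    sylowAt M = P ↔ ∀ g ∈ P, g • M = M := by
  rw [sylowAt, Equiv.symm_apply_eq, ← fixedVertex_eq_iff, eq_comm]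
  rfl

lemma smul_of_mem_sylowAt {M : Vert280} {g : L34} (hg : g ∈ sylowAt M) : g • M = M :=
  sylowAt_eq_iff.mp rfl g hg

lemma eq_of_mem_sylowAt {M N : Vert280} {g : L34} (hg : g ∈ sylowAt M) (h1 : g ≠ 1)
    (h : g • N = N) : N = M := by
  rw [eq_fixedVertex hg h1 h]
  exact sylowEquiv.apply_symm_apply M

lemma sylowAt_herm₀ : sylowAt herm₀ = heisenbergSylow :=
  sylowAt_eq_iff.mpr fun _ hg => smul_herm₀_of_mem hg

lemma sylowAt_smul (l : L34) (M : Vert280) : sylowAt (l • M) = l • sylowAt M := by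
  rw [sylowAt, Equiv.symm_apply_eq]
  change _ = fixedVertex _
  rw [fixedVertex_smul]
  congr 1
  exact (sylowEquiv.apply_symm_apply M).symm

end Sylow280

/-! ### The action of `Aut(PSL₃(4))` on the vertices -/

section Aut280

open Matrix
open scoped Pointwise

/-- `Aut(PSL₃(4))` acts on the vertices as it acts on the Sylow `3`-subgroups of `PSL₃(4)`. -/
noncomputable instance : MulAction AutPSL34 Vert280 where
  smul α M := sylowEquiv (α • sylowAt M)
  one_smul M := by
    change sylowEquiv ((1 : AutPSL34) • sylowAt M) = M
    rw [one_smul, sylowAt, Equiv.apply_symm_apply]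
  mul_smul α β M := by
    change sylowEquiv ((α * β) • sylowAt M) =
      sylowEquiv (α • sylowAt (sylowEquiv (β • sylowAt M)))
    rw [mul_smul, sylowAt, sylowAt, Equiv.symm_apply_apply]

lemma sylowAt_aut_smul (α : AutPSL34) (M : Vert280) : sylowAt (α • M) = α • sylowAt M :=
  sylowEquiv.symm_apply_apply _

lemma mem_aut_smul_sylowAt_iff {α : AutPSL34} {M : Vert280} {g : L34} :
    g ∈ sylowAt (α • M) ↔ α⁻¹ g ∈ sylowAt M := by
  rw [sylowAt_aut_smul]
  exact Subgroup.mem_pointwise_smul_iff_inv_smul_mem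

lemma aut_apply_mem_sylowAt {α : AutPSL34} {M : Vert280} {g : L34} (hg : g ∈ sylowAt M) :
    α g ∈ sylowAt (α • M) := by
  rw [mem_aut_smul_sylowAt_iff]
  simpa using hg

lemma aut_smul_eq {α : AutPSL34} {M N : Vert280} (h : ∀ g ∈ sylowAt M, α g • N = N) :
    α • M = N := by
  obtain ⟨g, hg, h1⟩ := exists_ne_one_mem (sylowAt M)
  refine (eq_of_mem_sylowAt (aut_apply_mem_sylowAt (α := α) hg) (fun h0 => h1 ?_) (h g hg)).symm
  rwa [map_eq_one_iff α α.injective] at h0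

lemma aut_smul_smul (α : AutPSL34) (l : L34) (M : Vert280) : α • l • M = α l • α • M := by
  refine aut_smul_eq fun g hg => ?_
  rw [sylowAt_smul] at hg
  have hg' : g ∈ MulAut.conj l • (sylowAt M : Subgroup L34) := hg
  rw [Subgroup.mem_pointwise_smul_iff_inv_smul_mem] at hg'
  have h : l⁻¹ * g * l ∈ (sylowAt M : Subgroup L34) := by simpa [← map_inv, mul_assoc] using hg'
  have h1 := smul_of_mem_sylowAt (aut_apply_mem_sylowAt (α := α) h)
  rw [map_mul, map_mul, map_inv, mul_smul, mul_smul, inv_smul_eq_iff] at h1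
  exact h1

lemma conj_smul (l : L34) (M : Vert280) : MulAut.conj l • M = l • M := by
  refine aut_smul_eq fun g hg => ?_
  rw [MulAut.conj_apply, mul_smul, mul_smul, inv_smul_smul, smul_of_mem_sylowAt hg]

/-- Adjacency is determined by the action of the group: the neighbours of `M` are those vertices
other than `M` whose orbit under the stabilizer of `M` is an orbit of the Sylow `3`-subgroup. -/
lemma adj_iff_orbit (M N : Vert280) : graph280.Adj M N ↔
    M ≠ N ∧ ∀ l : L34, l • M = M → ∃ g ∈ sylowAt M, l • N = g • N := by
  have main : ∀ N, graph280.Adj herm₀ N ↔ herm₀ ≠ N ∧ ∀ l : L34, l • herm₀ = herm₀ →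
      ∃ g ∈ sylowAt herm₀, l • N = g • N := by
    intro N
    rw [sylowAt_herm₀]
    constructor
    · intro h
      refine ⟨h.ne, fun l hl => ?_⟩
      obtain ⟨g, hg, hg'⟩ := exists_mem_smul_eq_herm₁ h
      obtain ⟨k, hk, hk'⟩ := exists_mem_smul_eq_herm₁ (M := l • N) (by
        rw [← hl]; exact psl_smul_adj l h)
      refine ⟨k⁻¹ * g, mul_mem (s := heisenbergSubgroup) (inv_mem hk) hg, ?_⟩
      rw [mul_smul, hg', eq_inv_smul_iff, hk']
    · rintro ⟨hne, h⟩
      rw [← levelH_eq_one_iff]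
      have h0 : levelH N ≠ 0 := fun h => hne ((levelH_eq_zero N).mp h).symm
      have fix : ∀ u : SL34, congrH u.1 herm₀ = herm₀ →
          ∃ i j : Fin 3, heisenberg i j N = congrH u.1 N := by
        intro u hu
        obtain ⟨g, hg, hg'⟩ := h (proj u) (by rw [proj_smul]; exact Subtype.ext hu)
        obtain ⟨i, j, rfl⟩ := mem_heisenbergSubgroup_iff.mp hg
        refine ⟨i, j, ?_⟩
        rw [← heisenberg_smul, ← hg', proj_smul]
        rfl
      rcases matFourier_moves N with h1 | h1 | h1
      · omega
      · obtain ⟨i, j, hij⟩ := fix slFourier (by change congrH matFourier _ = _; decide +kernel)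
        exact absurd hij (h1 i j)
      · obtain ⟨i, j, hij⟩ := fix slFourier' (by change congrH matFourier' _ = _; decide +kernel)
        exact absurd hij (h1 i j)
  obtain ⟨k, rfl⟩ := psl_transitive M
  have h1 : graph280.Adj (k • herm₀) N ↔ graph280.Adj herm₀ (k⁻¹ • N) := by
    constructor
    · intro h; simpa using psl_smul_adj k⁻¹ h
    · intro h; simpa using psl_smul_adj k h
  rw [h1, main, sylowAt_smul]
  refine and_congr (by rw [Ne, Ne, eq_inv_smul_iff]) ⟨fun h l hl => ?_, fun h l hl => ?_⟩
  · obtain ⟨g, hg, hg'⟩ := h (k⁻¹ * l * k) (by rw [mul_smul, mul_smul, hl, inv_smul_smul])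
    refine ⟨k * g * k⁻¹, ?_, ?_⟩
    · change k * g * k⁻¹ ∈ MulAut.conj k • (sylowAt herm₀ : Subgroup L34)
      exact Subgroup.smul_mem_pointwise_smul _ (MulAut.conj k) _ hg
    · rw [mul_smul, mul_smul, smul_inv_smul, inv_smul_eq_iff] at hg'
      rw [hg', mul_smul, mul_smul]
  · obtain ⟨g, hg, hg'⟩ := h (k * l * k⁻¹) (by rw [mul_smul, mul_smul, inv_smul_smul, hl])
    have hg2 : g ∈ MulAut.conj k • (sylowAt herm₀ : Subgroup L34) := hg
    rw [Subgroup.mem_pointwise_smul_iff_inv_smul_mem] at hg2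
    refine ⟨k⁻¹ * g * k, ?_, ?_⟩
    · have : k⁻¹ * g * k ∈ (sylowAt herm₀ : Subgroup L34) := by
        simpa [← map_inv, mul_assoc] using hg2
      exact this
    · rw [mul_smul, mul_smul] at hg'
      rw [mul_smul, mul_smul, smul_inv_smul, ← hg', inv_smul_smul]

lemma aut_smul_adj (α : AutPSL34) {M N : Vert280} (h : graph280.Adj M N) :
    graph280.Adj (α • M) (α • N) := by
  rw [adj_iff_orbit] at h ⊢
  refine ⟨(MulAction.injective α).ne h.1, fun l hl => ?_⟩
  have e : ∀ x : Vert280, l • α • x = α • (α⁻¹ l) • x := fun x => by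
    rw [aut_smul_smul, ← MulAut.mul_apply, mul_inv_cancel, MulAut.one_apply]
  rw [e] at hl
  obtain ⟨g, hg, hg'⟩ := h.2 (α⁻¹ l) (MulAction.injective α hl)
  exact ⟨α g, aut_apply_mem_sylowAt hg, by rw [e, hg', aut_smul_smul]⟩

/-- The automorphism of the graph given by an automorphism of the group. -/
noncomputable def autIso (α : AutPSL34) : graph280 ≃g graph280 where
  toEquiv := MulAction.toPerm α
  map_rel_iff' {M N} := ⟨fun h => by simpa using aut_smul_adj α⁻¹ h, aut_smul_adj α⟩

lemma autIso_apply (α : AutPSL34) (M : Vert280) : autIso α M = α • M := rfl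

/-- The automorphisms of `SL₃(4)` induce automorphisms of `PSL₃(4)`. -/
lemma exists_aut_proj (θ : SL34 ≃* SL34) : ∃ α : AutPSL34, ∀ u, α (proj u) = proj (θ u) := by
  have hθ : ∀ u, θ u ∈ Subgroup.center SL34 ↔ u ∈ Subgroup.center SL34 := by
    intro u
    rw [Subgroup.mem_center_iff, Subgroup.mem_center_iff]
    constructor
    · intro h v
      apply θ.injective
      rw [map_mul, map_mul, h]
    · intro h v
      obtain ⟨v, rfl⟩ := θ.surjective v
      rw [← map_mul, ← map_mul, h]
  have hs : ∀ l, ∃ u, proj u = l := proj_surjective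
  choose s hs using hs
  have key : ∀ u, proj (θ (s (proj u))) = proj (θ u) := by
    intro u
    rw [proj_eq_iff, ← map_inv, ← map_mul, hθ, ← proj_eq_iff, hs]
  let f : L34 →* L34 := MonoidHom.mk' (fun l => proj (θ (s l))) fun k l => by
    obtain ⟨u, rfl⟩ := proj_surjective k
    obtain ⟨v, rfl⟩ := proj_surjective l
    rw [← map_mul, key, key, key, map_mul, map_mul]
  have hf : Function.Surjective f := by
    intro l
    obtain ⟨u, rfl⟩ := proj_surjective l
    refine ⟨proj (θ.symm u), ?_⟩
    change proj (θ (s (proj (θ.symm u)))) = proj u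
    rw [key, MulEquiv.apply_symm_apply]
  exact ⟨MulEquiv.ofBijective f (Finite.surjective_iff_bijective.mp hf), key⟩

/-- An automorphism of `SL₃(4)` and a compatible map on the vertices. -/
lemma exists_aut_smul_eq (θ : SL34 ≃* SL34) (f : Vert280 → Vert280)
    (hf : ∀ (u : SL34) (M : Vert280), f (u • M) = θ u • f M) :
    ∃ α : AutPSL34, ∀ M : Vert280, α • M = f M := by
  obtain ⟨α, hα⟩ := exists_aut_proj θ
  refine ⟨α, fun M => aut_smul_eq fun g hg => ?_⟩
  obtain ⟨u, rfl⟩ := proj_surjective g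
  have h := smul_of_mem_sylowAt hg
  rw [proj_smul] at h
  rw [hα, proj_smul, ← hf, h]

lemma toMat_herm₀ : toMat herm₀.1 = 1 := by decide +kernel

/-- Unitary matrices act on the graph, also if their determinant is not `1`. -/
lemma exists_aut_smul_eq_congrH {s : Matrix (Fin 3) (Fin 3) F4} (hs : congrH s herm₀ = herm₀) :
    ∃ α : AutPSL34, ∀ M : Vert280, (α • M).1 = congrH s M := by
  have h1 : s * sᴴ = 1 := by
    have := congrArg toMat hs
    rwa [toMat_congrH, toMat_herm₀, mul_one] at this
  have h2 : sᴴ * s = 1 := mul_eq_one_comm.mp h1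
  have hdet : s.det * sᴴ.det = 1 := by rw [← Matrix.det_mul, h1, Matrix.det_one]
  let θ : SL34 ≃* SL34 :=
    { toFun := fun u => ⟨s * u.1 * sᴴ, by
        rw [Matrix.det_mul, Matrix.det_mul, u.2, mul_one, hdet]⟩
      invFun := fun u => ⟨sᴴ * u.1 * s, by
        rw [Matrix.det_mul, Matrix.det_mul, u.2, mul_one, mul_comm, hdet]⟩
      left_inv := fun u => Subtype.ext <| by
        change sᴴ * (s * u.1 * sᴴ) * s = u.1
        rw [mul_assoc s, ← mul_assoc sᴴ, h2, one_mul, mul_assoc, h2, mul_one]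
      right_inv := fun u => Subtype.ext <| by
        change s * (sᴴ * u.1 * s) * sᴴ = u.1
        rw [mul_assoc sᴴ, ← mul_assoc s, h1, one_mul, mul_assoc, h1, mul_one]
      map_mul' := fun u v => Subtype.ext <| by
        change s * (u.1 * v.1) * sᴴ = s * u.1 * sᴴ * (s * v.1 * sᴴ)
        have : s * u.1 * sᴴ * (s * v.1 * sᴴ) = s * u.1 * (sᴴ * s) * v.1 * sᴴ := by
          simp only [mul_assoc]
        rw [this, h2, mul_one]
        simp only [mul_assoc] }
  obtain ⟨α, hα⟩ := exists_aut_smul_eq θ (fun M => ⟨congrH s M, by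
    rw [← det_toMat, toMat_congrH, Matrix.det_mul, Matrix.det_mul, det_toMat, M.2, mul_one, hdet]⟩)
    (fun u M => Subtype.ext <| toMat_injective <| by
      change toMat (congrH s (congrH u.1 M)) = toMat (congrH (s * u.1 * sᴴ) (congrH s M))
      simp only [toMat_congrH, Matrix.conjTranspose_mul, Matrix.conjTranspose_conjTranspose]
      have : s * u.1 * sᴴ * (s * toMat M.1 * sᴴ) * (s * (u.1ᴴ * sᴴ)) =
          s * u.1 * (sᴴ * s) * toMat M.1 * (sᴴ * s) * u.1ᴴ * sᴴ := by
        simp only [mul_assoc]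
      rw [this, h2]
      simp only [mul_assoc, mul_one])
  exact ⟨α, fun M => congrArg Subtype.val (hα M)⟩

/-- The inverse transpose automorphism acts on the vertices by matrix inversion. -/
lemma exists_aut_smul_eq_adjH : ∃ α : AutPSL34, ∀ M : Vert280, (α • M).1 = adjH M := by
  have hinv : ∀ M : Vert280, toMat M.1 * toMat (adjH M) = 1 := fun M => by
    rw [toMat_adjH, M.2, one_smul]
  let t : SL34 → SL34 :=
    fun u => ⟨(u⁻¹).1ᴴ, by rw [Matrix.det_conjTranspose, (u⁻¹).2, star_one]⟩
  have hθ : ∀ u, t (t u) = u := fun u => Subtype.ext <| by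
    change (adjugate ((u⁻¹).1ᴴ))ᴴ = u.1
    rw [← Matrix.adjugate_conjTranspose, Matrix.conjTranspose_conjTranspose]
    exact congrArg Subtype.val (inv_inv u)
  let θ : SL34 ≃* SL34 :=
    { toFun := t
      invFun := t
      left_inv := hθ
      right_inv := hθ
      map_mul' := fun u v => Subtype.ext <| by
        change ((u * v)⁻¹).1ᴴ = (u⁻¹).1ᴴ * (v⁻¹).1ᴴ
        rw [_root_.mul_inv_rev, ← Matrix.conjTranspose_mul]
        rfl }
  obtain ⟨α, hα⟩ := exists_aut_smul_eq θ (fun M => ⟨adjH M, by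
    have h := congrArg Matrix.det (hinv M)
    rwa [Matrix.det_mul, det_toMat, det_toMat, M.2, one_mul, Matrix.det_one] at h⟩)
    (fun u M => Subtype.ext <| toMat_injective <| by
      change toMat (adjH (u • M).1) = toMat (congrH (u⁻¹).1ᴴ (adjH M))
      refine (left_inv_eq_right_inv (a := toMat (u • M).1) ?_ ?_)
      · exact mul_eq_one_comm.mp (hinv (u • M))
      · rw [toMat_sl_smul, toMat_congrH, Matrix.conjTranspose_conjTranspose]
        have h1 : u.1ᴴ * (u⁻¹).1ᴴ = 1 := by
          rw [← Matrix.conjTranspose_mul]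
          have : (u⁻¹).1 * u.1 = 1 := congrArg Subtype.val (inv_mul_cancel u)
          rw [this, Matrix.conjTranspose_one]
        have h2 : u.1 * (u⁻¹).1 = 1 := congrArg Subtype.val (mul_inv_cancel u)
        have : u.1 * toMat M.1 * u.1ᴴ * ((u⁻¹).1ᴴ * toMat (adjH M) * (u⁻¹).1) =
            u.1 * (toMat M.1 * (u.1ᴴ * (u⁻¹).1ᴴ) * toMat (adjH M)) * (u⁻¹).1 := by
          simp only [mul_assoc]
        rw [this, h1, mul_one, hinv, mul_one, h2])
  exact ⟨α, fun M => congrArg Subtype.val (hα M)⟩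

end Aut280

/-! ### Geodesics of the graph on 280 vertices -/

section Spheres280

open Matrix

lemma levelH_smul {α : AutPSL34} (hα : α • herm₀ = herm₀) (M : Vert280) :
    levelH (α • M : Vert280) = levelH M := by
  have h := dist_map_iso (autIso α) herm₀ M
  rwa [autIso_apply, autIso_apply, hα, dist_herm₀, dist_herm₀] at h

lemma exists_aut_smul_eq_herm₁ {M : Vert280} (h : levelH M = 1) :
    ∃ α : AutPSL34, α • herm₀ = herm₀ ∧ α • M = herm₁ := by
  obtain ⟨g, hg, hg'⟩ := exists_mem_smul_eq_herm₁ ((levelH_eq_one_iff M).mp h)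
  exact ⟨MulAut.conj g, by rw [conj_smul, smul_herm₀_of_mem hg], by rw [conj_smul, hg']⟩

lemma exists_aut_smul_eq_herm₂ {M : Vert280} (ha : graph280.Adj herm₁ M) (h : levelH M = 2) :
    ∃ α : AutPSL34, α • herm₀ = herm₀ ∧ α • herm₁ = herm₁ ∧ α • M = herm₂ := by
  obtain ⟨v, hv, he⟩ := exists_point_of_adj ha
  obtain ⟨s, hs, hs'⟩ := sphere280_two v hv (he ▸ M.2) (he ▸ h)
  obtain ⟨h0, h1⟩ := unitaries₁_spec s hs
  obtain ⟨α, hα⟩ := exists_aut_smul_eq_congrH h0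
  exact ⟨α, Subtype.ext ((hα _).trans h0), Subtype.ext ((hα _).trans h1),
    Subtype.ext ((hα _).trans (he ▸ hs'))⟩

lemma exists_aut_smul_eq_herm₃ {M : Vert280} (ha : graph280.Adj herm₂ M) (h : levelH M = 3) :
    ∃ α : AutPSL34, α • herm₀ = herm₀ ∧ α • herm₁ = herm₁ ∧ α • herm₂ = herm₂ ∧
      α • M = herm₃ := by
  obtain ⟨v, hv, he⟩ := exists_point_of_adj ha
  obtain ⟨s, hs, hs'⟩ := sphere280_three v hv (he ▸ M.2) (he ▸ h)
  rw [← he] at hs'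
  obtain ⟨h0, h1, h2⟩ := unitaries₂_spec s hs
  obtain ⟨α, hα⟩ := exists_aut_smul_eq_congrH h0
  obtain ⟨ι, hι⟩ := exists_aut_smul_eq_adjH
  have hinv : adjH herm₀ = herm₀ := by decide +kernel
  obtain ⟨β, hβ⟩ : ∃ β : AutPSL34, ∀ N : Vert280,
      (β • N).1 = congrH s.1 (if s.2 then adjH N else N) := by
    cases hb : s.2 with
    | false => exact ⟨α, fun N => by rw [hα]; rfl⟩
    | true => exact ⟨α * ι, fun N => by rw [mul_smul, hα, hι]; rfl⟩
  refine ⟨β, Subtype.ext ((hβ _).trans ?_), Subtype.ext ((hβ _).trans h1),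
    Subtype.ext ((hβ _).trans h2), Subtype.ext ((hβ _).trans hs')⟩
  rw [hinv, ite_self, h0]

lemma exists_aut_smul_eq_herm₄ {M : Vert280} (ha : graph280.Adj herm₃ M) (h : levelH M = 4) :
    ∃ α : AutPSL34, α • herm₀ = herm₀ ∧ α • M = herm₄ := by
  obtain ⟨v, hv, he⟩ := exists_point_of_adj ha
  obtain ⟨s, hs, hs'⟩ := sphere280_four v hv (he ▸ M.2) (he ▸ h)
  obtain ⟨h0, -⟩ := unitaries₃_spec s hs
  obtain ⟨α, hα⟩ := exists_aut_smul_eq_congrH h0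
  exact ⟨α, Subtype.ext ((hα _).trans h0), Subtype.ext ((hα _).trans (he ▸ hs'))⟩

/-- A vertex at each distance from `herm₀`. -/
def hermBase : ℕ → Vert280
  | 0 => herm₀
  | 1 => herm₁
  | 2 => herm₂
  | 3 => herm₃
  | _ => herm₄

lemma exists_aut_smul_eq_hermBase (l : ℕ) : ∀ M : Vert280, levelH M = l →
    ∃ α : AutPSL34, α • herm₀ = herm₀ ∧ α • M = hermBase l := by
  have step : ∀ (l : ℕ) (M : Vert280), levelH M = l + 1 →
      (∀ N : Vert280, levelH N = l → ∃ α : AutPSL34, α • herm₀ = herm₀ ∧ α • N = hermBase l) →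
      (∀ N : Vert280, graph280.Adj (hermBase l) N → levelH N = l + 1 →
        ∃ α : AutPSL34, α • herm₀ = herm₀ ∧ α • N = hermBase (l + 1)) →
      ∃ α : AutPSL34, α • herm₀ = herm₀ ∧ α • M = hermBase (l + 1) := by
    intro l M hM h1 h2
    obtain ⟨N, hN, hN'⟩ := exists_adj_of_levelH (M := M) (by omega)
    obtain ⟨α, hα, hα'⟩ := h1 N (by omega)
    obtain ⟨β, hβ, hβ'⟩ := h2 (α • M) (by rw [← hα']; exact aut_smul_adj α hN.symm)
      (by rw [levelH_smul hα, hM])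
    exact ⟨β * α, by rw [mul_smul, hα, hβ], by rw [mul_smul, hβ']⟩
  induction l with
  | zero => exact fun M hM => ⟨1, one_smul _ _, by
      rw [one_smul]; exact (levelH_eq_zero M).mp hM⟩
  | succ l ih =>
    intro M hM
    refine step l M hM ih fun N hN hN' => ?_
    match l with
    | 0 => exact exists_aut_smul_eq_herm₁ hN'
    | 1 => exact (exists_aut_smul_eq_herm₂ hN hN').imp fun α h => ⟨h.1, h.2.2⟩
    | 2 => exact (exists_aut_smul_eq_herm₃ hN hN').imp fun α h => ⟨h.1, h.2.2.2⟩
    | 3 => exact exists_aut_smul_eq_herm₄ hN hN'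
    | l + 4 => have := levelH_lt_five N; omega

lemma exists_aut_smul_eq_of_level {M N : Vert280} (h : levelH M = levelH N) :
    ∃ α : AutPSL34, α • herm₀ = herm₀ ∧ α • M = N := by
  obtain ⟨α, hα, hα'⟩ := exists_aut_smul_eq_hermBase _ M h
  obtain ⟨β, hβ, hβ'⟩ := exists_aut_smul_eq_hermBase _ N rfl
  refine ⟨β⁻¹ * α, ?_, ?_⟩
  · rw [mul_smul, hα, inv_smul_eq_iff, hβ]
  · rw [mul_smul, hα', inv_smul_eq_iff, hβ']

lemma aut_transitive (M : Vert280) : ∃ α : AutPSL34, α • herm₀ = M := by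
  obtain ⟨l, hl⟩ := psl_transitive M
  exact ⟨MulAut.conj l, by rw [conj_smul, hl]⟩

lemma isSphereTransitive_graph280 : IsSphereTransitive AutPSL34 graph280 herm₀ 9 where
  transitive := aut_transitive
  smul_adj α := aut_smul_adj α
  connected := connected_graph280
  sphere M N h := exists_aut_smul_eq_of_level (by rwa [dist_herm₀, dist_herm₀] at h)
  valency := by
    have : graph280.neighborSet herm₀ =
        ((Finset.univ.filter fun M : Vert280 => levelH M = (1 : Fin 5) : Finset Vert280) :
          Set Vert280) := by
      ext M; simp [levelH_eq_one_iff]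
    rw [this, Set.ncard_coe_finset, card_sphere280]
    rfl
  pos := by norm_num
  large M h0 h1 := by
    have hl := levelH_lt_five M
    have : {N | graph280.dist herm₀ N = graph280.dist herm₀ M} =
        ((Finset.univ.filter fun N : Vert280 => levelH N = (⟨levelH M, hl⟩ : Fin 5) :
          Finset Vert280) : Set Vert280) := by
      ext N; simp [dist_herm₀]
    rw [this, Set.ncard_coe_finset, card_sphere280]
    have h0' : levelH M ≠ 0 := fun h => h0 ((levelH_eq_zero M).mp h)
    have h1' : levelH M ≠ 1 := fun h => h1 ((levelH_eq_one_iff M).mp h)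
    have hc : ∀ l : Fin 5, l.1 ≠ 0 → l.1 ≠ 1 → 9 < (![1, 9, 72, 144, 54] : Fin 5 → ℕ) l := by
      decide
    exact hc _ h0' h1'

lemma isGeodesicTransitive_three_graph280 : IsGeodesicTransitive graph280 3 := by
  refine isGeodesicTransitive_of_steps hermBase ?_ ?_ ?_ ?_
  · have h1 : graph280.Adj herm₀ herm₁ := by decide +kernel
    have h2 : graph280.Adj herm₁ herm₂ := by decide +kernel
    have h3 : graph280.Adj herm₂ herm₃ := by decide +kernel
    intro i hi
    match i, hi with
    | 0, _ => exact h1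
    | 1, _ => exact h2
    | 2, _ => exact h3
  · change graph280.dist herm₀ herm₃ = 3
    rw [dist_herm₀]
    decide +kernel
  · intro M
    obtain ⟨α, hα⟩ := aut_transitive M
    exact ⟨autIso α⁻¹, by rw [autIso_apply, inv_smul_eq_iff]; exact hα.symm⟩
  · intro i hi w ha hd
    replace hd : levelH w = i + 1 := by rw [← dist_herm₀]; exact hd
    match i, hi with
    | 0, _ =>
      obtain ⟨α, h0, h1⟩ := exists_aut_smul_eq_herm₁ hd
      refine ⟨autIso α, fun j hj => ?_, h1⟩
      obtain rfl : j = 0 := by omega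
      exact h0
    | 1, _ =>
      obtain ⟨α, h0, h1, h2⟩ := exists_aut_smul_eq_herm₂ ha hd
      refine ⟨autIso α, fun j hj => ?_, h2⟩
      obtain rfl | rfl : j = 0 ∨ j = 1 := by omega
      · exact h0
      · exact h1
    | 2, _ =>
      obtain ⟨α, h0, h1, h2, h3⟩ := exists_aut_smul_eq_herm₃ ha hd
      refine ⟨autIso α, fun j hj => ?_, h3⟩
      obtain rfl | rfl | rfl : j = 0 ∨ j = 1 ∨ j = 2 := by omega
      · exact h0
      · exact h1
      · exact h2

lemma not_isGeodesicTransitive_four_graph280 : ¬ IsGeodesicTransitive graph280 4 := by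
  have h01 : graph280.Adj herm₀ herm₁ := by decide +kernel
  have h12 : graph280.Adj herm₁ herm₂ := by decide +kernel
  have h23 : graph280.Adj herm₂ herm₃ := by decide +kernel
  have geo : ∀ M, graph280.Adj herm₃ M → levelH M = 4 →
      IsGeodesic graph280 4 ![herm₀, herm₁, herm₂, herm₃, M] := fun M h1 h2 =>
    isGeodesic_of_chain (fun i => by
        fin_cases i
        · exact h01
        · exact h12
        · exact h23
        · exact h1)
      ((dist_herm₀ M).trans h2)
  -- The middle vertex has a neighbour at distance `2` from both ends.
  have inv : ∀ (φ : graph280 ≃g graph280) (p : Fin 5 → Vert280),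
      (∃ v, graph280.Adj v (p 2) ∧ (v ≠ p 0 ∧ ¬ graph280.Adj v (p 0) ∧
        ∃ x, graph280.Adj x v ∧ graph280.Adj x (p 0)) ∧ (v ≠ p 4 ∧ ¬ graph280.Adj v (p 4) ∧
        ∃ x, graph280.Adj x v ∧ graph280.Adj x (p 4))) →
      (∃ v, graph280.Adj v (φ (p 2)) ∧ (v ≠ φ (p 0) ∧ ¬ graph280.Adj v (φ (p 0)) ∧
        ∃ x, graph280.Adj x v ∧ graph280.Adj x (φ (p 0))) ∧
        (v ≠ φ (p 4) ∧ ¬ graph280.Adj v (φ (p 4)) ∧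
        ∃ x, graph280.Adj x v ∧ graph280.Adj x (φ (p 4)))) := by
    rintro φ p ⟨v, h, ⟨h1, h2, x, h3, h4⟩, ⟨k1, k2, y, k3, k4⟩⟩
    refine ⟨φ v, ?_, ⟨φ.injective.ne h1, ?_, φ x, ?_, ?_⟩, ⟨φ.injective.ne k1, ?_, φ y, ?_, ?_⟩⟩ <;>
      simpa only [φ.map_adj_iff]
  refine not_isGeodesicTransitive_of_invariant (by norm_num) _ inv
    (geo ⟨(true, true, true, .o, .i, .w), by decide +kernel⟩ (by decide +kernel)
      (by decide +kernel)) (geo herm₄ (by decide +kernel) (by decide +kernel)) ?_ ?_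
  · change ∃ v, graph280.Adj v herm₂ ∧ (v ≠ herm₀ ∧ ¬ graph280.Adj v herm₀ ∧
        ∃ x, graph280.Adj x v ∧ graph280.Adj x herm₀) ∧
        (v ≠ ⟨(true, true, true, .o, .i, .w), _⟩ ∧
        ¬ graph280.Adj v ⟨(true, true, true, .o, .i, .w), _⟩ ∧
        ∃ x, graph280.Adj x v ∧ graph280.Adj x ⟨(true, true, true, .o, .i, .w), _⟩)
    decide +kernel
  · change ¬ ∃ v, graph280.Adj v herm₂ ∧ (v ≠ herm₀ ∧ ¬ graph280.Adj v herm₀ ∧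
        ∃ x, graph280.Adj x v ∧ graph280.Adj x herm₀) ∧
        (v ≠ herm₄ ∧ ¬ graph280.Adj v herm₄ ∧
        ∃ x, graph280.Adj x v ∧ graph280.Adj x herm₄)
    decide +kernel

end Spheres280

/-! ### The maximal subgroups of index `280` in `Aut(PSL₃(4))` -/

section Index280

instance : Finite AutPSL34 := DFunLike.finite AutPSL34

lemma orbit_aut : MulAction.orbit AutPSL34 herm₀ = Set.univ :=
  Set.eq_univ_of_forall aut_transitive

lemma index_stabilizer_aut (M : Vert280) : (MulAction.stabilizer AutPSL34 M).index = 280 := by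
  have h : MulAction.orbit AutPSL34 M = Set.univ := by
    obtain ⟨α, rfl⟩ := aut_transitive M
    rw [MulAction.orbit_smul, orbit_aut]
  rw [MulAction.index_stabilizer, h, Set.ncard_univ, Nat.card_eq_fintype_card, card_vert280]

lemma smul_mem_orbit_of_mem {G X : Type*} [Group G] [MulAction G X] {K : Subgroup G} {x y : X}
    {g : G} (hg : g ∈ K) (h : x ∈ MulAction.orbit K y) : g • x ∈ MulAction.orbit K y := by
  obtain ⟨k, rfl⟩ := h
  exact ⟨⟨g, hg⟩ * k, mul_smul _ _ _⟩

lemma smul_mem_orbit_subgroup {G X : Type*} [Group G] [MulAction G X] {K : Subgroup G} {g : G}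
    (hg : g ∈ K) (x : X) : g • x ∈ MulAction.orbit K x :=
  smul_mem_orbit_of_mem hg (MulAction.mem_orbit_self x)

lemma eq_top_of_stabilizer_le {G X : Type*} [Group G] [MulAction G X] {K : Subgroup G} {x : X}
    (hle : MulAction.stabilizer G x ≤ K) (h : ∀ y : X, y ∈ MulAction.orbit K x) : K = ⊤ := by
  rw [eq_top_iff]
  intro g _
  obtain ⟨k, hk⟩ := h (g • x)
  have h2 : k.1⁻¹ * g ∈ MulAction.stabilizer G x := by
    rw [MulAction.mem_stabilizer_iff, mul_smul, inv_smul_eq_iff]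
    exact hk.symm
  have := mul_mem k.2 (hle h2)
  rwa [mul_inv_cancel_left] at this

lemma ncard_orbit_dvd_index {G X : Type*} [Group G] [Finite G] [MulAction G X] {K : Subgroup G}
    {x : X} (hle : MulAction.stabilizer G x ≤ K) :
    (MulAction.orbit K x).ncard ∣ (MulAction.stabilizer G x).index := by
  have e1 := card_eq_ncard_orbit_mul K x
  rw [inf_eq_right.mpr hle] at e1
  have e2 := (MulAction.stabilizer G x).card_mul_index
  have e3 := K.card_subgroup_dvd_card
  rw [e1, ← e2, mul_comm] at e3
  exact Nat.dvd_of_mul_dvd_mul_left Nat.card_pos e3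

lemma mem_orbit_of_levelH_eq {K : Subgroup AutPSL34}
    (hK : MulAction.stabilizer AutPSL34 herm₀ ≤ K) {M N : Vert280} (h : levelH M = levelH N)
    (hM : M ∈ MulAction.orbit K herm₀) : N ∈ MulAction.orbit K herm₀ := by
  obtain ⟨α, hα, hα'⟩ := exists_aut_smul_eq_of_level h
  rw [← hα']
  exact smul_mem_orbit_of_mem (hK hα) hM

lemma levelH_herm₁ : levelH herm₁ = 1 := by decide +kernel

lemma levelH_hermBase_levelH : ∀ M : Vert280, levelH (hermBase (levelH M)) = levelH M := by
  decide +kernel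

lemma not_card_dvd_of_one_notMem : ∀ T : Finset (Fin 5), 0 ∈ T → 1 ∉ T → T ≠ {0} →
    ¬ (Finset.univ.filter fun M : Vert280 => ∃ l ∈ T, levelH M = l).card ∣ 280 := by
  decide +kernel

/-- The stabilizer of a vertex is a maximal subgroup. The orbit of the vertex under a larger
subgroup is a union of spheres, and its length divides `280`. If it contains the neighbours, then it
contains all vertices by connectedness; all the other unions are excluded by their length. -/
lemma isCoatom_stabilizer_herm₀ : IsCoatom (MulAction.stabilizer AutPSL34 herm₀) := by
  refine ⟨fun h => ?_, fun K hK => ?_⟩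
  · have := index_stabilizer_aut herm₀
    rw [h, Subgroup.index_top] at this
    norm_num at this
  by_cases h1 : herm₁ ∈ MulAction.orbit K herm₀
  · refine eq_top_of_stabilizer_le hK.le fun M => ?_
    refine exists_smul_eq_of_connected (G := K) connected_graph280 ?_ ?_ M
    · intro k x y h
      exact aut_smul_adj (k : AutPSL34) h
    · intro M hM
      refine mem_orbit_of_levelH_eq hK.le ?_ h1
      rw [(levelH_eq_one_iff M).mpr hM]
      exact levelH_herm₁
  · exfalso
    obtain ⟨k, hk, hkS⟩ := SetLike.exists_of_lt hK
    classical
    let T : Finset (Fin 5) := Finset.univ.filter fun l => hermBase l ∈ MulAction.orbit K herm₀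
    have hT : MulAction.orbit K herm₀ =
        ((Finset.univ.filter fun M : Vert280 => ∃ l ∈ T, levelH M = l : Finset Vert280) :
          Set Vert280) := by
      ext M
      simp only [Finset.coe_filter, Finset.mem_univ, true_and, Set.mem_ofPred_eq, T,
        Finset.mem_filter]
      constructor
      · intro hM
        exact ⟨⟨levelH M, levelH_lt_five M⟩,
          mem_orbit_of_levelH_eq hK.le (levelH_hermBase_levelH M).symm hM, rfl⟩
      · rintro ⟨l, hl, hl'⟩
        rw [← hl'] at hl
        exact mem_orbit_of_levelH_eq hK.le (levelH_hermBase_levelH M) hl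
    have hdvd := ncard_orbit_dvd_index hK.le
    rw [index_stabilizer_aut] at hdvd
    refine not_card_dvd_of_one_notMem T ?_ ?_ ?_ ?_
    · simp only [T, Finset.mem_filter, Finset.mem_univ, true_and]
      exact MulAction.mem_orbit_self herm₀
    · simp only [T, Finset.mem_filter, Finset.mem_univ, true_and]
      exact h1
    · intro h0
      apply hkS
      have h2 := smul_mem_orbit_subgroup hk herm₀
      rw [hT, h0] at h2
      have h3 : levelH (k • herm₀ : Vert280) = 0 := by simpa using h2
      exact (levelH_eq_zero _).mp h3
    · rw [hT, Set.ncard_coe_finset] at hdvd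
      convert hdvd

lemma exists_mem_sylowAt_smul_eq {M N N' : Vert280} (h : graph280.Adj M N)
    (h' : graph280.Adj M N') : ∃ g ∈ sylowAt M, g • N = N' := by
  obtain ⟨k, rfl⟩ := psl_transitive M
  have e : ∀ N, graph280.Adj (k • herm₀) N → graph280.Adj herm₀ (k⁻¹ • N) := fun N h => by
    simpa using psl_smul_adj k⁻¹ h
  obtain ⟨g, hg, hg'⟩ := exists_mem_smul_eq_herm₁ (e N h)
  obtain ⟨x, hx, hx'⟩ := exists_mem_smul_eq_herm₁ (e N' h')
  refine ⟨k * (x⁻¹ * g) * k⁻¹, ?_, ?_⟩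
  · rw [sylowAt_smul, sylowAt_herm₀]
    exact Subgroup.smul_mem_pointwise_smul _ (MulAut.conj k) _
      (mul_mem (inv_mem hx) hg : x⁻¹ * g ∈ heisenbergSubgroup)
  · rw [mul_smul, mul_smul, mul_smul, hg', ← hx', inv_smul_smul, smul_inv_smul]

/-- No automorphism of order `7` fixes a vertex: it would centralize the Sylow `3`-subgroup of the
vertex and fix one of the `9` neighbours, hence all of them, on which the Sylow subgroup is
transitive; by connectedness it would fix all vertices. -/
lemma orderOf_ne_seven {c : AutPSL34} {M : Vert280} (hM : c • M = M) : orderOf c ≠ 7 := by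
  intro ho
  have : Fact (Nat.Prime 7) := ⟨by norm_num⟩
  have h7 : c ^ 7 = 1 := ho ▸ pow_orderOf_eq_one c
  have cent : ∀ M : Vert280, c • M = M → ∀ g ∈ sylowAt M, c g = g := by
    intro M hM
    let F : Subgroup L34 := (sylowAt M : Subgroup L34) ⊓
      MonoidHom.eqLocus c.toMonoidHom (MonoidHom.id L34)
    have hle : F ≤ (sylowAt M : Subgroup L34) := inf_le_left
    have hmod := ncard_modEq_ncard_fixed (X := L34) h7 (S := (sylowAt M : Set L34))
      (fun g hg => by
        have := aut_apply_mem_sylowAt (α := c) hg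
        rw [hM] at this
        exact this)
    have hF : {x ∈ (sylowAt M : Set L34) | c • x = x} = (F : Set L34) := rfl
    have h9 : Nat.card (sylowAt M) = 9 := card_sylow3 _
    have h9' : (sylowAt M : Set L34).ncard = 9 := h9
    have hF' : (F : Set L34).ncard = Nat.card F := rfl
    rw [hF, h9', hF'] at hmod
    have hdvd : Nat.card F ∣ 9 := h9 ▸ Subgroup.card_dvd_of_le hle
    have hcard : Nat.card F = 9 := by
      unfold Nat.ModEq at hmod
      have := Nat.le_of_dvd (by norm_num) hdvd
      interval_cases Nat.card F <;> omega
    have heq : F = (sylowAt M : Subgroup L34) :=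
      Subgroup.eq_of_le_of_card_ge hle (by rw [hcard]; exact h9.le)
    intro g hg
    have : g ∈ F := heq ▸ hg
    exact this.2
  have nbr : ∀ M N : Vert280, graph280.Adj M N → c • M = M → c • N = N := by
    intro M N hN hM
    have hmod := ncard_modEq_ncard_fixed h7 (S := graph280.neighborSet M) (fun y hy => by
      have := aut_smul_adj c hy
      rw [hM] at this
      exact this)
    rw [isSphereTransitive_graph280.ncard_neighborSet M] at hmod
    obtain ⟨y, hy, hy'⟩ : {y ∈ graph280.neighborSet M | c • y = y}.Nonempty := by
      refine Set.nonempty_of_ncard_ne_zero fun h0 => ?_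
      rw [h0] at hmod
      norm_num [Nat.ModEq] at hmod
    obtain ⟨g, hg, rfl⟩ := exists_mem_sylowAt_smul_eq hy hN
    rw [aut_smul_smul, cent M hM g hg, hy']
  have all : ∀ N : Vert280, c • N = N := by
    intro N
    obtain ⟨p⟩ := connected_graph280 M N
    induction p with
    | nil => exact hM
    | cons ha _ ih => exact ih (nbr _ _ ha hM)
  have h1 : c = 1 := by
    ext l
    have : l⁻¹ * c l = 1 := eq_one_of_smul_eq fun N => by
      have h := aut_smul_smul c l N
      rw [all, all] at h
      rw [mul_smul, inv_smul_eq_iff, ← h]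
    rw [MulAut.one_apply, ← inv_mul_eq_one.mp this]
  rw [h1, orderOf_one] at ho
  norm_num at ho

lemma card_eq_relIndex_mul {G : Type*} [Group G] (H K : Subgroup G) :
    Nat.card K = H.relIndex K * Nat.card (H ⊓ K : Subgroup G) := by
  rw [Subgroup.relIndex, ← (H.subgroupOf K).card_mul_index, mul_comm,
    ← Subgroup.inf_subgroupOf_right, Nat.card_congr (Subgroup.subgroupOfEquivOfLe
      (inf_le_right : H ⊓ K ≤ K)).toEquiv]

lemma range_conj_normal : (MulAut.conj : L34 →* AutPSL34).range.Normal where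
  conj_mem := by
    rintro _ ⟨l, rfl⟩ α
    refine ⟨α l, ?_⟩
    ext x
    simp [MulAut.conj_apply]

/-- A subgroup of index `280` does not contain the inner automorphisms. It has the same order as the
stabilizer of a vertex, so that `7` would divide this order, which contradicts `orderOf_ne_seven`. -/
lemma not_range_conj_le {H : Subgroup AutPSL34} (hidx : H.index = 280) :
    ¬ (MulAut.conj : L34 →* AutPSL34).range ≤ H := by
  intro hle
  have : Fact (Nat.Prime 7) := ⟨by norm_num⟩
  set I := (MulAut.conj : L34 →* AutPSL34).range with hI
  have hS := (MulAction.stabilizer AutPSL34 herm₀).card_mul_index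
  have hH := H.card_mul_index
  rw [index_stabilizer_aut] at hS
  rw [hidx] at hH
  have h1 := card_eq_ncard_orbit_mul I herm₀
  have h2 : MulAction.orbit I herm₀ = Set.univ := by
    refine Set.eq_univ_of_forall fun M => ?_
    obtain ⟨l, hl⟩ := psl_transitive M
    exact ⟨⟨MulAut.conj l, l, rfl⟩, (conj_smul l herm₀).trans hl⟩
  rw [h2, Set.ncard_univ, Nat.card_eq_fintype_card (α := Vert280), card_vert280] at h1
  have h3 := Subgroup.card_dvd_of_le hle
  have h7 : 7 ∣ Nat.card (MulAction.stabilizer AutPSL34 herm₀) := by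
    have : Nat.card (MulAction.stabilizer AutPSL34 herm₀) = Nat.card H :=
      Nat.eq_of_mul_eq_mul_right (by norm_num : 0 < 280) (hS.trans hH.symm)
    rw [this]
    obtain ⟨m, hm⟩ := h3
    rw [hm, h1, show 280 = 7 * 40 by norm_num, mul_assoc, mul_assoc]
    exact dvd_mul_right _ _
  obtain ⟨c, hc⟩ := exists_prime_orderOf_dvd_card' 7 h7
  exact orderOf_ne_seven (c := c.1) c.2 (by rwa [Subgroup.orderOf_coe])

/-- The elements of `PSL₃(4)` whose inner automorphisms lie in a maximal subgroup of index `280`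
form a subgroup of order `72`. -/
lemma card_comap_conj {H : Subgroup AutPSL34} (hH : IsCoatom H) (hidx : H.index = 280) :
    Nat.card (H.comap (MulAut.conj : L34 →* AutPSL34)) = 72 := by
  have hnormal : (MulAut.conj : L34 →* AutPSL34).range.Normal := range_conj_normal
  have htop : H ⊔ (MulAut.conj : L34 →* AutPSL34).range = ⊤ :=
    hH.2 _ (lt_of_le_of_ne le_sup_left fun h => not_range_conj_le hidx (h ▸ le_sup_right))
  have e5 : (H.comap (MulAut.conj : L34 →* AutPSL34)).index =
      H.relIndex (MulAut.conj : L34 →* AutPSL34).range := Subgroup.index_comap H _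
  have e6 := (H.comap (MulAut.conj : L34 →* AutPSL34)).card_mul_index
  generalize (MulAut.conj : L34 →* AutPSL34).range = I at *
  have e1 := card_eq_relIndex_mul H I
  have e2 := card_eq_relIndex_mul I H
  have e3 := I.card_mul_index
  have e4 := H.card_mul_index
  rw [← Subgroup.relIndex_sup_right, htop, Subgroup.relIndex_top_right, inf_comm] at e2
  have hpos : 0 < Nat.card (H ⊓ I : Subgroup AutPSL34) := Nat.card_pos
  have hpos' : 0 < I.index := Nat.pos_of_ne_zero Subgroup.index_ne_zero_of_finite
  rw [hidx, e2] at e4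
  rw [e1, ← e4] at e3
  have e7 : H.relIndex I = 280 := by
    have : (Nat.card (H ⊓ I : Subgroup AutPSL34) * I.index) * H.relIndex I =
        (Nat.card (H ⊓ I : Subgroup AutPSL34) * I.index) * 280 := by
      linarith
    exact Nat.eq_of_mul_eq_mul_left (Nat.mul_pos hpos hpos') this
  rw [e5, e7, card_L34] at e6
  omega

lemma inf_stabilizer_eq_bot (P : Sylow 3 L34) {M : Vert280} (hM : M ≠ fixedVertex P) :
    (P : Subgroup L34) ⊓ MulAction.stabilizer L34 M = ⊥ := by
  rw [eq_bot_iff]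
  rintro x ⟨hx, hx'⟩
  by_contra h0
  exact hM (eq_fixedVertex hx h0 hx')

lemma orbit_subgroup_subset {G X : Type*} [Group G] [MulAction G X] {K N : Subgroup G} (h : K ≤ N)
    {x y : X} (hx : x ∈ MulAction.orbit N y) : MulAction.orbit K x ⊆ MulAction.orbit N y := by
  rintro _ ⟨k, rfl⟩
  exact smul_mem_orbit_of_mem (h k.2) hx

/-- A subgroup `N` of `PSL₃(4)` of order `72` that contains a Sylow `3`-subgroup `P` fixes the
fixed vertex of `P`: its orbit has a length that divides `8`, and `P` has orbits of length `9` on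
the other vertices. -/
lemma smul_fixedVertex_of_card {N : Subgroup L34} (hN : Nat.card N = 72) {P : Sylow 3 L34}
    (hP : (P : Subgroup L34) ≤ N) {g : L34} (hg : g ∈ N) : g • fixedVertex P = fixedVertex P := by
  have hPcard : Nat.card (P : Subgroup L34) = 9 := card_sylow3 P
  have horb := card_eq_ncard_orbit_mul N (fixedVertex P)
  have h9 : 9 ∣ Nat.card (N ⊓ MulAction.stabilizer L34 (fixedVertex P) : Subgroup L34) := by
    rw [← hPcard]
    exact Subgroup.card_dvd_of_le fun g hg => ⟨hP hg, smul_fixedVertex hg⟩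
  obtain ⟨m, hm⟩ := h9
  rw [hN, hm] at horb
  have hle8 : (MulAction.orbit N (fixedVertex P)).ncard ≤ 8 := by
    have h8 : (MulAction.orbit N (fixedVertex P)).ncard * m = 8 := by
      have : 9 * ((MulAction.orbit N (fixedVertex P)).ncard * m) = 9 * 8 := by
        rw [mul_left_comm, ← horb]
      exact Nat.eq_of_mul_eq_mul_left (by norm_num) this
    exact Nat.le_of_dvd (by norm_num) (Dvd.intro _ h8)
  by_contra hne
  have h1 := card_eq_ncard_orbit_mul (P : Subgroup L34) (g • fixedVertex P)
  rw [inf_stabilizer_eq_bot P hne, Subgroup.card_bot, mul_one, hPcard] at h1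
  have h3 : (MulAction.orbit (P : Subgroup L34) (g • fixedVertex P)).ncard ≤
      (MulAction.orbit N (fixedVertex P)).ncard :=
    Set.ncard_le_ncard (orbit_subgroup_subset hP (smul_mem_orbit_subgroup hg _)) (Set.toFinite _)
  omega

lemma exists_sylow_le {N : Subgroup L34} (hN : Nat.card N = 72) :
    ∃ P : Sylow 3 L34, (P : Subgroup L34) ≤ N := by
  obtain ⟨Q, hQ, -⟩ := Sylow.exists_subgroup_card_pow_prime_le (G := N) 3 (n := 0) (m := 2)
    (by rw [hN]; norm_num) ⊥ (by simp) (by norm_num)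
  have hQ' : Nat.card (Q.map N.subtype) = 9 := by
    rw [Subgroup.card_map_of_injective N.subtype_injective, hQ]; norm_num
  refine ⟨Sylow.ofCard (Q.map N.subtype) (by rw [hQ', factorization_card_L34]; norm_num), ?_⟩
  rintro g ⟨x, -, rfl⟩
  exact x.2

/-- A maximal subgroup `H` of index `280` is the stabilizer of a vertex, namely of the fixed vertex
of a Sylow `3`-subgroup of `PSL₃(4)` whose inner automorphisms lie in `H`. -/
lemma exists_eq_stabilizer_vert280 {H : Subgroup AutPSL34} (hH : IsCoatom H)
    (hidx : H.index = 280) : ∃ M : Vert280, H = MulAction.stabilizer AutPSL34 M := by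
  have hN := card_comap_conj hH hidx
  obtain ⟨P, hP⟩ := exists_sylow_le hN
  have hPM : sylowAt (fixedVertex P) = P := sylowAt_eq_iff.mpr fun g hg => smul_fixedVertex hg
  have hle : H ≤ MulAction.stabilizer AutPSL34 (fixedVertex P) := by
    intro α hα
    rw [MulAction.mem_stabilizer_iff]
    refine aut_smul_eq fun g hg => ?_
    rw [hPM] at hg
    refine smul_fixedVertex_of_card hN hP ?_
    have h1 : MulAut.conj (α g) = α * MulAut.conj g * α⁻¹ := by
      ext x
      simp [MulAut.conj_apply]
    rw [Subgroup.mem_comap, h1]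
    exact mul_mem (mul_mem hα (Subgroup.mem_comap.mp (hP hg))) (inv_mem hα)
  refine ⟨fixedVertex P, Subgroup.eq_of_le_of_card_ge hle ?_⟩
  have e1 := H.card_mul_index
  have e2 := (MulAction.stabilizer AutPSL34 (fixedVertex P)).card_mul_index
  rw [hidx] at e1
  rw [index_stabilizer_aut] at e2
  omega

theorem graph280_conclusion :
    (∃ (H : Subgroup AutPSL34) (Γ : SimpleGraph (AutPSL34 ⧸ H)),
      IsCoatom H ∧ H.index = 280 ∧ IsDistanceTransitiveOrbitalGraph H 9 Γ) ∧
    ∀ (H : Subgroup AutPSL34) (Γ : SimpleGraph (AutPSL34 ⧸ H)), IsCoatom H → H.index = 280 →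
      IsDistanceTransitiveOrbitalGraph H 9 Γ →
        IsGeodesicTransitive Γ 3 ∧ ¬ IsGeodesicTransitive Γ 4 := by
  have h := isSphereTransitive_graph280.orbital_conclusion isGeodesicTransitive_three_graph280
    not_isGeodesicTransitive_four_graph280 (fun H => IsCoatom H ∧ H.index = 280)
    ⟨isCoatom_stabilizer_herm₀, index_stabilizer_aut herm₀⟩
    (fun H Γ hH _ => exists_eq_stabilizer_vert280 hH.1 hH.2)
  refine ⟨?_, fun H Γ h1 h2 => h.2 H Γ ⟨h1, h2⟩⟩
  obtain ⟨H, Γ, hH, hΓ⟩ := h.1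
  exact ⟨H, Γ, hH.1, hH.2, hΓ⟩

end Index280

theorem lemma3p1 :
    -- the Paley graphs `P(13)`, `P(17)`, `P(25)`
    (∀ (F : Type*) [Field F] [Fintype F] (hF : Fintype.card F % 4 = 1),
      Fintype.card F = 13 ∨ Fintype.card F = 17 ∨ Fintype.card F = 25 →
        IsGeodesicTransitive (paleyGraph F hF) 1 ∧ ¬ IsGeodesicTransitive (paleyGraph F hF) 2) ∧
    -- the graph on 22 vertices
    (IsGeodesicTransitive graph22 2 ∧ ¬ IsGeodesicTransitive graph22 3) ∧
    -- the graph on 64 vertices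
    (IsGeodesicTransitive graph64 2 ∧ ¬ IsGeodesicTransitive graph64 3) ∧
    -- the graph on 68 vertices: it exists, and it has the property
    ((∃ (H : Subgroup PGammaL216) (Γ : SimpleGraph (PGammaL216 ⧸ H)),
        H.index = 68 ∧ IsDistanceTransitiveOrbitalGraph H 12 Γ) ∧
      ∀ (H : Subgroup PGammaL216) (Γ : SimpleGraph (PGammaL216 ⧸ H)),
        H.index = 68 → IsDistanceTransitiveOrbitalGraph H 12 Γ →
          IsGeodesicTransitive Γ 2 ∧ ¬ IsGeodesicTransitive Γ 3) ∧
    -- the graph on 280 vertices: it exists, and it has the property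
    ((∃ (H : Subgroup AutPSL34) (Γ : SimpleGraph (AutPSL34 ⧸ H)),
        IsCoatom H ∧ H.index = 280 ∧ IsDistanceTransitiveOrbitalGraph H 9 Γ) ∧
      ∀ (H : Subgroup AutPSL34) (Γ : SimpleGraph (AutPSL34 ⧸ H)),
        IsCoatom H → H.index = 280 → IsDistanceTransitiveOrbitalGraph H 9 Γ →
          IsGeodesicTransitive Γ 3 ∧ ¬ IsGeodesicTransitive Γ 4) := by
  exact ⟨fun F _ _ hF h => paleyGraph_conclusion F hF h,
    ⟨isGeodesicTransitive_two_graph22, not_isGeodesicTransitive_three_graph22⟩,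
    graph64_conclusion, graph68_conclusion, graph280_conclusion⟩
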